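/- **Setting.** Let $D\subseteq\mathbb R^d$ be open, $f:D\to\mathbb R$ bounded below, $\mathsf P$ a probability distribution, and $f(\cdot,\xi):D\to\mathbb R$ component functions. Let $L_0,L_\rho,\sigma\ge 0$, $0\le\rho<1$, $\lambda>0$, and assume: * $f$ and every $f(\cdot,\xi)$ are $(L_0,L_\rho)$-smooth on $D$: twice differentiable on $D$ with $\|\nabla^2 h(x)\|\le L_0+L_\rho\|\nabla h(x)\|^\rho$ for almost every $x\in D$ ($h=f$ or $h=f(\cdot,\xi)$; Euclidean and spectral norms, $u^0=1$); * for every $x\in D$, $\mathbb E_{\xi\sim\mathsf P}[\nabla f(x,\xi)]=\nabla f(x)$ and $\|\nabla f(x,\xi)-\nabla f(x)\|\le\sigma$ almost surely. **Algorithm (VRAdam)**, with parameters $\eta,\beta,\beta_2,\lambda,T,S_1$ and initial point $x_1\in D$. Operations on vectors are coordinatewise. Let $m_1$ be the average of $\nabla f(x_1,\cdot)$ over a batch of $S_1$ samples, $v_1=\beta_2m_1^2$ and $x_2=x_1-\eta m_1/(|m_1|+\lambda)$. For $t=2,\dots,T$ draw a new sample $\xi_t$ and put $$m_t=(1-\beta)m_{t-1}+\beta\nabla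 f(x_t,\xi_t)+(1-\beta)\bigl(\nabla f(x_t,\xi_t)-\nabla f(x_{t-1},\xi_t)\bigr),$$ $$v_t=(1-\beta_2)v_{t-1}+\beta_2(\nabla f(x_t,\xi_t))^2,\qquad \hat v_t=\frac{v_t}{1-(1-\beta_2)^t},\qquad x_{t+1}=x_t-\frac{\eta}{\sqrt{\hat v_t}+\lambda}\odot m_t,$$ where $\hat v_t:=0$ if $\beta_2=0$. The batch samples and $\xi_2,\dots,\xi_T$ are i.i.d. from $\mathsf P$, and almost surely the segments $[x_t,x_{t+1}]$, $1\le t\le T$, lie in $D$ (no condition if $D=\mathbb R^d$). **Notation.** $\Delta_1=f(x_1)-\inf_D f$, and for $G>0$ $$L=3L_0+4L_\rho G^\rho,\qquad r=\min\Bigl\{\tfrac1{5L_\rho G^{\rho-1}},\tfrac1{5(L_0^{\rho-1}L_\rho)^{1/\rho}}\Bigr\},\qquad \theta=40L\sqrt G\,\lambda^{-3/2},$$ where the second entry of $r$ is omitted if $\rho=0$ or $L_0=0$. Here and below a quotient of a positive number by $0$ is $+\infty$. **Theorem.** There are numerical constants $c,C>0$ such that the following holds. (a) Let $0<\delta<1$,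 $0\le\rho<1$, $\varepsilon>0$, $0\le\beta_2\le1$, and let $G>0$ satisfy $$G\ge\max\Bigl\{2\lambda,\;2\sigma,\;2\|\nabla f(x_1)\|,\;\tfrac{C\Delta_1L_0}{\delta\lambda},\;\bigl(\tfrac{C\Delta_1L_\rho}{\delta\lambda}\bigr)^{\frac1{1-\rho}}\Bigr\}.$$ Choose $\eta>0$, $\beta$, $T$ and $S_1$ with $$\eta\le c\min\Bigl\{\tfrac{r\lambda}{G},\;\tfrac{\lambda}{L},\;\tfrac{\lambda^2G\delta}{\Delta_1L^2},\;\tfrac{\lambda^2\sqrt\delta\,\varepsilon}{\sigma GL}\Bigr\},\quad \beta=\theta^2\eta^2\le1,\quad T=\Bigl\lceil\tfrac{C\,G\Delta_1}{\eta\delta\varepsilon^2}\Bigr\rceil,\quad S_1\ge\tfrac1{2\beta^2T}.$$ Then, with probability at least $1-\delta$, $\|\nabla f(x_t)\|\le G$ for every $1\le t\le T$ and $$\frac1T\sum_{t=1}^T\|\nabla f(x_t)\|^2\le\varepsilon^2 .$$ (b) Dimension-free $O(\varepsilon^{-3})$ gradient complexity: suppose moreover $\Delta_1>0$ and $L_0+L_\rho>0$.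 Then there is a $K$ depending only on $\delta,\rho,\lambda,\sigma,L_0,L_\rho,\Delta_1,\|\nabla f(x_1)\|,G$ (in particular not on $d$ or $\varepsilon$) such that for every $0<\varepsilon\le1$ the parameters $\eta,\beta,T,S_1$ can be chosen as in (a) so that VRAdam evaluates at most $K\varepsilon^{-3}$ stochastic gradients, their number being $S_1+2(T-1)$. -/

import Mathlib

open MeasureTheory ProbabilityTheory
open scoped ENNReal

namespace VRAdam

/-- `ℝ^d` with the Euclidean norm. -/
abbrev Vec (d : ℕ) : Type := EuclideanSpace ℝ (Fin d)

/-- `(L₀, L_ρ)`-smoothness on the open domain `D`: the function is twice differentiable on `D`, and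
`‖∇²f(x)‖ ≤ L₀ + L_ρ ‖∇f(x)‖^ρ` (spectral norm of the Hessian) for almost every `x ∈ D`. -/
def GenSmoothOn {d : ℕ} (D : Set (Vec d)) (ρ L₀ Lρ : ℝ) (f : Vec d → ℝ) : Prop :=
  DifferentiableOn ℝ f D ∧ DifferentiableOn ℝ (gradient f) D ∧
    ∀ᵐ x ∂(volume.restrict D), ‖fderiv ℝ (gradient f) x‖ ≤ L₀ + Lρ * ‖gradient f x‖ ^ ρ

/-- The stochastic gradient `∇f(x, ξ)`: the gradient in `x` of the component function `f(·, ξ)`. -/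
noncomputable def sgrad {d : ℕ} {Ξ : Type*} (F : Vec d → Ξ → ℝ) (x : Vec d) (ξ : Ξ) : Vec d :=
  gradient (fun y => F y ξ) x

/-- The quantities attached to time `t`: the iterate `x_t`, the momenta `m_t` and `v_t`,
and the next iterate `x_{t+1}`. -/
structure State (d : ℕ) where
  x : Vec d
  m : Vec d
  v : Vec d
  next : Vec d

section Algorithm

variable {d : ℕ} {Ξ : Type*} (F : Vec d → Ξ → ℝ) (η β βsq lam : ℝ)

/-- The initialization (time `t = 1`): `m₁` is the average of the stochastic gradients over the
batch, `v₁ = β_sq m₁²`, `x₁ = x_init`, `x₂ = x_init - η m₁ / (|m₁| + λ)` coordinatewise. -/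
noncomputable def initState (xinit : Vec d) {S₁ : ℕ} (batch : Fin S₁ → Ξ) : State d :=
  let m₁ : Vec d := (S₁ : ℝ)⁻¹ • ∑ j, sgrad F xinit (batch j)
  { x := xinit
    m := m₁
    v := WithLp.toLp 2 fun i => βsq * m₁ i ^ 2
    next := WithLp.toLp 2 fun i => xinit i - η * m₁ i / (|m₁ i| + lam) }

/-- The update at time `t ≥ 2` with the new sample `ξ`, from the state `s` of time `t - 1`.
(For `β_sq = 0` one has `v_t = 0`, and `v̂_t = 0 / 0` is read as `0`.) -/
noncomputable def stepState (t : ℕ) (ξ : Ξ) (s : State d) : State d :=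
  let x : Vec d := s.next
  let g : Vec d := sgrad F x ξ
  let m : Vec d := (1 - β) • s.m + β • g + (1 - β) • (g - sgrad F s.x ξ)
  let v : Vec d := WithLp.toLp 2 fun i => (1 - βsq) * s.v i + βsq * g i ^ 2
  let vhat : Vec d := WithLp.toLp 2 fun i => v i / (1 - (1 - βsq) ^ t)
  { x := x
    m := m
    v := v
    next := WithLp.toLp 2 fun i => x i - η / (√(vhat i) + lam) * m i }

/-- `state k` is the state at time `t = k + 1`; the sample drawn at time `t ≥ 2` is `ξ t`. -/
noncomputable def state (xinit : Vec d) {S₁ : ℕ} (batch : Fin S₁ → Ξ) (ξ : ℕ → Ξ) : ℕ → State d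
  | 0 => initState F η βsq lam xinit batch
  | k + 1 => stepState F η β βsq lam (k + 2) (ξ (k + 2)) (state xinit batch ξ k)

/-- The iterate `x_t` of VRAdam, for `t ≥ 1`. -/
noncomputable def iter (xinit : Vec d) {S₁ : ℕ} (batch : Fin S₁ → Ξ) (ξ : ℕ → Ξ) (t : ℕ) : Vec d :=
  (state F η β βsq lam xinit batch ξ (t - 1)).x

end Algorithm

/-- The number of stochastic gradients evaluated by VRAdam: `S₁` at the initialization
and two in each of the iterations `t = 2, …, T`. -/
def gradEvals (S₁ T : ℕ) : ℕ := S₁ + 2 * (T - 1)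

/-- `Δ₁ = f(x₁) - inf_D f`. -/
noncomputable def initGap {d : ℕ} (D : Set (Vec d)) (f : Vec d → ℝ) (x₁ : Vec d) : ℝ :=
  f x₁ - sInf (f '' D)

/-- `L = 3 L₀ + 4 L_ρ G^ρ`. -/
noncomputable def effL (ρ L₀ Lρ G : ℝ) : ℝ := 3 * L₀ + 4 * Lρ * G ^ ρ

/-- `r = min {1 / (5 L_ρ G^(ρ-1)), 1 / (5 (L₀^(ρ-1) L_ρ)^(1/ρ))}`, with `1 / 0 = ∞`; the second
entry is meaningful for `ρ > 0` and `L₀ > 0` only, and is `∞` if `ρ = 0` or `L₀ = 0`. -/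
noncomputable def effR (ρ L₀ Lρ G : ℝ) : ℝ≥0∞ :=
  min (ENNReal.ofReal (5 * Lρ * G ^ (ρ - 1)))⁻¹
    (if ρ = 0 ∨ L₀ = 0 then ∞ else (ENNReal.ofReal (5 * (L₀ ^ (ρ - 1) * Lρ) ^ (1 / ρ)))⁻¹)

/-- `min {r λ / G, λ / L, λ² G δ / (Δ₁ L²), λ² √δ ε / (σ G L)}`, where a quotient of a positive
number by zero is `∞`. -/
noncomputable def stepBound (δ ρ lam σ L₀ Lρ Δ ε G : ℝ) : ℝ≥0∞ :=
  let L := effL ρ L₀ Lρ G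
  min (min (effR ρ L₀ Lρ G * ENNReal.ofReal (lam / G)) (ENNReal.ofReal lam / ENNReal.ofReal L))
    (min (ENNReal.ofReal (lam ^ 2 * G * δ) / ENNReal.ofReal (Δ * L ^ 2))
      (ENNReal.ofReal (lam ^ 2 * √δ * ε) / ENNReal.ofReal (σ * G * L)))

/-- `G` is large enough (`g₁` stands for `‖∇f(x₁)‖`, and `Δ` for `Δ₁`). -/
structure LargeG (C δ ρ lam σ L₀ Lρ Δ g₁ G : ℝ) : Prop where
  pos : 0 < G
  lam_le : 2 * lam ≤ G
  sigma_le : 2 * σ ≤ G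
  grad_le : 2 * g₁ ≤ G
  zero_le : C * Δ * L₀ / (δ * lam) ≤ G
  rho_le : (C * Δ * Lρ / (δ * lam)) ^ (1 / (1 - ρ)) ≤ G

/-- The choice of `η`, `β`, `T` and `S₁`. -/
structure Choice (c C δ ρ lam σ L₀ Lρ Δ ε G η β : ℝ) (T S₁ : ℕ) : Prop where
  eta_pos : 0 < η
  eta_le : ENNReal.ofReal η ≤ ENNReal.ofReal c * stepBound δ ρ lam σ L₀ Lρ Δ ε G
  beta_eq : β = (40 * effL ρ L₀ Lρ G * √G * lam ^ (-(3 / 2) : ℝ)) ^ 2 * η ^ 2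
  beta_le : β ≤ 1
  T_eq : T = ⌈C * (G * Δ / (η * δ * ε ^ 2))⌉₊
  batch_le : (ENNReal.ofReal (2 * β ^ 2 * T))⁻¹ ≤ S₁

end VRAdam

/-!
A bound on the Hessian that is continuous in `x` and holds almost everywhere holds everywhere: by
Fubini it can be integrated along almost every parallel translate of a segment, hence along the
segment itself, and on small balls this bounds the derivative of the gradient at the centre.

Stop the run at the first state where the gradient or the momentum error exceeds `G`, or where the
next step is not controlled. Up to that time a step has length at most `2 η G / λ`, which is short
compared with `r`. Along it the gradients of `f` and, almost surely, of its components stay below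
a multiple of `G`, so the Hessian bound makes them Lipschitz with constant `L`.

For `f` this gives a decrease by a multiple of `η ‖∇f(x_t)‖² / G`, up to a loss proportional to
`η ‖m_t - ∇f(x_t)‖² / λ`. For the components it gives the variance reduction: since the new sample
is independent of the past, the expected squared momentum error contracts by `1 - β / 2`, up to the
noise `2 β² σ²` and a drift proportional to `η² ‖m_t‖²`, which `β = θ² η²` makes small compared with
the decrease of `f`. Together the two inequalities bound, along the stopped run, the expected totals
of squared gradients and squared errors and the expected squared error at the exit. By Markov's
inequality, with probability at least `1 - δ` none of the three is large. Then the error at the exit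
is at most `G`, and so is the gradient, because it can climb from `G / 2` to `G` only through steps
that the totals control. Hence the run is never stopped, and the total of squared gradients along
it is the one to be bounded.

For the complexity take `η` proportional to `ε`: then `T` is of order `ε⁻³` and `β` of order `ε²`,
so that `1 / (2 β² T)` is of order `ε⁻¹`.
-/

namespace VRAdam

section MeanValue

variable {E F : Type*} [NormedAddCommGroup E] [NormedSpace ℝ E] [NormedAddCommGroup F]
  [NormedSpace ℝ F]

theorem norm_sub_le_of_ae_norm_deriv_le [CompleteSpace F] {φ : ℝ → F} {a b M : ℝ} (hab : a ≤ b)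
    (hc : ContinuousOn φ (Set.Icc a b)) (hd : DifferentiableOn ℝ φ (Set.Ioo a b))
    (hM : ∀ᵐ t : ℝ, t ∈ Set.Ioo a b → ‖deriv φ t‖ ≤ M) : ‖φ b - φ a‖ ≤ M * (b - a) := by
  have hderiv : ∀ t ∈ Set.Ioo a b, HasDerivAt φ (deriv φ t) t := fun t ht =>
    (hd.differentiableAt (isOpen_Ioo.mem_nhds ht)).hasDerivAt
  have hM' : ∀ᵐ t : ℝ, t ∈ Set.uIoc a b → ‖deriv φ t‖ ≤ M := by
    rw [Set.uIoc_of_le hab]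
    filter_upwards [hM, Measure.ae_ne volume b] with t ht hne hmem
    exact ht ⟨hmem.1, hmem.2.lt_of_ne hne⟩
  have hint : IntervalIntegrable (deriv φ) volume a b := by
    rw [intervalIntegrable_iff]
    exact Measure.integrableOn_of_bounded (M := M) (by simp) (aestronglyMeasurable_deriv _ _)
      ((ae_restrict_iff' measurableSet_uIoc).2 hM')
  rw [← intervalIntegral.integral_eq_sub_of_hasDerivAt_of_le hab hc hderiv hint,
    ← abs_of_nonneg (sub_nonneg.2 hab)]
  exact intervalIntegral.norm_integral_le_of_norm_le_const_ae hM'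

/-- If the norm of a curve could reach `2 A`, it would have to grow by `A` in unit time at speed
less than `A`. -/
theorem norm_le_two_mul_of_norm_deriv_lt {φ φ' : ℝ → F} {A : ℝ}
    (hd : ∀ t ∈ Set.Icc (0 : ℝ) 1, HasDerivAt φ (φ' t) t) (h0 : ‖φ 0‖ ≤ A)
    (hlt : ∀ t ∈ Set.Icc (0 : ℝ) 1, ‖φ t‖ ≤ 2 * A → ‖φ' t‖ < A) :
    ∀ t ∈ Set.Icc (0 : ℝ) 1, ‖φ t‖ ≤ 2 * A := by
  have hA : 0 ≤ A := (norm_nonneg _).trans h0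
  have hgrow : ∀ t ∈ Set.Icc (0 : ℝ) 1, ‖φ t‖ ≤ A + t * A := by
    refine image_norm_le_of_norm_deriv_right_lt_deriv_boundary (B := fun t => A + t * A)
      (B' := fun _ => A) (fun t ht => (hd t ht).continuousAt.continuousWithinAt)
      (fun t ht => (hd t (Set.Ico_subset_Icc_self ht)).hasDerivWithinAt) (by simpa using h0)
      (fun t => by simpa using ((hasDerivAt_id t).mul_const A).const_add A) ?_
    intro t ht heq
    exact hlt t (Set.Ico_subset_Icc_self ht) (by rw [heq]; nlinarith [ht.2])
  intro t ht
  nlinarith [hgrow t ht, ht.2]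

section Haar

variable [FiniteDimensional ℝ E] [MeasurableSpace E] [BorelSpace E] {μ : Measure E}
  [μ.IsAddHaarMeasure]

theorem ae_ae_add_smul {p : E → Prop} (hp : ∀ᵐ z ∂μ, p z) (h : E) :
    ∀ᵐ z ∂μ, ∀ᵐ t : ℝ, p (z + t • h) := by
  set N := toMeasurable μ {z | ¬ p z}
  have hN : ∀ᵐ z ∂μ, z ∉ N :=
    measure_eq_zero_iff_ae_notMem.1 ((measure_toMeasurable _).trans (ae_iff.1 hp))
  have hlines : ∀ᵐ t : ℝ, ∀ᵐ z ∂μ, z + t • h ∉ N := .of_forall fun t =>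
    (measurePreserving_add_right μ (t • h)).quasiMeasurePreserving.ae hN
  have hmeas : MeasurableSet {q : ℝ × E | q.2 + q.1 • h ∉ N} :=
    (show Measurable fun q : ℝ × E => q.2 + q.1 • h by fun_prop)
      (measurableSet_toMeasurable _ _).compl
  filter_upwards [(Measure.ae_ae_comm hmeas).1 hlines] with z hz
  filter_upwards [hz] with t ht
  exact not_not.1 fun hn => ht (subset_toMeasurable _ _ hn)

variable [CompleteSpace F] {g : E → F} {s : Set E}

/-- By Fubini, almost every line in a given direction meets the exceptional set in a null set; the
inequality on such lines extends to all lines by continuity. -/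
theorem norm_image_sub_le_of_ae_norm_fderiv_le {M : ℝ} (hs : Convex ℝ s) (hso : IsOpen s)
    (hg : DifferentiableOn ℝ g s) (hM : ∀ᵐ z ∂μ, z ∈ s → ‖fderiv ℝ g z‖ ≤ M) {x y : E}
    (hx : x ∈ s) (hy : y ∈ s) : ‖g y - g x‖ ≤ M * ‖y - x‖ := by
  set h := y - x
  have hxh : x + h = y := add_sub_cancel x y
  have hgd : ∀ z ∈ s, DifferentiableAt ℝ g z := fun z hz => hg.differentiableAt (hso.mem_nhds hz)
  by_contra! hlt
  have hshift : ContinuousAt (fun z => z + h) x := by fun_prop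
  have hshift_mem : ∀ᶠ z in nhds x, z + h ∈ s :=
    hshift.eventually_mem (by rw [hxh]; exact hso.mem_nhds hy)
  have hcont : ContinuousAt (fun z => ‖g (z + h) - g z‖) x := by
    refine (ContinuousAt.sub ?_ (hgd x hx).continuousAt).norm
    exact ContinuousAt.comp (f := fun z => z + h) (by rw [hxh]; exact (hgd y hy).continuousAt)
      hshift
  have hlarge : ∀ᶠ z in nhds x, M * ‖h‖ < ‖g (z + h) - g z‖ :=
    hcont.eventually_const_lt (by simpa only [hxh] using hlt)
  obtain ⟨z, hz, ⟨hzs, hzhs⟩, hzlt⟩ :=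
    (Measure.dense_of_ae (ae_ae_add_smul hM h)).inter_nhds_nonempty
      (((hso.eventually_mem hx).and hshift_mem).and hlarge)
  have hseg : ∀ t ∈ Set.Icc (0 : ℝ) 1, z + t • h ∈ s := fun t ht => by
    simpa using hs.add_smul_sub_mem hzs hzhs ht
  have hder : ∀ t ∈ Set.Icc (0 : ℝ) 1,
      HasDerivAt (fun t : ℝ => g (z + t • h)) (fderiv ℝ g (z + t • h) h) t := fun t ht =>
    (hgd _ (hseg t ht)).hasFDerivAt.comp_hasDerivAt t
      (by simpa using ((hasDerivAt_id t).smul_const h).const_add z)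
  have hle := norm_sub_le_of_ae_norm_deriv_le zero_le_one
    (fun t ht => (hder t ht).continuousAt.continuousWithinAt)
    (fun t ht => (hder t (Set.Ioo_subset_Icc_self ht)).differentiableAt.differentiableWithinAt)
    (M := M * ‖h‖) (by
      filter_upwards [hz] with t ht htI
      have htI := Set.Ioo_subset_Icc_self htI
      rw [(hder t htI).deriv]
      exact ContinuousLinearMap.le_of_opNorm_le _ (ht (hseg t htI)) h)
  simp only [one_smul, zero_smul, add_zero, sub_zero, mul_one] at hle
  exact hle.not_gt hzlt

theorem norm_fderiv_le_of_ae_norm_fderiv_le {b : E → ℝ} (hs : IsOpen s)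
    (hg : DifferentiableOn ℝ g s) (hgb : ∀ᵐ z ∂μ, z ∈ s → ‖fderiv ℝ g z‖ ≤ b z) {x : E}
    (hx : x ∈ s) (hb : ContinuousAt b x) : ‖fderiv ℝ g x‖ ≤ b x := by
  refine le_of_forall_pos_le_add fun e he => ?_
  obtain ⟨R, hR, hball⟩ := Metric.eventually_nhds_iff_ball.1
    ((hb.eventually_lt_const (lt_add_of_pos_right _ he)).and (hs.mem_nhds hx))
  have hle : ∀ᵐ z ∂μ, z ∈ Metric.ball x R → ‖fderiv ℝ g z‖ ≤ b x + e := by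
    filter_upwards [hgb] with z hz hzR
    exact (hz (hball z hzR).2).trans (hball z hzR).1.le
  have hnn : 0 ≤ b x + e := by
    obtain ⟨z, hz, hzR⟩ := (Measure.dense_of_ae hle).inter_nhds_nonempty (Metric.ball_mem_nhds x hR)
    exact (norm_nonneg _).trans (hz hzR)
  refine norm_fderiv_le_of_lip' ℝ hnn ?_
  filter_upwards [Metric.ball_mem_nhds x hR] with y hy
  exact norm_image_sub_le_of_ae_norm_fderiv_le (convex_ball x R) Metric.isOpen_ball
    (hg.mono fun z hz => (hball z hz).2) hle (Metric.mem_ball_self hR) hy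

end Haar

end MeanValue

theorem sub_le_inner_gradient_add {E : Type*} [NormedAddCommGroup E] [InnerProductSpace ℝ E]
    [CompleteSpace E] {f : E → ℝ} {f' : E → E} {x y : E} {L : ℝ} (hL : 0 ≤ L)
    (hf : ∀ p ∈ segment ℝ x y, HasGradientAt f (f' p) p)
    (hlip : ∀ p ∈ segment ℝ x y, ‖f' p - f' x‖ ≤ L * ‖p - x‖) :
    f y - f x ≤ inner ℝ (f' x) (y - x) + L * ‖y - x‖ ^ 2 := by
  have hbound : ∀ p ∈ segment ℝ x y, ‖InnerProductSpace.toDual ℝ E (f' p)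
      - InnerProductSpace.toDual ℝ E (f' x)‖ ≤ L * ‖y - x‖ := fun p hp => by
    rw [← map_sub, LinearIsometryEquiv.norm_map]
    refine (hlip p hp).trans (mul_le_mul_of_nonneg_left ?_ hL)
    obtain ⟨s, hs, rfl⟩ := segment_eq_image' ℝ x y ▸ hp
    rw [add_sub_cancel_left, norm_smul, Real.norm_of_nonneg hs.1]
    exact mul_le_of_le_one_left (norm_nonneg _) hs.2
  have hmvt := (convex_segment x y).norm_image_sub_le_of_norm_hasFDerivWithin_le'
    (fun p hp => (hf p hp).hasFDerivAt.hasFDerivWithinAt) hbound (left_mem_segment ℝ x y)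
    (right_mem_segment ℝ x y)
  rw [InnerProductSpace.toDual_apply_apply] at hmvt
  linarith [(abs_le.1 hmvt).2]

section GeneralizedSmoothness

variable {ρ L₀ Lρ G R : ℝ}

theorem effL_nonneg (hL₀ : 0 ≤ L₀) (hLρ : 0 ≤ Lρ) (hG : 0 ≤ G) : 0 ≤ effL ρ L₀ Lρ G := by
  unfold effL; positivity

/-- The condition `R ≤ r / 2`, cleared of the quotients in `r` that may be infinite. -/
structure IsShort (ρ L₀ Lρ G R : ℝ) : Prop where
  mul_rpow_le : 10 * (R * (Lρ * G ^ ρ)) ≤ G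
  mul_balance_le : ρ ≠ 0 → L₀ ≠ 0 → 10 * (R * (L₀ ^ (ρ - 1) * Lρ) ^ (1 / ρ)) ≤ 1

theorem IsShort.mono {R' : ℝ} (h : IsShort ρ L₀ Lρ G R) (hL₀ : 0 ≤ L₀) (hLρ : 0 ≤ Lρ)
    (hG : 0 ≤ G) (hR : R' ≤ R) : IsShort ρ L₀ Lρ G R' where
  mul_rpow_le := h.mul_rpow_le.trans' (by gcongr)
  mul_balance_le hρ h0 := (h.mul_balance_le hρ h0).trans' (by gcongr)

/-- At gradient norm `B` the two terms of the Hessian bound balance, `Lρ B ^ ρ = L₀`. -/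
theorem IsShort.exists_balance (h : IsShort ρ L₀ Lρ G R) (hρ : 0 < ρ) (hL₀ : 0 ≤ L₀)
    (hLρ : 0 < Lρ) : ∃ B, 0 ≤ B ∧ Lρ * B ^ ρ = L₀ ∧ 10 * (R * L₀) ≤ B := by
  refine ⟨(L₀ / Lρ) ^ (1 / ρ), by positivity, ?_, ?_⟩
  · rw [← Real.rpow_mul (by positivity), one_div_mul_cancel hρ.ne', Real.rpow_one]
    field_simp
  · rcases hL₀.eq_or_lt with rfl | hL₀pos
    · simp only [mul_zero]; positivity
    have hfactor : (L₀ ^ (ρ - 1) * Lρ) ^ (1 / ρ) * (L₀ / Lρ) ^ (1 / ρ) = L₀ := by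
      have : L₀ ^ (ρ - 1) * Lρ * (L₀ / Lρ) = L₀ ^ ρ := by
        rw [Real.rpow_sub_one hL₀pos.ne']; field_simp
      rw [← Real.mul_rpow (by positivity) (by positivity), this, ← Real.rpow_mul hL₀,
        mul_one_div_cancel hρ.ne', Real.rpow_one]
    calc 10 * (R * L₀)
        = 10 * (R * (L₀ ^ (ρ - 1) * Lρ) ^ (1 / ρ)) * (L₀ / Lρ) ^ (1 / ρ) := by
          linear_combination (-10 * R) * hfactor
      _ ≤ 1 * (L₀ / Lρ) ^ (1 / ρ) := by
          gcongr; exact h.mul_balance_le hρ.ne' hL₀pos.ne'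
      _ = _ := one_mul _

theorem mul_rpow_le_mul {a u v : ℝ} (hρ : 0 ≤ ρ) (hρ1 : ρ ≤ 1) (ha : 1 ≤ a) (hu : 0 ≤ u)
    (hv : 0 ≤ v) (huv : u ≤ a * v) : u ^ ρ ≤ a * v ^ ρ := calc
  u ^ ρ ≤ (a * v) ^ ρ := Real.rpow_le_rpow hu huv hρ
  _ = a ^ ρ * v ^ ρ := Real.mul_rpow (by positivity) hv
  _ ≤ a * v ^ ρ := by
    gcongr
    simpa using Real.rpow_le_rpow_of_exponent_le ha hρ1

theorem IsShort.exists_level (h : IsShort ρ L₀ Lρ G R) (hρ : 0 ≤ ρ) (hρ1 : ρ ≤ 1) (hL₀ : 0 ≤ L₀)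
    (hLρ : 0 ≤ Lρ) (hG : 0 < G) (hR : 0 ≤ R) :
    ∃ A, 2 * G ≤ A ∧ R * effL ρ L₀ Lρ G < A ∧
      ∀ u, 0 ≤ u → u ≤ 2 * A → L₀ + Lρ * u ^ ρ ≤ effL ρ L₀ Lρ G := by
  have hLG : 0 ≤ Lρ * G ^ ρ := by positivity
  by_cases hconst : ρ = 0 ∨ Lρ = 0
  · have hRL : 0 ≤ R * effL ρ L₀ Lρ G := mul_nonneg hR (effL_nonneg hL₀ hLρ hG.le)
    refine ⟨2 * G + R * effL ρ L₀ Lρ G, by linarith, by linarith, fun u _ _ => ?_⟩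
    unfold effL
    rcases hconst with rfl | rfl
    · simp only [Real.rpow_zero, mul_one]; linarith
    · linarith
  · rw [not_or] at hconst
    obtain ⟨B, hB0, hBL, hRB⟩ :=
      h.exists_balance (hρ.lt_of_ne' hconst.1) hL₀ (hLρ.lt_of_ne' hconst.2)
    have hBA := le_max_left B (2 * G)
    have hGA := le_max_right B (2 * G)
    refine ⟨max B (2 * G), hGA, by unfold effL; linarith [h.mul_rpow_le], fun u hu hu2 => ?_⟩
    unfold effL
    rcases le_total B (2 * G) with hBG | hBG
    · have := mul_le_mul_of_nonneg_left (mul_rpow_le_mul hρ hρ1 (a := 4) (by norm_num) hu hG.le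
        (by rw [max_eq_right hBG] at hu2; linarith)) hLρ
      linarith
    · have := mul_le_mul_of_nonneg_left (mul_rpow_le_mul hρ hρ1 (a := 2) (by norm_num) hu hB0
        (by rwa [max_eq_left hBG] at hu2)) hLρ
      linarith

variable {d : ℕ} {D : Set (Vec d)} {f : Vec d → ℝ}

theorem GenSmoothOn.differentiableAt_gradient (hf : GenSmoothOn D ρ L₀ Lρ f) (hD : IsOpen D)
    {x : Vec d} (hx : x ∈ D) : DifferentiableAt ℝ (gradient f) x :=
  hf.2.1.differentiableAt (hD.mem_nhds hx)

theorem GenSmoothOn.hasGradientAt (hf : GenSmoothOn D ρ L₀ Lρ f) (hD : IsOpen D)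
    {x : Vec d} (hx : x ∈ D) : HasGradientAt f (gradient f x) x :=
  (hf.1.differentiableAt (hD.mem_nhds hx)).hasGradientAt

theorem GenSmoothOn.continuousOn_gradient (hf : GenSmoothOn D ρ L₀ Lρ f) :
    ContinuousOn (gradient f) D :=
  hf.2.1.continuousOn

theorem GenSmoothOn.norm_fderiv_gradient_le (hf : GenSmoothOn D ρ L₀ Lρ f) (hD : IsOpen D)
    (hρ : 0 ≤ ρ) {x : Vec d} (hx : x ∈ D) :
    ‖fderiv ℝ (gradient f) x‖ ≤ L₀ + Lρ * ‖gradient f x‖ ^ ρ :=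
  norm_fderiv_le_of_ae_norm_fderiv_le hD hf.2.1 ((ae_restrict_iff' hD.measurableSet).1 hf.2.2) hx
    (continuousAt_const.add (continuousAt_const.mul
      ((hf.differentiableAt_gradient hD hx).continuousAt.norm.rpow_const (Or.inr hρ))))

theorem GenSmoothOn.norm_gradient_sub_le (hf : GenSmoothOn D ρ L₀ Lρ f) (hD : IsOpen D)
    (hρ : 0 ≤ ρ) (hρ1 : ρ ≤ 1) (hL₀ : 0 ≤ L₀) (hLρ : 0 ≤ Lρ) (hG : 0 < G) {x y : Vec d}
    (hxy : segment ℝ x y ⊆ D) (hx : ‖gradient f x‖ ≤ 2 * G)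
    (hshort : IsShort ρ L₀ Lρ G ‖y - x‖) :
    ∀ p ∈ segment ℝ x y, ‖gradient f p - gradient f x‖ ≤ effL ρ L₀ Lρ G * ‖p - x‖ := by
  obtain ⟨A, hGA, hRA, hlevel⟩ := hshort.exists_level hρ hρ1 hL₀ hLρ hG (norm_nonneg _)
  have hmem : ∀ s ∈ Set.Icc (0 : ℝ) 1, x + s • (y - x) ∈ D := fun s hs =>
    hxy (segment_eq_image' ℝ x y ▸ ⟨s, hs, rfl⟩)
  have hhess : ∀ p ∈ D, ‖gradient f p‖ ≤ 2 * A → ‖fderiv ℝ (gradient f) p‖ ≤ effL ρ L₀ Lρ G :=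
    fun p hp hpA => (hf.norm_fderiv_gradient_le hD hρ hp).trans (hlevel _ (norm_nonneg _) hpA)
  have hder : ∀ s ∈ Set.Icc (0 : ℝ) 1, HasDerivAt (fun s : ℝ => gradient f (x + s • (y - x)))
      (fderiv ℝ (gradient f) (x + s • (y - x)) (y - x)) s := fun s hs => by
    have hline : HasDerivAt (fun s : ℝ => x + s • (y - x)) (y - x) s := by
      simpa using ((hasDerivAt_id s).smul_const (y - x)).const_add x
    exact (hf.differentiableAt_gradient hD (hmem s hs)).hasFDerivAt.comp_hasDerivAt s hline
  have hgrad : ∀ s ∈ Set.Icc (0 : ℝ) 1, ‖gradient f (x + s • (y - x))‖ ≤ 2 * A := by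
    refine norm_le_two_mul_of_norm_deriv_lt hder (by simpa using hx.trans hGA) fun s hs hsA => ?_
    exact (ContinuousLinearMap.le_of_opNorm_le _ (hhess _ (hmem s hs) hsA) _).trans_lt
      (by rwa [mul_comm])
  have hbound : ∀ p ∈ segment ℝ x y, ‖fderiv ℝ (gradient f) p‖ ≤ effL ρ L₀ Lρ G := fun p hp => by
    refine hhess p (hxy hp) ?_
    obtain ⟨s, hs, rfl⟩ := segment_eq_image' ℝ x y ▸ hp
    exact hgrad s hs
  exact fun p hp => Convex.norm_image_sub_le_of_norm_hasFDerivWithin_le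
    (fun z hz => (hf.differentiableAt_gradient hD (hxy hz)).hasFDerivAt.hasFDerivWithinAt) hbound
    (convex_segment x y) (left_mem_segment ℝ x y) hp

end GeneralizedSmoothness

section SecondMoment

variable {Ω E : Type*} [MeasurableSpace Ω] {μ : Measure Ω} [IsProbabilityMeasure μ]
  [NormedAddCommGroup E]

theorem integrable_norm_add_sq {W : Ω → E} (hW : AEStronglyMeasurable W μ) {b : ℝ}
    (hb : ∀ᵐ ω ∂μ, ‖W ω‖ ≤ b) (a : E) : Integrable (fun ω => ‖a + W ω‖ ^ 2) μ :=
  ((memLp_const a).add (MemLp.of_bound hW b hb)).integrable_norm_pow two_ne_zero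

variable [InnerProductSpace ℝ E] [CompleteSpace E]

theorem integral_norm_add_sq_le {W : Ω → E} (hW : AEStronglyMeasurable W μ) {b : ℝ}
    (hb : ∀ᵐ ω ∂μ, ‖W ω‖ ≤ b) (h0 : ∫ ω, W ω ∂μ = 0) (a : E) :
    ∫ ω, ‖a + W ω‖ ^ 2 ∂μ ≤ ‖a‖ ^ 2 + b ^ 2 := by
  have hWi : Integrable W μ := Integrable.of_bound hW b hb
  have hcross : Integrable (fun ω => ‖a‖ ^ 2 + 2 * inner ℝ a (W ω)) μ :=
    (integrable_const _).add ((hWi.const_inner a).const_mul 2)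
  calc ∫ ω, ‖a + W ω‖ ^ 2 ∂μ ≤ ∫ ω, (‖a‖ ^ 2 + 2 * inner ℝ a (W ω) + b ^ 2) ∂μ := by
        refine integral_mono_of_nonneg (ae_of_all _ fun ω => sq_nonneg _)
          (hcross.add (integrable_const _)) ?_
        filter_upwards [hb] with ω hω
        rw [norm_add_sq_real]
        gcongr
    _ = ‖a‖ ^ 2 + b ^ 2 := by
        rw [integral_add hcross (integrable_const _), integral_add (integrable_const _)
          ((hWi.const_inner a).const_mul 2), integral_const_mul, integral_inner hWi, h0]
        simp

theorem integral_norm_sum_sq_le [MeasurableSpace E] [BorelSpace E] {ι : Type*} {s : Finset ι}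
    {X : ι → Ω → E} {b : ℝ} (hX : ∀ i ∈ s, AEStronglyMeasurable (X i) μ)
    (hb : ∀ i ∈ s, ∀ᵐ ω ∂μ, ‖X i ω‖ ≤ b) (h0 : ∀ i ∈ s, ∫ ω, X i ω ∂μ = 0)
    (hind : (s : Set ι).Pairwise fun i j => X i ⟂ᵢ[μ] X j) :
    ∫ ω, ‖∑ i ∈ s, X i ω‖ ^ 2 ∂μ ≤ s.card * b ^ 2 := by
  have hL2 : ∀ i ∈ s, MemLp (X i) 2 μ := fun i hi => MemLp.of_bound (hX i hi) b (hb i hi)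
  have hinner : ∀ i ∈ s, ∀ j ∈ s, Integrable (fun ω => inner ℝ (X i ω) (X j ω)) μ :=
    fun i hi j hj => .of_bound ((hX i hi).inner (hX j hj)) (b * b) <| by
      filter_upwards [hb i hi, hb j hj] with ω hωi hωj
      exact (norm_inner_le_norm _ _).trans (by gcongr; exact (norm_nonneg _).trans hωi)
  have hcross : ∀ i ∈ s, ∀ j ∈ s, j ≠ i → ∫ ω, inner ℝ (X i ω) (X j ω) ∂μ = 0 := by
    intro i hi j hj hji
    have h := (hind hi hj hji.symm).integral_bilin ((hL2 i hi).integrable one_le_two)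
      ((hL2 j hj).integrable one_le_two) (innerSL ℝ)
    rwa [h0 i hi, map_zero] at h
  have hdiag : ∀ i ∈ s, ∫ ω, inner ℝ (X i ω) (X i ω) ∂μ ≤ b ^ 2 := by
    intro i hi
    have h := integral_norm_add_sq_le (hX i hi) (hb i hi) (h0 i hi) 0
    simpa using h
  calc ∫ ω, ‖∑ i ∈ s, X i ω‖ ^ 2 ∂μ
      = ∑ i ∈ s, ∑ j ∈ s, ∫ ω, inner ℝ (X i ω) (X j ω) ∂μ := by
        simp_rw [← real_inner_self_eq_norm_sq, sum_inner, inner_sum]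
        rw [integral_finsetSum _ fun i hi => integrable_finsetSum _ (hinner i hi)]
        exact Finset.sum_congr rfl fun i hi => integral_finsetSum _ (hinner i hi)
    _ = ∑ i ∈ s, ∫ ω, inner ℝ (X i ω) (X i ω) ∂μ := Finset.sum_congr rfl fun i hi =>
        Finset.sum_eq_single_of_mem i hi (hcross i hi)
    _ ≤ s.card * b ^ 2 := by
        rw [← nsmul_eq_mul]
        exact Finset.sum_le_card_nsmul _ _ _ hdiag

end SecondMoment

theorem measureReal_ge_le_of_integral_le_mul {α : Type*} [MeasurableSpace α] {μ : Measure α}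
    {f : α → ℝ} (hf : 0 ≤ f) (hfi : Integrable f μ) {M p : ℝ} (hM : 0 < M)
    (h : ∫ x, f x ∂μ ≤ p * M) : μ.real {x | M ≤ f x} ≤ p := by
  refine le_of_mul_le_mul_left ?_ hM
  calc M * μ.real {x | M ≤ f x} ≤ ∫ x, f x ∂μ :=
        mul_meas_ge_le_integral_of_nonneg (ae_of_all _ hf) hfi M
    _ ≤ M * p := h.trans_eq (mul_comm p M)

theorem measureReal_and_ge_le_of_integral_le_mul {α : Type*} [MeasurableSpace α] {μ : Measure α}
    {f : α → ℝ} {q : Prop} (hf : 0 ≤ f) (hfi : Integrable f μ) {M p : ℝ} (hM : 0 < M)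
    (hp : 0 ≤ p) (h : q → ∫ x, f x ∂μ ≤ p * M) : μ.real {x | q ∧ M ≤ f x} ≤ p := by
  by_cases hq : q
  · simpa only [hq, true_and] using measureReal_ge_le_of_integral_le_mul hf hfi hM (h hq)
  · simpa [hq] using hp

section Freezing

variable {Ω A Ξ : Type*} [MeasurableSpace Ω] {μ : Measure Ω} [IsFiniteMeasure μ]
  [MeasurableSpace A] [MeasurableSpace Ξ] {P : Measure Ξ} {X : Ω → A} {Z : Ω → Ξ}

theorem map_prodMk_eq_prod (hX : AEMeasurable X μ) (hZ : HasLaw Z P μ) (hXZ : X ⟂ᵢ[μ] Z) :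
    μ.map (fun ω => (X ω, Z ω)) = (μ.map X).prod P := by
  rw [hXZ.map_prod_eq_prod_map_map hX hZ.aemeasurable, hZ.map_eq]

theorem ae_of_forall_ae_of_indepFun (hX : AEMeasurable X μ) (hZ : HasLaw Z P μ)
    (hXZ : X ⟂ᵢ[μ] Z) {p : A → Ξ → Prop} (hp : MeasurableSet {q : A × Ξ | p q.1 q.2})
    (h : ∀ a, ∀ᵐ z ∂P, p a z) : ∀ᵐ ω ∂μ, p (X ω) (Z ω) := by
  have : IsFiniteMeasure P := hZ.map_eq ▸ inferInstance
  refine ae_of_ae_map (hX.prodMk hZ.aemeasurable) (p := fun q => p q.1 q.2) ?_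
  rw [map_prodMk_eq_prod hX hZ hXZ, Measure.ae_prod_iff_ae_ae hp]
  exact ae_of_all _ h

theorem integral_le_integral_of_indepFun (hX : AEMeasurable X μ) (hZ : HasLaw Z P μ)
    (hXZ : X ⟂ᵢ[μ] Z) {ψ : A → Ξ → ℝ} (hψ : Measurable (Function.uncurry ψ))
    (hψ0 : ∀ a z, 0 ≤ ψ a z) {φ : A → ℝ} (hφ : Integrable (fun ω => φ (X ω)) μ)
    (hψi : ∀ a, Integrable (ψ a) P) (hle : ∀ a, ∫ z, ψ a z ∂P ≤ φ a) :
    Integrable (fun ω => ψ (X ω) (Z ω)) μ ∧ ∫ ω, ψ (X ω) (Z ω) ∂μ ≤ ∫ ω, φ (X ω) ∂μ := by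
  have hφ0 : ∀ a, 0 ≤ φ a := fun a => (integral_nonneg (hψ0 a)).trans (hle a)
  have hpair : AEMeasurable (fun ω => (X ω, Z ω)) μ := hX.prodMk hZ.aemeasurable
  have : IsFiniteMeasure P := hZ.map_eq ▸ inferInstance
  have hlint : ∫⁻ ω, ENNReal.ofReal (ψ (X ω) (Z ω)) ∂μ ≤ ∫⁻ ω, ENNReal.ofReal (φ (X ω)) ∂μ :=
    calc ∫⁻ ω, ENNReal.ofReal (ψ (X ω) (Z ω)) ∂μ
        = ∫⁻ a, ∫⁻ z, ENNReal.ofReal (ψ a z) ∂P ∂(μ.map X) := by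
          have hψ' : Measurable fun q : A × Ξ => ENNReal.ofReal (ψ q.1 q.2) := hψ.ennreal_ofReal
          rw [← lintegral_map' hψ'.aemeasurable hpair, map_prodMk_eq_prod hX hZ hXZ,
            lintegral_prod _ hψ'.aemeasurable]
      _ ≤ ∫⁻ a, ENNReal.ofReal (φ a) ∂(μ.map X) := lintegral_mono fun a => by
          rw [← ofReal_integral_eq_lintegral_ofReal (hψi a) (ae_of_all _ (hψ0 a))]
          exact ENNReal.ofReal_le_ofReal (hle a)
      _ ≤ ∫⁻ ω, ENNReal.ofReal (φ (X ω)) ∂μ := lintegral_map_le _ _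
  rw [← ofReal_integral_eq_lintegral_ofReal hφ (ae_of_all _ fun ω => hφ0 _)] at hlint
  have hint : Integrable (fun ω => ψ (X ω) (Z ω)) μ :=
    ⟨(hψ.comp_aemeasurable hpair).aestronglyMeasurable,
      (hasFiniteIntegral_iff_ofReal (ae_of_all _ fun ω => hψ0 _ _)).2
        (hlint.trans_lt ENNReal.ofReal_lt_top)⟩
  refine ⟨hint, ?_⟩
  rwa [← ofReal_integral_eq_lintegral_ofReal hint (ae_of_all _ fun ω => hψ0 _ _),
    ENNReal.ofReal_le_ofReal_iff (integral_nonneg fun ω => hφ0 _)] at hlint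

end Freezing

section OracleRun

variable {d : ℕ} {Ξ : Type*} (γ : Vec d → Ξ → Vec d) (η β βsq lam : ℝ)

/-- The initialization of VRAdam with an arbitrary gradient oracle `γ` in place of `sgrad F`. -/
noncomputable def oracleInit (xinit : Vec d) {S₁ : ℕ} (batch : Fin S₁ → Ξ) : State d :=
  let m₁ : Vec d := (S₁ : ℝ)⁻¹ • ∑ j, γ xinit (batch j)
  { x := xinit
    m := m₁
    v := WithLp.toLp 2 fun i => βsq * m₁ i ^ 2
    next := WithLp.toLp 2 fun i => xinit i - η * m₁ i / (|m₁ i| + lam) }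

/-- The update of VRAdam with an arbitrary gradient oracle `γ` in place of `sgrad F`. -/
noncomputable def oracleStep (t : ℕ) (ξ : Ξ) (s : State d) : State d :=
  let x : Vec d := s.next
  let g : Vec d := γ x ξ
  let m : Vec d := (1 - β) • s.m + β • g + (1 - β) • (g - γ s.x ξ)
  let v : Vec d := WithLp.toLp 2 fun i => (1 - βsq) * s.v i + βsq * g i ^ 2
  let vhat : Vec d := WithLp.toLp 2 fun i => v i / (1 - (1 - βsq) ^ t)
  { x := x
    m := m
    v := v
    next := WithLp.toLp 2 fun i => x i - η / (√(vhat i) + lam) * m i }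

/-- The run of VRAdam with an arbitrary gradient oracle `γ`: the state at time `k + 1`. Oracles
extended by zero off the domain make it a measurable function of the samples. -/
noncomputable def oracleState (xinit : Vec d) {S₁ : ℕ} (batch : Fin S₁ → Ξ) (ξ : ℕ → Ξ) :
    ℕ → State d
  | 0 => oracleInit γ η βsq lam xinit batch
  | k + 1 => oracleStep γ η β βsq lam (k + 2) (ξ (k + 2)) (oracleState xinit batch ξ k)

theorem state_eq_oracleState (F : Vec d → Ξ → ℝ) (xinit : Vec d) {S₁ : ℕ} (batch : Fin S₁ → Ξ)
    (ξ : ℕ → Ξ) (k : ℕ) : state F η β βsq lam xinit batch ξ k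
      = oracleState (sgrad F) η β βsq lam xinit batch ξ k := by
  induction k with
  | zero => rfl
  | succ k ih => rw [state, oracleState, ← ih]; rfl

variable {γ η β βsq lam} {xinit : Vec d} {S₁ : ℕ} {batch : Fin S₁ → Ξ} {ξ : ℕ → Ξ}

theorem oracleState_congr_samples {ξ' : ℕ → Ξ} {k : ℕ} (h : ∀ t, 2 ≤ t → t ≤ k + 1 → ξ t = ξ' t) :
    oracleState γ η β βsq lam xinit batch ξ k = oracleState γ η β βsq lam xinit batch ξ' k := by
  induction k with
  | zero => rfl
  | succ k ih =>
    rw [oracleState, oracleState, ih fun t h2 ht => h t h2 (by lia), h (k + 2) (by lia) le_rfl]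

theorem oracleState_congr_oracle {γ' : Vec d → Ξ → Vec d} {D : Set (Vec d)}
    (hγ : ∀ x ∈ D, γ x = γ' x) {k : ℕ}
    (h : ∀ j ≤ k, (oracleState γ η β βsq lam xinit batch ξ j).x ∈ D) :
    oracleState γ η β βsq lam xinit batch ξ k = oracleState γ' η β βsq lam xinit batch ξ k := by
  induction k with
  | zero =>
    have h0 : γ xinit = γ' xinit := hγ _ (h 0 le_rfl)
    simp only [oracleState, oracleInit, h0]
  | succ k ih =>
    have ih := ih fun j hj => h j (by lia)
    have hnext : γ (oracleState γ η β βsq lam xinit batch ξ k).next = γ' _ :=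
      hγ _ (h (k + 1) le_rfl)
    have hx := hγ _ (h k (by lia))
    rw [ih] at hnext hx
    simp only [oracleState, ih, oracleStep, hnext, hx]

section StepSize

theorem coord_sq_le {w : Vec d} {B : ℝ} (hw : ‖w‖ ≤ B) (i : Fin d) : w i ^ 2 ≤ B ^ 2 :=
  sq_le_sq' (abs_le.1 ((PiLp.norm_apply_le w i).trans hw)).1
    (abs_le.1 ((PiLp.norm_apply_le w i).trans hw)).2

variable {B : ℝ}

theorem oracleInit_v_mem (hβ0 : 0 ≤ βsq)
    (h : ‖(oracleInit γ η βsq lam xinit batch).m‖ ≤ B) (i : Fin d) :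
    (oracleInit γ η βsq lam xinit batch).v i ∈ Set.Icc 0 ((1 - (1 - βsq) ^ 1) * B ^ 2) := by
  have hsq := coord_sq_le h i
  rw [pow_one, sub_sub_cancel]
  exact ⟨mul_nonneg hβ0 (sq_nonneg _), mul_le_mul_of_nonneg_left hsq hβ0⟩

theorem oracleStep_v_mem (hβ0 : 0 ≤ βsq) (hβ1 : βsq ≤ 1) {t n : ℕ} {z : Ξ} {s : State d}
    {i : Fin d} (hs : s.v i ∈ Set.Icc 0 ((1 - (1 - βsq) ^ n) * B ^ 2)) (hz : ‖γ s.next z‖ ≤ B) :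
    (oracleStep γ η β βsq lam t z s).v i ∈ Set.Icc 0 ((1 - (1 - βsq) ^ (n + 1)) * B ^ 2) := by
  have hβ : 0 ≤ 1 - βsq := by linarith
  refine ⟨add_nonneg (mul_nonneg hβ hs.1) (mul_nonneg hβ0 (sq_nonneg _)), ?_⟩
  calc (1 - βsq) * s.v i + βsq * γ s.next z i ^ 2
      ≤ (1 - βsq) * ((1 - (1 - βsq) ^ n) * B ^ 2) + βsq * B ^ 2 := by
        exact add_le_add (mul_le_mul_of_nonneg_left hs.2 hβ)
          (mul_le_mul_of_nonneg_left (coord_sq_le hz i) hβ0)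
    _ = (1 - (1 - βsq) ^ (n + 1)) * B ^ 2 := by ring

theorem oracleState_v_mem (hβ0 : 0 ≤ βsq) (hβ1 : βsq ≤ 1) (k : ℕ)
    (h0 : ‖(oracleState γ η β βsq lam xinit batch ξ 0).m‖ ≤ B)
    (h : ∀ j < k, ‖γ (oracleState γ η β βsq lam xinit batch ξ j).next (ξ (j + 2))‖ ≤ B)
    (i : Fin d) : (oracleState γ η β βsq lam xinit batch ξ k).v i
      ∈ Set.Icc 0 ((1 - (1 - βsq) ^ (k + 1)) * B ^ 2) := by
  induction k with
  | zero => exact oracleInit_v_mem hβ0 h0 i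
  | succ k ih => exact oracleStep_v_mem hβ0 hβ1 (ih fun j hj => h j (by lia)) (h k (by lia))

theorem div_add_mem_Icc (hη : 0 ≤ η) (hlam : 0 < lam) {q : ℝ} (hq : q ∈ Set.Icc 0 B) :
    η / (q + lam) ∈ Set.Icc (η / (B + lam)) (η / lam) := by
  obtain ⟨hq0, hqB⟩ := hq
  exact ⟨by gcongr, by gcongr; linarith⟩

theorem oracleInit_exists_step_size (hη : 0 ≤ η) (hlam : 0 < lam)
    (h : ‖(oracleInit γ η βsq lam xinit batch).m‖ ≤ B) (i : Fin d) :
    ∃ a ∈ Set.Icc (η / (B + lam)) (η / lam), (oracleInit γ η βsq lam xinit batch).x i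
      - (oracleInit γ η βsq lam xinit batch).next i
      = a * (oracleInit γ η βsq lam xinit batch).m i := by
  refine ⟨_, div_add_mem_Icc hη hlam ⟨abs_nonneg _, (PiLp.norm_apply_le _ i).trans h⟩, ?_⟩
  simp only [oracleInit]
  ring

theorem oracleStep_exists_step_size (hβ0 : 0 ≤ βsq) (hβ1 : βsq ≤ 1) (hη : 0 ≤ η)
    (hlam : 0 < lam) (hB : 0 ≤ B) {t : ℕ} {z : Ξ} {s : State d} {i : Fin d}
    (h : (oracleStep γ η β βsq lam t z s).v i ∈ Set.Icc 0 ((1 - (1 - βsq) ^ t) * B ^ 2)) :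
    ∃ a ∈ Set.Icc (η / (B + lam)) (η / lam), (oracleStep γ η β βsq lam t z s).x i
      - (oracleStep γ η β βsq lam t z s).next i = a * (oracleStep γ η β βsq lam t z s).m i := by
  have hweight : 0 ≤ 1 - (1 - βsq) ^ t :=
    sub_nonneg.2 (pow_le_one₀ (by linarith) (by linarith))
  have hsqrt : √((oracleStep γ η β βsq lam t z s).v i / (1 - (1 - βsq) ^ t)) ≤ B := by
    rw [Real.sqrt_le_left hB]
    exact div_le_of_le_mul₀ hweight (by positivity) (by linarith [h.2])
  refine ⟨_, div_add_mem_Icc hη hlam ⟨Real.sqrt_nonneg _, hsqrt⟩, ?_⟩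
  simp only [oracleStep]
  ring

theorem oracleState_exists_step_size (hβ0 : 0 ≤ βsq) (hβ1 : βsq ≤ 1) (hη : 0 ≤ η)
    (hlam : 0 < lam) (k : ℕ)
    (h0 : ‖(oracleState γ η β βsq lam xinit batch ξ 0).m‖ ≤ B)
    (h : ∀ j < k, ‖γ (oracleState γ η β βsq lam xinit batch ξ j).next (ξ (j + 2))‖ ≤ B)
    (i : Fin d) : ∃ a ∈ Set.Icc (η / (B + lam)) (η / lam),
      (oracleState γ η β βsq lam xinit batch ξ k).x i
        - (oracleState γ η β βsq lam xinit batch ξ k).next i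
        = a * (oracleState γ η β βsq lam xinit batch ξ k).m i := by
  cases k with
  | zero => exact oracleInit_exists_step_size hη hlam h0 i
  | succ k =>
    exact oracleStep_exists_step_size hβ0 hβ1 hη hlam ((norm_nonneg _).trans h0)
      (oracleState_v_mem hβ0 hβ1 (k + 1) h0 h i)

end StepSize

end OracleRun

section Measurability

variable {d : ℕ}

/-- The Borel structure of `ℝ^d × ℝ^d × ℝ^d × ℝ^d`, to which `State d` is identified. -/
instance : MeasurableSpace (State d) :=
  .comap (fun s => (s.x, s.m, s.v, s.next)) inferInstance

theorem measurable_state_tuple : Measurable fun s : State d => (s.x, s.m, s.v, s.next) :=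
  comap_measurable _

theorem measurable_state_x : Measurable (State.x : State d → Vec d) :=
  measurable_state_tuple.fst

theorem measurable_state_m : Measurable (State.m : State d → Vec d) :=
  measurable_state_tuple.snd.fst

theorem measurable_state_v : Measurable (State.v : State d → Vec d) :=
  measurable_state_tuple.snd.snd.fst

theorem measurable_state_next : Measurable (State.next : State d → Vec d) :=
  measurable_state_tuple.snd.snd.snd

variable {A : Type*} [MeasurableSpace A]

theorem measurable_state_mk {x m v y : A → Vec d} (hx : Measurable x) (hm : Measurable m)
    (hv : Measurable v) (hy : Measurable y) :
    Measurable fun u => State.mk (x u) (m u) (v u) (y u) :=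
  measurable_comap_iff.2 (hx.prodMk (hm.prodMk (hv.prodMk hy)))

theorem measurable_coord {q : A → Vec d} (hq : Measurable q) (i : Fin d) :
    Measurable fun u => q u i :=
  (measurable_pi_apply i).comp ((WithLp.measurable_ofLp 2 _).comp hq)

theorem measurable_toLp_of_coord {q : A → Fin d → ℝ} (hq : ∀ i, Measurable fun u => q u i) :
    Measurable fun u => (WithLp.toLp 2 (q u) : Vec d) :=
  (WithLp.measurable_toLp 2 _).comp (measurable_pi_iff.2 hq)

variable {Ξ : Type*} [MeasurableSpace Ξ] {γ : Vec d → Ξ → Vec d} {η β βsq lam : ℝ}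

theorem measurable_oracleInit {xinit : Vec d} (hγ : Measurable (γ xinit)) (S₁ : ℕ) :
    Measurable (oracleInit γ η βsq lam xinit : (Fin S₁ → Ξ) → State d) := by
  have hm : Measurable fun b : Fin S₁ → Ξ => (S₁ : ℝ)⁻¹ • ∑ j, γ xinit (b j) :=
    (Finset.measurable_sum _ fun j _ => hγ.comp (measurable_pi_apply j)).const_smul (S₁ : ℝ)⁻¹
  have hmi := measurable_coord hm
  exact measurable_state_mk measurable_const hm
    (measurable_toLp_of_coord fun i => ((hmi i).pow_const 2).const_mul βsq)
    (measurable_toLp_of_coord fun i => measurable_const.sub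
      (((hmi i).const_mul η).div ((measurable_norm.comp (hmi i)).add_const lam)))

theorem measurable_oracleStep (hγ : Measurable (Function.uncurry γ)) (t : ℕ) :
    Measurable (Function.uncurry (oracleStep γ η β βsq lam t)) := by
  have hs : Measurable fun q : Ξ × State d => q.2 := measurable_snd
  have hnext := measurable_state_next.comp hs
  have hg : Measurable fun q : Ξ × State d => γ q.2.next q.1 :=
    hγ.comp (hnext.prodMk measurable_fst)
  have hg' : Measurable fun q : Ξ × State d => γ q.2.x q.1 :=
    hγ.comp ((measurable_state_x.comp hs).prodMk measurable_fst)
  have hm := (((measurable_state_m.comp hs).const_smul (1 - β)).add (hg.const_smul β)).add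
    ((hg.sub hg').const_smul (1 - β))
  have hv := fun i => ((measurable_coord (measurable_state_v.comp hs) i).const_mul (1 - βsq)).add
    (((measurable_coord hg i).pow_const 2).const_mul βsq)
  exact measurable_state_mk hnext hm (measurable_toLp_of_coord hv)
    (measurable_toLp_of_coord fun i => (measurable_coord hnext i).sub
      ((measurable_const.div (((hv i).div_const (1 - (1 - βsq) ^ t)).sqrt.add_const lam)).mul
        (measurable_coord hm i)))

theorem measurable_oracleState (hγ : Measurable (Function.uncurry γ)) (xinit : Vec d) {S₁ : ℕ}
    {batch : A → Fin S₁ → Ξ} {ξ : A → ℕ → Ξ} (hb : Measurable batch) (hξ : Measurable ξ) (k : ℕ) :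
    Measurable fun u => oracleState γ η β βsq lam xinit (batch u) (ξ u) k := by
  induction k with
  | zero => exact (measurable_oracleInit (hγ.comp measurable_prodMk_left) S₁).comp hb
  | succ k ih =>
    exact (measurable_oracleStep hγ (k + 2)).comp
      (((measurable_pi_apply (k + 2)).comp hξ).prodMk ih)

end Measurability

section Domain

theorem isOpen_setOf_segment_subset {E : Type*} [AddCommGroup E] [Module ℝ E] [TopologicalSpace E]
    [IsTopologicalAddGroup E] [ContinuousSMul ℝ E] {D : Set E} (hD : IsOpen D) :
    IsOpen {p : E × E | segment ℝ p.1 p.2 ⊆ D} := by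
  rw [isOpen_iff_mem_nhds]
  intro p hp
  have hnear := isCompact_Icc (a := (0 : ℝ)) (b := 1) |>.eventually_forall_of_forall_eventually
    (x₀ := p) (P := fun q s => q.1 + s • (q.2 - q.1) ∈ D) fun s hs => by
      have hc : Continuous fun w : (E × E) × ℝ => w.1.1 + w.2 • (w.1.2 - w.1.1) := by
        fun_prop
      exact (hD.preimage hc).mem_nhds (hp (segment_eq_image' ℝ p.1 p.2 ▸ ⟨s, hs, rfl⟩))
  filter_upwards [hnear] with q hq
  rw [segment_eq_image']
  rintro _ ⟨s, hs, rfl⟩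
  exact hq s hs

theorem measurable_uncurry_indicator {X Z E : Type*} [TopologicalSpace X]
    [TopologicalSpace.MetrizableSpace X] [SecondCountableTopology X] [MeasurableSpace X]
    [OpensMeasurableSpace X] [MeasurableSpace Z] [NormedAddCommGroup E] [MeasurableSpace E]
    [BorelSpace E] [SecondCountableTopology E] {D : Set X} (hD : MeasurableSet D)
    {g : X → Z → E} (hc : ∀ z, ContinuousOn (fun x => g x z) D) (hm : ∀ x ∈ D, Measurable (g x)) :
    Measurable (Function.uncurry fun x z => D.indicator (fun y => g y z) x) := by
  have hres : Measurable (Function.uncurry fun (x : D) (z : Z) => g x z) :=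
    (stronglyMeasurable_uncurry_of_continuous_of_stronglyMeasurable
      (fun z => continuousOn_iff_continuous_domRestrict.1 (hc z))
      (fun x => (hm x x.2).stronglyMeasurable)).measurable
  have hs : MeasurableSet (D ×ˢ (Set.univ : Set Z)) := hD.prod MeasurableSet.univ
  refine measurable_of_restrict_of_restrict_compl hs ?_ ?_
  · have hcoe : Measurable fun q : (D ×ˢ (Set.univ : Set Z) : Set (X × Z)) =>
        ((⟨q.1.1, q.2.1⟩ : D), q.1.2) :=
      (Measurable.subtype_mk (measurable_fst.comp measurable_subtype_coe)).prodMk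
        (measurable_snd.comp measurable_subtype_coe)
    convert hres.comp hcoe using 1
    ext1 q
    exact Set.indicator_of_mem (s := D) (a := q.1.1) q.2.1 fun y => g y q.1.2
  · convert (measurable_const : Measurable fun _ :
      ((D ×ˢ (Set.univ : Set Z))ᶜ : Set (X × Z)) => (0 : E)) using 1
    ext1 q
    exact Set.indicator_of_notMem (s := D) (a := q.1.1) (fun h => q.2 ⟨h, trivial⟩)
      fun y => g y q.1.2

end Domain

/-- The standing assumptions on the objective `f`, on its domain and on the component functions. -/
structure Problem {d : ℕ} {Ξ : Type*} [MeasurableSpace Ξ] (D : Set (Vec d)) (f : Vec d → ℝ)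
    (P : Measure Ξ) (F : Vec d → Ξ → ℝ) (ρ σ L₀ Lρ : ℝ) : Prop where
  rho_nonneg : 0 ≤ ρ
  rho_le_one : ρ ≤ 1
  L₀_nonneg : 0 ≤ L₀
  Lρ_nonneg : 0 ≤ Lρ
  isOpen : IsOpen D
  bddBelow : BddBelow (f '' D)
  smooth : GenSmoothOn D ρ L₀ Lρ f
  smooth_comp : ∀ z, GenSmoothOn D ρ L₀ Lρ fun x => F x z
  measurable_sgrad : ∀ x ∈ D, Measurable (sgrad F x)
  integral_sgrad : ∀ x ∈ D, ∫ z, sgrad F x z ∂P = gradient f x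
  noise : ∀ x ∈ D, ∀ᵐ z ∂P, ‖sgrad F x z - gradient f x‖ ≤ σ

/-- The conditions on the step size under which single steps are controlled. They do not involve
the accuracy `ε` or the confidence `δ`, and no quotient that may be infinite. -/
structure StepRegime (ρ σ L₀ Lρ lam G η β : ℝ) : Prop where
  G_pos : 0 < G
  lam_pos : 0 < lam
  eta_pos : 0 < η
  lam_le : 2 * lam ≤ G
  sigma_le : 2 * σ ≤ G
  short : IsShort ρ L₀ Lρ G (2 * (η * G) / lam)
  eta_effL_le : 8 * (η * effL ρ L₀ Lρ G) ≤ lam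
  beta_eq : β * lam ^ 3 = 1600 * effL ρ L₀ Lρ G ^ 2 * G * η ^ 2
  beta_le : β ≤ 1

/-- The gradient of `f`, extended by zero off `D` so that it is measurable. -/
noncomputable def gradExt {d : ℕ} (D : Set (Vec d)) (f : Vec d → ℝ) : Vec d → Vec d :=
  D.indicator (gradient f)

/-- The stochastic gradient, extended by zero off `D` so that it is jointly measurable. -/
noncomputable def sgradExt {d : ℕ} {Ξ : Type*} (D : Set (Vec d)) (F : Vec d → Ξ → ℝ) (x : Vec d)
    (z : Ξ) : Vec d :=
  D.indicator (fun y => sgrad F y z) x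

/-- A state is good if the gradient and the momentum error are at most `G`, and the next step stays
in `D` and has coordinatewise step sizes in `[η / (2 G), η / λ]`. -/
structure Good {d : ℕ} (D : Set (Vec d)) (f : Vec d → ℝ) (G η lam : ℝ) (s : State d) : Prop where
  segment_subset : segment ℝ s.x s.next ⊆ D
  norm_grad_le : ‖gradExt D f s.x‖ ≤ G
  norm_err_le : ‖s.m - gradExt D f s.x‖ ≤ G
  exists_step_size : ∀ i, ∃ a ∈ Set.Icc (η / (2 * G)) (η / lam), s.x i - s.next i = a * s.m i

/-- The squared momentum error of a state. -/
noncomputable def errSq {d : ℕ} (D : Set (Vec d)) (f : Vec d → ℝ) (s : State d) : ℝ :=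
  ‖s.m - gradExt D f s.x‖ ^ 2

/-- The squared gradient norm of a state. -/
noncomputable def gradSq {d : ℕ} (D : Set (Vec d)) (f : Vec d → ℝ) (s : State d) : ℝ :=
  ‖gradExt D f s.x‖ ^ 2

/-- The fluctuation of the momentum error in one step: the centred part of the new momentum given
the state `s`. -/
noncomputable def stepNoise {d : ℕ} {Ξ : Type*} (f : Vec d → ℝ) (F : Vec d → Ξ → ℝ) (β : ℝ)
    (s : State d) (z : Ξ) : Vec d :=
  β • (sgrad F s.next z - gradient f s.next)
    + (1 - β) • ((sgrad F s.next z - sgrad F s.x z) - (gradient f s.next - gradient f s.x))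

section SingleStep

variable {d : ℕ} {Ξ : Type*} [MeasurableSpace Ξ] {D : Set (Vec d)} {f : Vec d → ℝ} {P : Measure Ξ}
  {F : Vec d → Ξ → ℝ} {ρ σ L₀ Lρ lam G η β : ℝ} {s : State d}

theorem gradExt_of_mem {x : Vec d} (hx : x ∈ D) : gradExt D f x = gradient f x :=
  Set.indicator_of_mem hx _

theorem sgradExt_of_mem {Ξ : Type*} {F : Vec d → Ξ → ℝ} {x : Vec d} (hx : x ∈ D) :
    sgradExt D F x = sgrad F x :=
  funext fun _ => Set.indicator_of_mem hx _

theorem errSq_nonneg (s : State d) : 0 ≤ errSq D f s := sq_nonneg _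

theorem gradSq_nonneg (s : State d) : 0 ≤ gradSq D f s := sq_nonneg _

theorem StepRegime.beta_nonneg (hr : StepRegime ρ σ L₀ Lρ lam G η β) : 0 ≤ β := by
  have hG := hr.G_pos
  refine nonneg_of_mul_nonneg_left ?_ (pow_pos hr.lam_pos 3)
  rw [hr.beta_eq]
  positivity

theorem Problem.integrable_sgrad [IsProbabilityMeasure P] (hp : Problem D f P F ρ σ L₀ Lρ)
    {x : Vec d} (hx : x ∈ D) : Integrable (sgrad F x) P := by
  have hcentred : Integrable (fun z => sgrad F x z - gradient f x) P :=
    .of_bound (((hp.measurable_sgrad x hx).sub measurable_const).aestronglyMeasurable) σ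
      (hp.noise x hx)
  exact (hcentred.add (integrable_const (gradient f x))).congr
    (ae_of_all _ fun z => sub_add_cancel _ _)

theorem norm_le_mul_norm_of_forall_abs_le {v w : Vec d} {c : ℝ} (hc : 0 ≤ c)
    (h : ∀ i, |v i| ≤ c * |w i|) : ‖v‖ ≤ c * ‖w‖ := by
  refine le_of_sq_le_sq ?_ (by positivity)
  rw [mul_pow, EuclideanSpace.real_norm_sq_eq, EuclideanSpace.real_norm_sq_eq, Finset.mul_sum]
  refine Finset.sum_le_sum fun i _ => ?_
  rw [← sq_abs, ← sq_abs (w i), ← mul_pow]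
  exact pow_le_pow_left₀ (abs_nonneg _) (h i) 2

namespace Good

theorem mem (hs : Good D f G η lam s) : s.x ∈ D :=
  hs.segment_subset (left_mem_segment ℝ _ _)

theorem next_mem (hs : Good D f G η lam s) : s.next ∈ D :=
  hs.segment_subset (right_mem_segment ℝ _ _)

theorem norm_gradient_le (hs : Good D f G η lam s) : ‖gradient f s.x‖ ≤ G :=
  gradExt_of_mem hs.mem ▸ hs.norm_grad_le

theorem norm_m_le_add (s : State d) :
    ‖s.m‖ ≤ ‖gradExt D f s.x‖ + ‖s.m - gradExt D f s.x‖ := by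
  simpa using norm_add_le (gradExt D f s.x) (s.m - gradExt D f s.x)

theorem norm_m_le (hs : Good D f G η lam s) : ‖s.m‖ ≤ 2 * G := by
  linarith [norm_m_le_add (D := D) (f := f) s, hs.norm_grad_le, hs.norm_err_le]

theorem norm_next_sub_le (hs : Good D f G η lam s) (hr : StepRegime ρ σ L₀ Lρ lam G η β) :
    ‖s.next - s.x‖ ≤ η / lam * ‖s.m‖ := by
  have hG := hr.G_pos
  have hη := hr.eta_pos
  have hlam := hr.lam_pos
  refine norm_le_mul_norm_of_forall_abs_le (by positivity) fun i => ?_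
  obtain ⟨a, ⟨ha, ha'⟩, heq⟩ := hs.exists_step_size i
  have ha0 : 0 ≤ a := le_trans (by positivity) ha
  rw [PiLp.sub_apply, abs_sub_comm, heq, abs_mul, abs_of_nonneg ha0]
  gcongr

theorem isShort (hs : Good D f G η lam s) (hp : Problem D f P F ρ σ L₀ Lρ)
    (hr : StepRegime ρ σ L₀ Lρ lam G η β) : IsShort ρ L₀ Lρ G ‖s.next - s.x‖ := by
  have hη := hr.eta_pos
  have hlam := hr.lam_pos
  refine hr.short.mono hp.L₀_nonneg hp.Lρ_nonneg hr.G_pos.le ?_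
  calc ‖s.next - s.x‖ ≤ η / lam * ‖s.m‖ := hs.norm_next_sub_le hr
    _ ≤ η / lam * (2 * G) := by gcongr; exact hs.norm_m_le
    _ = 2 * (η * G) / lam := by ring

theorem norm_gradient_sub_le (hs : Good D f G η lam s) (hp : Problem D f P F ρ σ L₀ Lρ)
    (hr : StepRegime ρ σ L₀ Lρ lam G η β) {h : Vec d → ℝ} (hh : GenSmoothOn D ρ L₀ Lρ h)
    (hx : ‖gradient h s.x‖ ≤ 2 * G) : ∀ p ∈ segment ℝ s.x s.next,
      ‖gradient h p - gradient h s.x‖ ≤ effL ρ L₀ Lρ G * ‖p - s.x‖ :=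
  hh.norm_gradient_sub_le hp.isOpen hp.rho_nonneg hp.rho_le_one hp.L₀_nonneg hp.Lρ_nonneg
    hr.G_pos hs.segment_subset hx (hs.isShort hp hr)

theorem norm_gradient_next_sub_le (hs : Good D f G η lam s) (hp : Problem D f P F ρ σ L₀ Lρ)
    (hr : StepRegime ρ σ L₀ Lρ lam G η β) :
    ‖gradient f s.next - gradient f s.x‖ ≤ effL ρ L₀ Lρ G * ‖s.next - s.x‖ :=
  hs.norm_gradient_sub_le hp hr hp.smooth (by linarith [hs.norm_gradient_le, hr.G_pos]) _
    (right_mem_segment ℝ _ _)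

theorem norm_gradExt_next_le (hs : Good D f G η lam s) (hp : Problem D f P F ρ σ L₀ Lρ)
    (hr : StepRegime ρ σ L₀ Lρ lam G η β) :
    ‖gradExt D f s.next‖ ≤ ‖gradExt D f s.x‖ + effL ρ L₀ Lρ G * η / lam * ‖s.m‖ := by
  have hL := effL_nonneg (ρ := ρ) hp.L₀_nonneg hp.Lρ_nonneg hr.G_pos.le
  rw [gradExt_of_mem hs.mem, gradExt_of_mem hs.next_mem]
  calc ‖gradient f s.next‖ ≤ ‖gradient f s.x‖ + ‖gradient f s.next - gradient f s.x‖ :=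
        norm_le_norm_add_norm_sub' _ _
    _ ≤ ‖gradient f s.x‖ + effL ρ L₀ Lρ G * (η / lam * ‖s.m‖) := by
        gcongr
        exact (hs.norm_gradient_next_sub_le hp hr).trans (by gcongr; exact hs.norm_next_sub_le hr)
    _ = _ := by ring

end Good

theorem neg_mul_add_mul_sq_le {L a g m : ℝ} (ha : 0 ≤ a) (hLa : L * a ≤ 1 / 8) :
    g * -(a * m) + L * (a * m) ^ 2 ≤ -(a / 4) * g ^ 2 + 3 * a / 4 * (m - g) ^ 2 := by
  have hquad : L * (a * m) ^ 2 ≤ 1 / 8 * (a * m ^ 2) := calc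
    L * (a * m) ^ 2 = L * a * (a * m ^ 2) := by ring
    _ ≤ 1 / 8 * (a * m ^ 2) := by gcongr
  have hsq : 0 ≤ a * (5 / 8 * g ^ 2 + 3 / 4 * (g * (m - g)) + 5 / 8 * (m - g) ^ 2) :=
    mul_nonneg ha (by nlinarith [sq_nonneg (g + (m - g)), sq_nonneg g, sq_nonneg (m - g)])
  linarith

theorem coordinate_descent {L a g m : ℝ} (hG : 0 < G) (hη : 0 < η) (hlam : 0 < lam) (hL : 0 ≤ L)
    (hle : 8 * (η * L) ≤ lam) (ha : a ∈ Set.Icc (η / (2 * G)) (η / lam)) :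
    g * -(a * m) + L * (a * m) ^ 2 ≤ -(η / (8 * G)) * g ^ 2 + 3 * η / (4 * lam) * (m - g) ^ 2 := by
  have hLa : L * a ≤ 1 / 8 := calc
    L * a ≤ L * (η / lam) := by gcongr; exact ha.2
    _ = 8 * (η * L) / (8 * lam) := by field_simp
    _ ≤ lam / (8 * lam) := by gcongr
    _ = 1 / 8 := by field_simp
  have hlower : η / (8 * G) ≤ a / 4 := calc
    η / (8 * G) = η / (2 * G) / 4 := by ring
    _ ≤ a / 4 := by gcongr; exact ha.1
  have hupper : 3 * a / 4 ≤ 3 * η / (4 * lam) := calc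
    3 * a / 4 ≤ 3 * (η / lam) / 4 := by gcongr; exact ha.2
    _ = 3 * η / (4 * lam) := by ring
  have ha0 : 0 ≤ a := le_trans (by positivity) ha.1
  linarith [neg_mul_add_mul_sq_le ha0 hLa (g := g) (m := m),
    mul_le_mul_of_nonneg_right hlower (sq_nonneg g),
    mul_le_mul_of_nonneg_right hupper (sq_nonneg (m - g))]

theorem Good.descent (hs : Good D f G η lam s) (hp : Problem D f P F ρ σ L₀ Lρ)
    (hr : StepRegime ρ σ L₀ Lρ lam G η β) :
    f s.next - f s.x ≤ -(η / (8 * G)) * gradSq D f s + 3 * η / (4 * lam) * errSq D f s := by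
  have hL := effL_nonneg (ρ := ρ) hp.L₀_nonneg hp.Lρ_nonneg hr.G_pos.le
  rw [gradSq, errSq, gradExt_of_mem hs.mem]
  refine (sub_le_inner_gradient_add hL
    (fun p hpx => hp.smooth.hasGradientAt hp.isOpen (hs.segment_subset hpx))
    (hs.norm_gradient_sub_le hp hr hp.smooth
      (by linarith [hs.norm_gradient_le, hr.G_pos]))).trans ?_
  simp only [PiLp.inner_apply, EuclideanSpace.real_norm_sq_eq, Finset.mul_sum,
    ← Finset.sum_add_distrib]
  refine Finset.sum_le_sum fun i _ => ?_
  obtain ⟨a, ha, heq⟩ := hs.exists_step_size i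
  have hnext : (s.next - s.x) i = -(a * s.m i) := by rw [PiLp.sub_apply, ← heq, neg_sub]
  rw [hnext, RCLike.inner_apply, conj_trivial, mul_comm, neg_sq, PiLp.sub_apply]
  exact coordinate_descent hr.G_pos hr.eta_pos hr.lam_pos hL hr.eta_effL_le ha

section Variance

theorem variance_recursion_bound {L R e g w : ℝ} (hG : 0 < G) (hlam : 0 < lam)
    (hlG : 2 * lam ≤ G) (hβ0 : 0 ≤ β) (hβ1 : β ≤ 1)
    (hβ : β * lam ^ 3 = 1600 * L ^ 2 * G * η ^ 2) (hR0 : 0 ≤ R)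
    (hR : R ≤ η / lam * w) (hw0 : 0 ≤ w) (hw : w ≤ g + e) :
    ((1 - β) * e) ^ 2 + (β * σ + 2 * L * R) ^ 2
      ≤ (1 - β / 2) * e ^ 2 + β * lam / (100 * G) * g ^ 2 + 2 * β ^ 2 * σ ^ 2 := by
  have hR2 : R ^ 2 ≤ (η / lam) ^ 2 * (2 * (g ^ 2 + e ^ 2)) := calc
    R ^ 2 ≤ (η / lam) ^ 2 * w ^ 2 := mul_pow (η / lam) w 2 ▸ pow_le_pow_left₀ hR0 hR 2
    _ ≤ (η / lam) ^ 2 * (2 * (g ^ 2 + e ^ 2)) := by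
      gcongr
      exact (pow_le_pow_left₀ hw0 hw 2).trans add_sq_le
  have hθ : 16 * L ^ 2 * (η / lam) ^ 2 = β * lam / (100 * G) := by
    field_simp
    linear_combination (-1 : ℝ) * hβ
  have hθ_le : β * lam / (100 * G) ≤ β / 200 := by
    rw [div_le_div_iff₀ (by positivity) (by norm_num)]
    nlinarith
  have hdrift : 8 * L ^ 2 * R ^ 2 ≤ β * lam / (100 * G) * g ^ 2 + β / 200 * e ^ 2 := calc
    8 * L ^ 2 * R ^ 2 ≤ 8 * L ^ 2 * ((η / lam) ^ 2 * (2 * (g ^ 2 + e ^ 2))) := by gcongr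
    _ = β * lam / (100 * G) * g ^ 2 + β * lam / (100 * G) * e ^ 2 := by rw [← hθ]; ring
    _ ≤ β * lam / (100 * G) * g ^ 2 + β / 200 * e ^ 2 := by gcongr
  have hcontr : ((1 - β) * e) ^ 2 ≤ (1 - β) * e ^ 2 := by
    rw [mul_pow]
    gcongr
    nlinarith
  have hcross : (β * σ + 2 * L * R) ^ 2 ≤ 2 * ((β * σ) ^ 2 + (2 * L * R) ^ 2) := add_sq_le
  nlinarith [mul_nonneg hβ0 (sq_nonneg e)]

theorem Problem.integrable_stepNoise [IsProbabilityMeasure P] (hp : Problem D f P F ρ σ L₀ Lρ)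
    (hx : s.x ∈ D) (hy : s.next ∈ D) : Integrable (stepNoise f F β s) P :=
  (((hp.integrable_sgrad hy).sub (integrable_const _)).smul β).add
    ((((hp.integrable_sgrad hy).sub (hp.integrable_sgrad hx)).sub
      (integrable_const _)).smul (1 - β))

theorem Problem.integral_stepNoise [IsProbabilityMeasure P] (hp : Problem D f P F ρ σ L₀ Lρ)
    (hx : s.x ∈ D) (hy : s.next ∈ D) : ∫ z, stepNoise f F β s z ∂P = 0 := by
  have hcentred : ∀ y ∈ D, Integrable (fun z => sgrad F y z - gradient f y) P ∧
      ∫ z, (sgrad F y z - gradient f y) ∂P = 0 := fun y hy => by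
    refine ⟨(hp.integrable_sgrad hy).sub (integrable_const _), ?_⟩
    rw [integral_sub (hp.integrable_sgrad hy) (integrable_const _), hp.integral_sgrad y hy]
    simp
  have hrearrange : ∀ z, stepNoise f F β s z = (sgrad F s.next z - gradient f s.next)
      - (1 - β) • (sgrad F s.x z - gradient f s.x) := fun z => by rw [stepNoise]; module
  simp_rw [hrearrange]
  rw [integral_sub (hcentred _ hy).1 ((hcentred _ hx).1.fun_smul (1 - β)), integral_smul,
    (hcentred _ hx).2, (hcentred _ hy).2, smul_zero, sub_zero]

theorem Good.ae_norm_stepNoise_le (hs : Good D f G η lam s) (hp : Problem D f P F ρ σ L₀ Lρ)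
    (hr : StepRegime ρ σ L₀ Lρ lam G η β) :
    ∀ᵐ z ∂P, ‖stepNoise f F β s z‖ ≤ β * σ + 2 * effL ρ L₀ Lρ G * ‖s.next - s.x‖ := by
  have hβ0 := hr.beta_nonneg
  have hβ1 : 0 ≤ 1 - β := sub_nonneg.2 hr.beta_le
  filter_upwards [hp.noise _ hs.mem, hp.noise _ hs.next_mem] with z hzx hzy
  have hsx : ‖sgrad F s.x z‖ ≤ 2 * G := by
    linarith [norm_le_norm_add_norm_sub' (sgrad F s.x z) (gradient f s.x), hs.norm_gradient_le,
      hr.sigma_le, hr.G_pos]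
  have hsdiff : ‖sgrad F s.next z - sgrad F s.x z‖ ≤ effL ρ L₀ Lρ G * ‖s.next - s.x‖ :=
    hs.norm_gradient_sub_le hp hr (hp.smooth_comp z) hsx _ (right_mem_segment ℝ _ _)
  have hdiff : ‖(sgrad F s.next z - sgrad F s.x z) - (gradient f s.next - gradient f s.x)‖
      ≤ 2 * effL ρ L₀ Lρ G * ‖s.next - s.x‖ := by
    linarith [norm_sub_le (sgrad F s.next z - sgrad F s.x z) (gradient f s.next - gradient f s.x),
      hs.norm_gradient_next_sub_le hp hr]
  refine (norm_add_le _ _).trans ?_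
  rw [norm_smul, norm_smul, Real.norm_of_nonneg hβ0, Real.norm_of_nonneg hβ1]
  exact add_le_add (mul_le_mul_of_nonneg_left hzy hβ0)
    ((mul_le_of_le_one_left (norm_nonneg _) (by linarith)).trans hdiff)

theorem Good.errSq_oracleStep {Ξ : Type*} {F : Vec d → Ξ → ℝ}
    (hs : Good D f G η lam s) (βsq : ℝ) (t : ℕ) (z : Ξ) :
    errSq D f (oracleStep (sgradExt D F) η β βsq lam t z s)
      = ‖(1 - β) • (s.m - gradient f s.x) + stepNoise f F β s z‖ ^ 2 := by
  simp only [errSq, oracleStep, stepNoise, sgradExt_of_mem hs.mem, sgradExt_of_mem hs.next_mem,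
    gradExt_of_mem hs.next_mem]
  congr 2
  module

theorem Good.integrable_errSq_oracleStep [IsProbabilityMeasure P] (hs : Good D f G η lam s)
    (hp : Problem D f P F ρ σ L₀ Lρ) (hr : StepRegime ρ σ L₀ Lρ lam G η β) (βsq : ℝ) (t : ℕ) :
    Integrable (fun z => errSq D f (oracleStep (sgradExt D F) η β βsq lam t z s)) P := by
  simp_rw [hs.errSq_oracleStep]
  exact integrable_norm_add_sq (hp.integrable_stepNoise hs.mem hs.next_mem).aestronglyMeasurable
    (hs.ae_norm_stepNoise_le hp hr) _

theorem Good.integral_errSq_oracleStep_le [IsProbabilityMeasure P] (hs : Good D f G η lam s)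
    (hp : Problem D f P F ρ σ L₀ Lρ) (hr : StepRegime ρ σ L₀ Lρ lam G η β) (βsq : ℝ) (t : ℕ) :
    ∫ z, errSq D f (oracleStep (sgradExt D F) η β βsq lam t z s) ∂P
      ≤ (1 - β / 2) * errSq D f s + β * lam / (100 * G) * gradSq D f s + 2 * β ^ 2 * σ ^ 2 := by
  have hm := norm_m_le_add (D := D) (f := f) s
  rw [errSq, gradSq, gradExt_of_mem hs.mem] at *
  simp_rw [hs.errSq_oracleStep]
  refine (integral_norm_add_sq_le (hp.integrable_stepNoise hs.mem hs.next_mem).aestronglyMeasurable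
    (hs.ae_norm_stepNoise_le hp hr) (hp.integral_stepNoise hs.mem hs.next_mem) _).trans ?_
  rw [norm_smul, Real.norm_of_nonneg (sub_nonneg.2 hr.beta_le)]
  exact variance_recursion_bound hr.G_pos hr.lam_pos hr.lam_le hr.beta_nonneg hr.beta_le
    hr.beta_eq (norm_nonneg _) (hs.norm_next_sub_le hr) (norm_nonneg _) hm

end Variance

end SingleStep

open Classical in
/-- The indicator of the event that the first `n` states of a run are good. -/
noncomputable def active {d : ℕ} (D : Set (Vec d)) (f : Vec d → ℝ) (G η lam : ℝ)
    (s : ℕ → State d) (n : ℕ) : ℝ :=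
  if ∀ j < n, Good D f G η lam (s j) then 1 else 0

/-- The sum of the squared gradients over the first `n` states of a run, stopped at the first state
that is not good. -/
noncomputable def gradTotal {d : ℕ} (D : Set (Vec d)) (f : Vec d → ℝ) (G η lam : ℝ) (n : ℕ)
    (s : ℕ → State d) : ℝ :=
  ∑ k ∈ Finset.range n, active D f G η lam s (k + 1) * gradSq D f (s k)

/-- The sum of the squared momentum errors over the first `n` states of a run, stopped at the first
state that is not good. -/
noncomputable def errTotal {d : ℕ} (D : Set (Vec d)) (f : Vec d → ℝ) (G η lam : ℝ) (n : ℕ)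
    (s : ℕ → State d) : ℝ :=
  ∑ k ∈ Finset.range n, active D f G η lam s (k + 1) * errSq D f (s k)

/-- The squared momentum error of the first state that is not good, if it is among the first `n`
states of a run, and zero otherwise. -/
noncomputable def exitErr {d : ℕ} (D : Set (Vec d)) (f : Vec d → ℝ) (G η lam : ℝ) (n : ℕ)
    (s : ℕ → State d) : ℝ :=
  ∑ k ∈ Finset.range n,
    (active D f G η lam s k * errSq D f (s k) - active D f G η lam s (k + 1) * errSq D f (s k))

section Pathwise

variable {d : ℕ} {D : Set (Vec d)} {f : Vec d → ℝ} {ρ σ L₀ Lρ lam G η β : ℝ} {s : ℕ → State d}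
  {n : ℕ}

theorem active_of_forall (h : ∀ j < n, Good D f G η lam (s j)) : active D f G η lam s n = 1 :=
  if_pos h

theorem active_of_not_forall (h : ¬ ∀ j < n, Good D f G η lam (s j)) :
    active D f G η lam s n = 0 :=
  if_neg h

theorem active_zero : active D f G η lam s 0 = 1 :=
  active_of_forall (by simp)

theorem active_congr {s' : ℕ → State d} (h : ∀ j < n, s j = s' j) :
    active D f G η lam s n = active D f G η lam s' n := by
  unfold active
  congr 1
  exact propext (forall₂_congr fun j hj => by rw [h j hj])

theorem active_nonneg : 0 ≤ active D f G η lam s n := by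
  unfold active
  split_ifs <;> norm_num

theorem active_succ_le : active D f G η lam s (n + 1) ≤ active D f G η lam s n := by
  by_cases h : ∀ j < n + 1, Good D f G η lam (s j)
  · rw [active_of_forall h, active_of_forall fun j hj => h j (by lia)]
  · exact active_of_not_forall h ▸ active_nonneg

theorem active_succ_mul_le {q : State d → ℝ} {b : ℝ} (hb : 0 ≤ b)
    (hq : ∀ s, Good D f G η lam s → q s ≤ b) : active D f G η lam s (n + 1) * q (s n) ≤ b := by
  by_cases h : ∀ j < n + 1, Good D f G η lam (s j)
  · rw [active_of_forall h, one_mul]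
    exact hq _ (h n n.lt_succ_self)
  · rwa [active_of_not_forall h, zero_mul]

theorem Good.errSq_le {s : State d} (hs : Good D f G η lam s) : errSq D f s ≤ G ^ 2 :=
  pow_le_pow_left₀ (norm_nonneg _) hs.norm_err_le 2

theorem Good.gradSq_le {s : State d} (hs : Good D f G η lam s) : gradSq D f s ≤ G ^ 2 :=
  pow_le_pow_left₀ (norm_nonneg _) hs.norm_grad_le 2

theorem gradTotal_nonneg : 0 ≤ gradTotal D f G η lam n s :=
  Finset.sum_nonneg fun _ _ => mul_nonneg active_nonneg (gradSq_nonneg _)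

theorem errTotal_nonneg : 0 ≤ errTotal D f G η lam n s :=
  Finset.sum_nonneg fun _ _ => mul_nonneg active_nonneg (errSq_nonneg _)

theorem active_mul_errSq_sub_nonneg (k : ℕ) : 0 ≤
    active D f G η lam s k * errSq D f (s k) - active D f G η lam s (k + 1) * errSq D f (s k) :=
  sub_nonneg.2 (mul_le_mul_of_nonneg_right active_succ_le (errSq_nonneg _))

theorem exitErr_nonneg : 0 ≤ exitErr D f G η lam n s :=
  Finset.sum_nonneg fun k _ => active_mul_errSq_sub_nonneg k

theorem sum_add_le_gradTotal_add_errTotal {k : ℕ} (hk : k ≤ n)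
    (hgood : ∀ j < k, Good D f G η lam (s j)) :
    ∑ j ∈ Finset.range k, (gradSq D f (s j) + errSq D f (s j))
      ≤ gradTotal D f G η lam n s + errTotal D f G η lam n s := by
  rw [gradTotal, errTotal, ← Finset.sum_add_distrib]
  refine le_trans (Finset.sum_le_sum fun j hj => ?_) (Finset.sum_le_sum_of_subset_of_nonneg
    (Finset.range_subset_range.2 hk) fun j _ _ => add_nonneg
      (mul_nonneg active_nonneg (gradSq_nonneg _)) (mul_nonneg active_nonneg (errSq_nonneg _)))
  have hj := Finset.mem_range.1 hj
  rw [active_of_forall fun i hi => hgood i (by lia), one_mul, one_mul]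

theorem norm_err_le_of_exitErr_le (hG : 0 ≤ G) (hexit : exitErr D f G η lam n s ≤ G ^ 2) {k : ℕ}
    (hk : k < n) (hgood : ∀ j < k, Good D f G η lam (s j)) :
    ‖(s k).m - gradExt D f (s k).x‖ ≤ G := by
  by_cases h : ∀ j < k + 1, Good D f G η lam (s j)
  · exact (h k k.lt_succ_self).norm_err_le
  · refine le_of_sq_le_sq ((le_of_eq ?_).trans ((Finset.single_le_sum
      (fun j _ => active_mul_errSq_sub_nonneg j) (Finset.mem_range.2 hk)).trans hexit)) hG
    rw [active_of_forall hgood, active_of_not_forall h, one_mul, zero_mul, sub_zero, errSq]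

section Descent

variable {Ξ : Type*} [MeasurableSpace Ξ] {P : Measure Ξ} {F : Vec d → Ξ → ℝ}

theorem Problem.sInf_le (hp : Problem D f P F ρ σ L₀ Lρ) {x : Vec d} (hx : x ∈ D) :
    sInf (f '' D) ≤ f x :=
  csInf_le hp.bddBelow ⟨x, hx, rfl⟩

theorem mul_gradTotal_le (hp : Problem D f P F ρ σ L₀ Lρ) (hr : StepRegime ρ σ L₀ Lρ lam G η β)
    (hs : ∀ k, (s (k + 1)).x = (s k).next) (h0 : (s 0).x ∈ D) (n : ℕ) :
    η / (8 * G) * gradTotal D f G η lam n s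
      ≤ initGap D f (s 0).x + 3 * η / (4 * lam) * errTotal D f G η lam n s := by
  set A : ℕ → ℝ := fun n => η / (8 * G) * gradTotal D f G η lam n s
    - 3 * η / (4 * lam) * errTotal D f G η lam n s with hA
  -- The second bound holds only while the run is good; it turns into the first at the exit.
  suffices h : A n ≤ initGap D f (s 0).x ∧
      ((∀ j < n, Good D f G η lam (s j)) → A n ≤ f (s 0).x - f (s n).x) by
    linarith [h.1]
  induction n with
  | zero =>
    have hA0 : A 0 = 0 := by simp [hA, gradTotal, errTotal]
    exact ⟨hA0 ▸ sub_nonneg.2 (hp.sInf_le h0), fun _ => by rw [hA0, sub_self]⟩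
  | succ n ih =>
    have hsucc : A (n + 1) = A n + active D f G η lam s (n + 1) *
        (η / (8 * G) * gradSq D f (s n) - 3 * η / (4 * lam) * errSq D f (s n)) := by
      simp only [hA, gradTotal, errTotal, Finset.sum_range_succ]
      ring
    by_cases h : ∀ j < n + 1, Good D f G η lam (s j)
    · have hgood := h n n.lt_succ_self
      have hdesc : A (n + 1) ≤ f (s 0).x - f (s (n + 1)).x := by
        rw [hsucc, active_of_forall h, hs n]
        linarith [hgood.descent hp hr, ih.2 fun j hj => h j (by lia)]
      have hnext : (s (n + 1)).x ∈ D := hs n ▸ hgood.next_mem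
      exact ⟨hdesc.trans (sub_le_sub_left (hp.sInf_le hnext) _), fun _ => hdesc⟩
    · rw [hsucc, active_of_not_forall h, zero_mul, add_zero]
      exact ⟨ih.1, fun h' => absurd h' h⟩

theorem drift_bound {q S a b w a' : ℝ} (hG : 0 < G) (hq : 0 ≤ q) (hS : 0 ≤ S) (hw : w ≤ a + b)
    (hw2 : w ≤ 2 * G) (ha : a ≤ G / 2 + q * (2 * G) + q * (3 / G) * S) (ha' : a' ≤ a + q * w) :
    a' ≤ G / 2 + q * (2 * G) + q * (3 / G) * (S + (a ^ 2 + b ^ 2)) := by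
  rw [mul_add]
  rcases le_or_gt a (G / 2) with hsmall | hlarge
  · have hqw : q * w ≤ q * (2 * G) := by gcongr
    have hS' : 0 ≤ q * (3 / G) * S := by positivity
    have hab : 0 ≤ q * (3 / G) * (a ^ 2 + b ^ 2) := by positivity
    linarith
  · have hw' : w ≤ 3 / G * (a ^ 2 + b ^ 2) := by
      refine hw.trans ?_
      rw [div_mul_eq_mul_div, le_div_iff₀ hG]
      nlinarith [sq_nonneg (b - G / 2)]
    have hqw : q * w ≤ q * (3 / G * (a ^ 2 + b ^ 2)) := by gcongr
    linarith

theorem norm_gradExt_le_add_sum (hp : Problem D f P F ρ σ L₀ Lρ)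
    (hr : StepRegime ρ σ L₀ Lρ lam G η β) (hs : ∀ k, (s (k + 1)).x = (s k).next)
    (h0 : 2 * ‖gradExt D f (s 0).x‖ ≤ G) (hgood : ∀ j < n, Good D f G η lam (s j)) :
    ‖gradExt D f (s n).x‖ ≤ G / 2 + effL ρ L₀ Lρ G * η / lam * (2 * G)
      + effL ρ L₀ Lρ G * η / lam * (3 / G)
        * ∑ k ∈ Finset.range n, (gradSq D f (s k) + errSq D f (s k)) := by
  have hG := hr.G_pos
  have hq : 0 ≤ effL ρ L₀ Lρ G * η / lam := div_nonneg
    (mul_nonneg (effL_nonneg hp.L₀_nonneg hp.Lρ_nonneg hG.le) hr.eta_pos.le) hr.lam_pos.le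
  induction n with
  | zero =>
    have := mul_nonneg hq hG.le
    simp only [Finset.range_zero, Finset.sum_empty, mul_zero, add_zero]
    linarith
  | succ n ih =>
    have hn := hgood n n.lt_succ_self
    rw [hs n, Finset.sum_range_succ]
    exact drift_bound hG hq
      (Finset.sum_nonneg fun k _ => add_nonneg (gradSq_nonneg _) (errSq_nonneg _))
      (Good.norm_m_le_add (s n)) hn.norm_m_le (ih fun j hj => hgood j (by lia))
      (hn.norm_gradExt_next_le hp hr)

theorem norm_gradExt_le_of_total_le (hp : Problem D f P F ρ σ L₀ Lρ)
    (hr : StepRegime ρ σ L₀ Lρ lam G η β) (hs : ∀ k, (s (k + 1)).x = (s k).next)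
    (h0 : 2 * ‖gradExt D f (s 0).x‖ ≤ G)
    (htotal : 12 * (effL ρ L₀ Lρ G * η)
      * (gradTotal D f G η lam n s + errTotal D f G η lam n s) ≤ lam * G ^ 2)
    {k : ℕ} (hk : k ≤ n) (hgood : ∀ j < k, Good D f G η lam (s j)) :
    ‖gradExt D f (s k).x‖ ≤ G := by
  have hG := hr.G_pos
  have hη := hr.eta_pos
  have hlam := hr.lam_pos
  have hL := effL_nonneg (ρ := ρ) hp.L₀_nonneg hp.Lρ_nonneg hG.le
  have hstep : effL ρ L₀ Lρ G * η / lam * (2 * G) ≤ G / 4 := calc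
    _ = 8 * (η * effL ρ L₀ Lρ G) / lam * (G / 4) := by ring
    _ ≤ 1 * (G / 4) := by gcongr; exact (div_le_one hlam).2 hr.eta_effL_le
    _ = G / 4 := one_mul _
  have hdrift : effL ρ L₀ Lρ G * η / lam * (3 / G)
      * ∑ j ∈ Finset.range k, (gradSq D f (s j) + errSq D f (s j)) ≤ G / 4 := calc
    _ ≤ effL ρ L₀ Lρ G * η / lam * (3 / G)
        * (gradTotal D f G η lam n s + errTotal D f G η lam n s) := by
      gcongr
      exact sum_add_le_gradTotal_add_errTotal hk hgood
    _ = 12 * (effL ρ L₀ Lρ G * η) * (gradTotal D f G η lam n s + errTotal D f G η lam n s)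
        / (4 * (lam * G)) := by
      field_simp
      ring
    _ ≤ lam * G ^ 2 / (4 * (lam * G)) := by gcongr
    _ = G / 4 := by field_simp
  linarith [norm_gradExt_le_add_sum hp hr hs h0 hgood]

theorem forall_good (hp : Problem D f P F ρ σ L₀ Lρ) (hr : StepRegime ρ σ L₀ Lρ lam G η β)
    (hs : ∀ k, (s (k + 1)).x = (s k).next) {N : ℕ} (h0 : 2 * ‖gradExt D f (s 0).x‖ ≤ G)
    (herr0 : ‖(s 0).m - gradExt D f (s 0).x‖ ≤ G)
    (hseg : ∀ k ≤ N, segment ℝ (s k).x (s k).next ⊆ D)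
    (hstep : ∀ k ≤ N, (∀ j ≤ k, ‖gradExt D f (s j).x‖ ≤ G) →
      ∀ i, ∃ a ∈ Set.Icc (η / (2 * G)) (η / lam), (s k).x i - (s k).next i = a * (s k).m i)
    (hexit : N ≠ 0 → exitErr D f G η lam (N + 1) s ≤ G ^ 2)
    (htotal : N ≠ 0 → 12 * (effL ρ L₀ Lρ G * η)
      * (gradTotal D f G η lam (N + 1) s + errTotal D f G η lam (N + 1) s) ≤ lam * G ^ 2) :
    ∀ k ≤ N, Good D f G η lam (s k) := by
  intro k
  induction k using Nat.strong_induction_on with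
  | _ k ih =>
    intro hk
    have hgood : ∀ j < k, Good D f G η lam (s j) := fun j hj => ih j hj (by lia)
    have hbounds : ‖gradExt D f (s k).x‖ ≤ G ∧ ‖(s k).m - gradExt D f (s k).x‖ ≤ G := by
      rcases eq_or_ne k 0 with rfl | hk0
      · exact ⟨by linarith [norm_nonneg (gradExt D f (s 0).x)], herr0⟩
      · have hN : N ≠ 0 := by lia
        exact ⟨norm_gradExt_le_of_total_le hp hr hs h0 (htotal hN) (by lia) hgood,
          norm_err_le_of_exitErr_le hr.G_pos.le (hexit hN) (by lia) hgood⟩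
    refine ⟨hseg k hk, hbounds.1, hbounds.2, hstep k hk fun j hj => ?_⟩
    rcases hj.lt_or_eq with hj | rfl
    exacts [(hgood j hj).norm_grad_le, hbounds.1]

end Descent

end Pathwise

section Measurability

variable {d : ℕ} {D : Set (Vec d)} {f : Vec d → ℝ} {ρ σ L₀ Lρ lam G η β : ℝ}
  {Ξ : Type*} [MeasurableSpace Ξ] {P : Measure Ξ} {F : Vec d → Ξ → ℝ}

theorem Problem.measurable_sgradExt (hp : Problem D f P F ρ σ L₀ Lρ) :
    Measurable (Function.uncurry (sgradExt D F)) :=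
  measurable_uncurry_indicator hp.isOpen.measurableSet
    (fun z => (hp.smooth_comp z).continuousOn_gradient) hp.measurable_sgrad

theorem Problem.measurable_gradExt (hp : Problem D f P F ρ σ L₀ Lρ) :
    Measurable (gradExt D f) := by
  have h := measurable_uncurry_indicator (Z := Unit) hp.isOpen.measurableSet
    (fun _ => hp.smooth.continuousOn_gradient) (fun _ _ => measurable_const)
  exact h.comp (measurable_id.prodMk (measurable_const (a := ())))

theorem Problem.measurable_errSq (hp : Problem D f P F ρ σ L₀ Lρ) : Measurable (errSq D f) :=
  (measurable_state_m.sub (hp.measurable_gradExt.comp measurable_state_x)).norm.pow_const 2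

theorem Problem.measurable_gradSq (hp : Problem D f P F ρ σ L₀ Lρ) : Measurable (gradSq D f) :=
  (hp.measurable_gradExt.comp measurable_state_x).norm.pow_const 2

theorem exists_mem_Icc_eq_mul_iff {l u p m : ℝ} (hl : 0 ≤ l) (hlu : l ≤ u) :
    (∃ a ∈ Set.Icc l u, p = a * m) ↔ l * m ^ 2 ≤ p * m ∧ |p| ≤ u * |m| := by
  constructor
  · rintro ⟨a, ⟨hla, hau⟩, rfl⟩
    have hsq : a * m * m = a * m ^ 2 := by ring
    rw [hsq, abs_mul, abs_of_nonneg (hl.trans hla)]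
    exact ⟨by gcongr, by gcongr⟩
  · rintro ⟨hlower, hupper⟩
    rcases eq_or_ne m 0 with rfl | hm
    · exact ⟨l, ⟨le_rfl, hlu⟩, by simpa using hupper⟩
    · refine ⟨p / m, ⟨?_, ?_⟩, (div_mul_cancel₀ p hm).symm⟩
      · rw [← mul_div_mul_right p m hm, le_div_iff₀ (mul_self_pos.2 hm), ← sq]
        exact hlower
      · refine (le_abs_self _).trans ?_
        rwa [abs_div, div_le_iff₀ (abs_pos.2 hm)]

theorem Problem.measurableSet_good (hp : Problem D f P F ρ σ L₀ Lρ)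
    (hr : StepRegime ρ σ L₀ Lρ lam G η β) : MeasurableSet {s | Good D f G η lam s} := by
  have hη := hr.eta_pos
  have hlam := hr.lam_pos
  have hG := hr.G_pos
  have hmeas_segment : MeasurableSet {s : State d | segment ℝ s.x s.next ⊆ D} :=
    (measurable_state_x.prodMk measurable_state_next)
      (isOpen_setOf_segment_subset hp.isOpen).measurableSet
  have hgrad := hp.measurable_gradExt.comp measurable_state_x
  have hstep (i : Fin d) : MeasurableSet {s : State d | η / (2 * G) * s.m i ^ 2
      ≤ (s.x i - s.next i) * s.m i ∧ |s.x i - s.next i| ≤ η / lam * |s.m i|} := by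
    have hx := measurable_coord measurable_state_x i
    have hm := measurable_coord measurable_state_m i
    have hn := measurable_coord measurable_state_next i
    exact (measurableSet_le ((hm.pow_const 2).const_mul _) ((hx.sub hn).mul hm)).inter
      (measurableSet_le (measurable_norm.comp (hx.sub hn)) ((measurable_norm.comp hm).const_mul _))
  have hgood : ∀ s : State d, Good D f G η lam s ↔ segment ℝ s.x s.next ⊆ D ∧
      ‖gradExt D f s.x‖ ≤ G ∧ ‖s.m - gradExt D f s.x‖ ≤ G ∧ ∀ i, η / (2 * G) * s.m i ^ 2
        ≤ (s.x i - s.next i) * s.m i ∧ |s.x i - s.next i| ≤ η / lam * |s.m i| := by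
    intro s
    have hlu : η / (2 * G) ≤ η / lam := by gcongr; linarith [hr.lam_le]
    simp only [← exists_mem_Icc_eq_mul_iff (by positivity : 0 ≤ η / (2 * G)) hlu]
    exact ⟨fun h => ⟨h.1, h.2, h.3, h.4⟩, fun h => ⟨h.1, h.2.1, h.2.2.1, h.2.2.2⟩⟩
  have hsteps : MeasurableSet {s : State d | ∀ i, η / (2 * G) * s.m i ^ 2
      ≤ (s.x i - s.next i) * s.m i ∧ |s.x i - s.next i| ≤ η / lam * |s.m i|} := by
    simpa only [Set.ofPred_forall] using MeasurableSet.iInter hstep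
  simp only [hgood]
  exact hmeas_segment.inter ((measurableSet_le hgrad.norm measurable_const).inter
    ((measurableSet_le (measurable_state_m.sub hgrad).norm measurable_const).inter hsteps))

theorem Problem.measurable_active (hp : Problem D f P F ρ σ L₀ Lρ)
    (hr : StepRegime ρ σ L₀ Lρ lam G η β) (n : ℕ) :
    Measurable fun s => active D f G η lam s n := by
  refine Measurable.ite ?_ measurable_const measurable_const
  simp only [Set.ofPred_forall]
  exact MeasurableSet.iInter fun j => MeasurableSet.iInter fun _ =>
    measurable_pi_apply j (hp.measurableSet_good hr)

theorem Problem.measurable_active_mul (hp : Problem D f P F ρ σ L₀ Lρ)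
    (hr : StepRegime ρ σ L₀ Lρ lam G η β) {q : State d → ℝ} (hq : Measurable q) (n k : ℕ) :
    Measurable fun s : ℕ → State d => active D f G η lam s n * q (s k) :=
  (hp.measurable_active hr n).mul (hq.comp (measurable_pi_apply k))

end Measurability

/-- `X` is the random run of VRAdam with the extended oracle. The sample drawn at time
`k + 2 ≤ N + 1` is independent of the past, which is encoded as the path stopped at the index
`k`. -/
structure IsRun {d : ℕ} {Ω Ξ : Type*} [MeasurableSpace Ω] [MeasurableSpace Ξ] (μ : Measure Ω)
    (P : Measure Ξ) (D : Set (Vec d)) (F : Vec d → Ξ → ℝ) (η β βsq lam : ℝ) (x₁ : Vec d) (N : ℕ)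
    {S₁ : ℕ} (batch : Fin S₁ → Ω → Ξ) (ξ : ℕ → Ω → Ξ) (X : Ω → ℕ → State d) : Prop where
  eq_oracleState : ∀ ω, X ω
    = oracleState (sgradExt D F) η β βsq lam x₁ (fun j => batch j ω) (fun t => ξ t ω)
  aemeasurable : AEMeasurable X μ
  hasLaw_batch : ∀ j, HasLaw (batch j) P μ
  indepFun_batch : Pairwise fun i j => batch i ⟂ᵢ[μ] batch j
  hasLaw_sample : ∀ k < N, HasLaw (ξ (k + 2)) P μ
  indepFun_past : ∀ k < N, (fun ω j => X ω (min j k)) ⟂ᵢ[μ] ξ (k + 2)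

theorem active_stopped {d : ℕ} {D : Set (Vec d)} {f : Vec d → ℝ} {G η lam : ℝ}
    (s : ℕ → State d) (k : ℕ) :
    active D f G η lam (fun j => s (min j k)) (k + 1) = active D f G η lam s (k + 1) :=
  active_congr fun j hj => by rw [min_eq_left (Nat.lt_succ_iff.1 hj)]

section Expectation

variable {d : ℕ} {D : Set (Vec d)} {f : Vec d → ℝ} {ρ σ L₀ Lρ lam G η β βsq : ℝ}
  {Ω Ξ : Type*} [MeasurableSpace Ω] [MeasurableSpace Ξ] {μ : Measure Ω} {P : Measure Ξ}
  {F : Vec d → Ξ → ℝ} {x₁ : Vec d} {N S₁ k : ℕ} {batch : Fin S₁ → Ω → Ξ} {ξ : ℕ → Ω → Ξ}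
  {X : Ω → ℕ → State d}

namespace IsRun

theorem zero_x (hX : IsRun μ P D F η β βsq lam x₁ N batch ξ X) (ω : Ω) : (X ω 0).x = x₁ := by
  rw [hX.eq_oracleState]
  rfl

theorem succ (hX : IsRun μ P D F η β βsq lam x₁ N batch ξ X) (ω : Ω) (k : ℕ) : X ω (k + 1)
    = oracleStep (sgradExt D F) η β βsq lam (k + 2) (ξ (k + 2) ω) (X ω k) := by
  rw [hX.eq_oracleState]
  rfl

theorem succ_x (hX : IsRun μ P D F η β βsq lam x₁ N batch ξ X) (ω : Ω) (k : ℕ) :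
    (X ω (k + 1)).x = (X ω k).next := by
  rw [hX.succ]
  rfl

theorem zero_m_sub (hX : IsRun μ P D F η β βsq lam x₁ N batch ξ X) (hx₁ : x₁ ∈ D) (hS : S₁ ≠ 0)
    (ω : Ω) : (X ω 0).m - gradExt D f (X ω 0).x
      = (S₁ : ℝ)⁻¹ • ∑ j, (sgrad F x₁ (batch j ω) - gradient f x₁) := by
  have hm : (X ω 0).m = (S₁ : ℝ)⁻¹ • ∑ j, sgradExt D F x₁ (batch j ω) := by
    rw [hX.eq_oracleState]
    rfl
  rw [hm, hX.zero_x, sgradExt_of_mem hx₁, gradExt_of_mem hx₁, Finset.sum_sub_distrib,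
    Finset.sum_const, Finset.card_univ, Fintype.card_fin, smul_sub, ← Nat.cast_smul_eq_nsmul ℝ,
    inv_smul_smul₀ (Nat.cast_ne_zero.2 hS)]

theorem ae_norm_batch_sub_le (hX : IsRun μ P D F η β βsq lam x₁ N batch ξ X)
    (hp : Problem D f P F ρ σ L₀ Lρ) (hx₁ : x₁ ∈ D) :
    ∀ᵐ ω ∂μ, ∀ j, ‖sgrad F x₁ (batch j ω) - gradient f x₁‖ ≤ σ :=
  ae_all_iff.2 fun j => ((hX.hasLaw_batch j).ae_iff (measurableSet_setOfPred.1 (measurableSet_le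
    ((hp.measurable_sgrad x₁ hx₁).sub_const _).norm measurable_const))).2 (hp.noise x₁ hx₁)

theorem ae_norm_zero_m_sub_le (hX : IsRun μ P D F η β βsq lam x₁ N batch ξ X)
    (hp : Problem D f P F ρ σ L₀ Lρ) (hx₁ : x₁ ∈ D) (hS : S₁ ≠ 0) :
    ∀ᵐ ω ∂μ, ‖(X ω 0).m - gradExt D f (X ω 0).x‖ ≤ σ := by
  filter_upwards [hX.ae_norm_batch_sub_le hp hx₁] with ω hω
  have hS' : (S₁ : ℝ) ≠ 0 := Nat.cast_ne_zero.2 hS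
  rw [hX.zero_m_sub hx₁ hS, norm_smul, Real.norm_of_nonneg (by positivity)]
  calc _ ≤ (S₁ : ℝ)⁻¹ * ∑ _ : Fin S₁, σ := by
        gcongr
        exact norm_sum_le_of_le _ fun j _ => hω j
    _ = σ := by simp [hS']

theorem integrable_errSq_zero [IsFiniteMeasure μ]
    (hX : IsRun μ P D F η β βsq lam x₁ N batch ξ X) (hp : Problem D f P F ρ σ L₀ Lρ)
    (hx₁ : x₁ ∈ D) (hS : S₁ ≠ 0) : Integrable (fun ω => errSq D f (X ω 0)) μ := by
  have hmeas : Measurable fun s : ℕ → State d => errSq D f (s 0) :=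
    hp.measurable_errSq.comp (measurable_pi_apply 0)
  refine .of_bound (hmeas.comp_aemeasurable hX.aemeasurable).aestronglyMeasurable (σ ^ 2) ?_
  filter_upwards [hX.ae_norm_zero_m_sub_le hp hx₁ hS] with ω hω
  rw [Real.norm_of_nonneg (errSq_nonneg _)]
  exact pow_le_pow_left₀ (norm_nonneg _) hω 2

theorem integral_errSq_zero_le [IsProbabilityMeasure μ] [IsProbabilityMeasure P]
    (hX : IsRun μ P D F η β βsq lam x₁ N batch ξ X) (hp : Problem D f P F ρ σ L₀ Lρ)
    (hx₁ : x₁ ∈ D) (hS : S₁ ≠ 0) : ∫ ω, errSq D f (X ω 0) ∂μ ≤ σ ^ 2 / S₁ := by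
  have hnoise := (hp.measurable_sgrad x₁ hx₁).sub_const (gradient f x₁)
  have hS' : (S₁ : ℝ) ≠ 0 := Nat.cast_ne_zero.2 hS
  have hsum : ∫ ω, ‖∑ j, (sgrad F x₁ (batch j ω) - gradient f x₁)‖ ^ 2 ∂μ
      ≤ (Finset.univ : Finset (Fin S₁)).card * σ ^ 2 := by
    refine integral_norm_sum_sq_le (fun j _ => ?_) (fun j _ => ?_) (fun j _ => ?_) ?_
    · exact (hnoise.comp_aemeasurable (hX.hasLaw_batch j).aemeasurable).aestronglyMeasurable
    · exact (hX.ae_norm_batch_sub_le hp hx₁).mono fun _ h => h j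
    · have hcentred : ∫ z, (sgrad F x₁ z - gradient f x₁) ∂P = 0 := by
        rw [integral_sub (hp.integrable_sgrad hx₁) (integrable_const _), hp.integral_sgrad x₁ hx₁,
          integral_const, probReal_univ, one_smul, sub_self]
      rw [← hcentred]
      exact (hX.hasLaw_batch j).integral_comp (f := fun z => sgrad F x₁ z - gradient f x₁)
        hnoise.aestronglyMeasurable
    · exact fun i _ j _ hij => (hX.indepFun_batch hij).comp hnoise hnoise
  simp only [errSq, hX.zero_m_sub hx₁ hS, norm_smul, mul_pow, norm_inv, Real.norm_natCast]
  rw [integral_const_mul]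
  calc _ ≤ ((S₁ : ℝ)⁻¹) ^ 2 * (S₁ * σ ^ 2) := by
        gcongr
        simpa using hsum
    _ = σ ^ 2 / S₁ := by field_simp

theorem aemeasurable_active_mul (hX : IsRun μ P D F η β βsq lam x₁ N batch ξ X)
    (hp : Problem D f P F ρ σ L₀ Lρ) (hr : StepRegime ρ σ L₀ Lρ lam G η β) {q : State d → ℝ}
    (hq : Measurable q) (n k : ℕ) :
    AEMeasurable (fun ω => active D f G η lam (X ω) n * q (X ω k)) μ :=
  (hp.measurable_active_mul hr hq n k).comp_aemeasurable hX.aemeasurable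

theorem integrable_active_succ_mul [IsFiniteMeasure μ]
    (hX : IsRun μ P D F η β βsq lam x₁ N batch ξ X) (hp : Problem D f P F ρ σ L₀ Lρ)
    (hr : StepRegime ρ σ L₀ Lρ lam G η β) {q : State d → ℝ} (hq : Measurable q)
    (hq0 : ∀ s, 0 ≤ q s) {b : ℝ} (hb : 0 ≤ b) (hqb : ∀ s, Good D f G η lam s → q s ≤ b) (k : ℕ) :
    Integrable (fun ω => active D f G η lam (X ω) (k + 1) * q (X ω k)) μ :=
  .of_bound (hX.aemeasurable_active_mul hp hr hq (k + 1) k).aestronglyMeasurable b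
    (ae_of_all _ fun ω => by
      rw [Real.norm_of_nonneg (mul_nonneg active_nonneg (hq0 _))]
      exact active_succ_mul_le hb hqb)

theorem integrable_active_succ_mul_errSq [IsFiniteMeasure μ]
    (hX : IsRun μ P D F η β βsq lam x₁ N batch ξ X) (hp : Problem D f P F ρ σ L₀ Lρ)
    (hr : StepRegime ρ σ L₀ Lρ lam G η β) (k : ℕ) :
    Integrable (fun ω => active D f G η lam (X ω) (k + 1) * errSq D f (X ω k)) μ :=
  hX.integrable_active_succ_mul hp hr hp.measurable_errSq errSq_nonneg (sq_nonneg G)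
    (fun _ hs => hs.errSq_le) k

theorem integrable_active_succ_mul_gradSq [IsFiniteMeasure μ]
    (hX : IsRun μ P D F η β βsq lam x₁ N batch ξ X) (hp : Problem D f P F ρ σ L₀ Lρ)
    (hr : StepRegime ρ σ L₀ Lρ lam G η β) (k : ℕ) :
    Integrable (fun ω => active D f G η lam (X ω) (k + 1) * gradSq D f (X ω k)) μ :=
  hX.integrable_active_succ_mul hp hr hp.measurable_gradSq gradSq_nonneg (sq_nonneg G)
    (fun _ hs => hs.gradSq_le) k

theorem integrable_gradTotal [IsFiniteMeasure μ]
    (hX : IsRun μ P D F η β βsq lam x₁ N batch ξ X)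
    (hp : Problem D f P F ρ σ L₀ Lρ) (hr : StepRegime ρ σ L₀ Lρ lam G η β) (n : ℕ) :
    Integrable (fun ω => gradTotal D f G η lam n (X ω)) μ :=
  integrable_finsetSum _ fun k _ => hX.integrable_active_succ_mul_gradSq hp hr k

theorem integrable_errTotal [IsFiniteMeasure μ]
    (hX : IsRun μ P D F η β βsq lam x₁ N batch ξ X)
    (hp : Problem D f P F ρ σ L₀ Lρ) (hr : StepRegime ρ σ L₀ Lρ lam G η β) (n : ℕ) :
    Integrable (fun ω => errTotal D f G η lam n (X ω)) μ :=
  integrable_finsetSum _ fun k _ => hX.integrable_active_succ_mul_errSq hp hr k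

theorem mul_integral_gradTotal_le [IsProbabilityMeasure μ]
    (hX : IsRun μ P D F η β βsq lam x₁ N batch ξ X)
    (hp : Problem D f P F ρ σ L₀ Lρ) (hr : StepRegime ρ σ L₀ Lρ lam G η β) (hx₁ : x₁ ∈ D) (n : ℕ) :
    η / (8 * G) * ∫ ω, gradTotal D f G η lam n (X ω) ∂μ
      ≤ initGap D f x₁ + 3 * η / (4 * lam) * ∫ ω, errTotal D f G η lam n (X ω) ∂μ := by
  have hgrad := (hX.integrable_gradTotal hp hr n).const_mul (η / (8 * G))
  have herr := (hX.integrable_errTotal hp hr n).const_mul (3 * η / (4 * lam))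
  calc _ = ∫ ω, η / (8 * G) * gradTotal D f G η lam n (X ω) ∂μ := (integral_const_mul _ _).symm
    _ ≤ ∫ ω, (initGap D f x₁ + 3 * η / (4 * lam) * errTotal D f G η lam n (X ω)) ∂μ :=
      integral_mono hgrad ((integrable_const _).add herr) fun ω => by
        simpa only [hX.zero_x] using
          mul_gradTotal_le hp hr (hX.succ_x ω) ((hX.zero_x ω).symm ▸ hx₁) n
    _ = _ := by
      rw [integral_add (integrable_const _) herr, integral_const_mul, integral_const,
        probReal_univ, one_smul]

end IsRun

theorem Problem.integrable_active_mul_errSq_oracleStep [IsProbabilityMeasure P]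
    (hp : Problem D f P F ρ σ L₀ Lρ) (hr : StepRegime ρ σ L₀ Lρ lam G η β) (βsq : ℝ) (t k : ℕ)
    (s : ℕ → State d) : Integrable (fun z => active D f G η lam s (k + 1)
      * errSq D f (oracleStep (sgradExt D F) η β βsq lam t z (s k))) P := by
  by_cases h : ∀ j < k + 1, Good D f G η lam (s j)
  · exact ((h k k.lt_succ_self).integrable_errSq_oracleStep hp hr βsq t).const_mul _
  · simp only [active_of_not_forall h, zero_mul]
    exact integrable_zero _ _ _

theorem Problem.integral_active_mul_errSq_oracleStep_le [IsProbabilityMeasure P]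
    (hp : Problem D f P F ρ σ L₀ Lρ) (hr : StepRegime ρ σ L₀ Lρ lam G η β) (βsq : ℝ) (t k : ℕ)
    (s : ℕ → State d) : ∫ z, active D f G η lam s (k + 1)
        * errSq D f (oracleStep (sgradExt D F) η β βsq lam t z (s k)) ∂P
      ≤ (1 - β / 2) * (active D f G η lam s (k + 1) * errSq D f (s k))
        + β * lam / (100 * G) * (active D f G η lam s (k + 1) * gradSq D f (s k))
        + 2 * β ^ 2 * σ ^ 2 := by
  by_cases h : ∀ j < k + 1, Good D f G η lam (s j)
  · simp only [active_of_forall h, one_mul]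
    exact (h k k.lt_succ_self).integral_errSq_oracleStep_le hp hr βsq t
  · simp only [active_of_not_forall h, zero_mul, mul_zero, integral_zero, zero_add]
    positivity

namespace IsRun

variable [IsProbabilityMeasure μ] [IsProbabilityMeasure P]

theorem integral_active_mul_errSq_succ_le (hX : IsRun μ P D F η β βsq lam x₁ N batch ξ X)
    (hp : Problem D f P F ρ σ L₀ Lρ) (hr : StepRegime ρ σ L₀ Lρ lam G η β) (hk : k < N) :
    Integrable (fun ω => active D f G η lam (X ω) (k + 1) * errSq D f (X ω (k + 1))) μ ∧
    ∫ ω, active D f G η lam (X ω) (k + 1) * errSq D f (X ω (k + 1)) ∂μ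
      ≤ (1 - β / 2) * ∫ ω, active D f G η lam (X ω) (k + 1) * errSq D f (X ω k) ∂μ
        + β * lam / (100 * G) * ∫ ω, active D f G η lam (X ω) (k + 1) * gradSq D f (X ω k) ∂μ
        + 2 * β ^ 2 * σ ^ 2 := by
  have herr := (hX.integrable_active_succ_mul_errSq hp hr k).const_mul (1 - β / 2)
  have hgrad := (hX.integrable_active_succ_mul_gradSq hp hr k).const_mul (β * lam / (100 * G))
  have hsum : Integrable (fun ω =>
      (1 - β / 2) * (active D f G η lam (X ω) (k + 1) * errSq D f (X ω k))
        + β * lam / (100 * G) * (active D f G η lam (X ω) (k + 1) * gradSq D f (X ω k))) μ :=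
    herr.add hgrad
  have hpast : AEMeasurable (fun ω j => X ω (min j k)) μ :=
    (measurable_pi_lambda _ fun j => measurable_pi_apply (min j k)).comp_aemeasurable
      hX.aemeasurable
  have hψ : Measurable (Function.uncurry fun (s : ℕ → State d) z => active D f G η lam s (k + 1)
      * errSq D f (oracleStep (sgradExt D F) η β βsq lam (k + 2) z (s k))) :=
    ((hp.measurable_active hr (k + 1)).comp measurable_fst).mul
      (hp.measurable_errSq.comp ((measurable_oracleStep hp.measurable_sgradExt (k + 2)).comp
        (measurable_snd.prodMk ((measurable_pi_apply k).comp measurable_fst))))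
  have hstep := integral_le_integral_of_indepFun hpast (hX.hasLaw_sample k hk)
    (hX.indepFun_past k hk) hψ (fun _ _ => mul_nonneg active_nonneg (errSq_nonneg _))
    (φ := fun s => (1 - β / 2) * (active D f G η lam s (k + 1) * errSq D f (s k))
      + β * lam / (100 * G) * (active D f G η lam s (k + 1) * gradSq D f (s k))
      + 2 * β ^ 2 * σ ^ 2)
    (by
      simp only [active_stopped, min_self]
      exact hsum.add (integrable_const _))
    (hp.integrable_active_mul_errSq_oracleStep hr βsq (k + 2) k)
    (hp.integral_active_mul_errSq_oracleStep_le hr βsq (k + 2) k)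
  simp only [active_stopped, min_self, ← hX.succ] at hstep
  rwa [integral_add hsum (integrable_const _), integral_add herr hgrad,
    integral_const_mul, integral_const_mul, integral_const, probReal_univ, one_smul] at hstep

theorem integrable_active_mul_errSq (hX : IsRun μ P D F η β βsq lam x₁ N batch ξ X)
    (hp : Problem D f P F ρ σ L₀ Lρ) (hr : StepRegime ρ σ L₀ Lρ lam G η β) (hx₁ : x₁ ∈ D)
    (hS : S₁ ≠ 0) (hk : k ≤ N) :
    Integrable (fun ω => active D f G η lam (X ω) k * errSq D f (X ω k)) μ := by
  cases k with
  | zero => simpa only [active_zero, one_mul] using hX.integrable_errSq_zero hp hx₁ hS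
  | succ k => exact (hX.integral_active_mul_errSq_succ_le hp hr hk).1

theorem integrable_exitErr (hX : IsRun μ P D F η β βsq lam x₁ N batch ξ X)
    (hp : Problem D f P F ρ σ L₀ Lρ) (hr : StepRegime ρ σ L₀ Lρ lam G η β) (hx₁ : x₁ ∈ D)
    (hS : S₁ ≠ 0) : Integrable (fun ω => exitErr D f G η lam (N + 1) (X ω)) μ :=
  integrable_finsetSum _ fun k hk =>
    (hX.integrable_active_mul_errSq hp hr hx₁ hS (Nat.lt_succ_iff.1 (Finset.mem_range.1 hk))).sub
      (hX.integrable_active_succ_mul_errSq hp hr k)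

end IsRun

theorem sum_variance_recursion {a b c : ℕ → ℝ} {β κ w : ℝ} {N : ℕ} (hβ : β ≤ 1)
    (hκ : 0 ≤ κ) (hb : ∀ k, 0 ≤ b k) (hc : ∀ k, 0 ≤ c k)
    (h : ∀ k < N, a (k + 1) ≤ (1 - β / 2) * b k + κ * c k + w) :
    ∑ k ∈ Finset.range (N + 1), (a k - b k) + β / 2 * ∑ k ∈ Finset.range (N + 1), b k
      ≤ a 0 + N * w + κ * ∑ k ∈ Finset.range (N + 1), c k := by
  have hpartial : ∀ n ≤ N, ∑ k ∈ Finset.range (n + 1), (a k - b k) + b n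
      + β / 2 * ∑ k ∈ Finset.range n, b k ≤ a 0 + n * w + κ * ∑ k ∈ Finset.range n, c k := by
    intro n
    induction n with
    | zero => simp
    | succ n ih =>
      intro hn
      rw [Finset.sum_range_succ _ (n + 1), Finset.sum_range_succ b, Finset.sum_range_succ c]
      push_cast
      linarith [ih (by lia), h n (by lia)]
  have hlast : β / 2 * b N ≤ 1 * b N := mul_le_mul_of_nonneg_right (by linarith) (hb N)
  rw [Finset.sum_range_succ b, Finset.sum_range_succ c]
  linarith [hpartial N le_rfl, mul_nonneg hκ (hc N)]

namespace IsRun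

variable [IsProbabilityMeasure μ] [IsProbabilityMeasure P]

theorem integral_exitErr_add_le (hX : IsRun μ P D F η β βsq lam x₁ N batch ξ X)
    (hp : Problem D f P F ρ σ L₀ Lρ) (hr : StepRegime ρ σ L₀ Lρ lam G η β) (hx₁ : x₁ ∈ D)
    (hS : S₁ ≠ 0) : ∫ ω, exitErr D f G η lam (N + 1) (X ω) ∂μ
        + β / 2 * ∫ ω, errTotal D f G η lam (N + 1) (X ω) ∂μ
      ≤ σ ^ 2 / S₁ + N * (2 * β ^ 2 * σ ^ 2)
        + β * lam / (100 * G) * ∫ ω, gradTotal D f G η lam (N + 1) (X ω) ∂μ := by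
  have hG := hr.G_pos
  have hlam := hr.lam_pos
  have hβ := hr.beta_nonneg
  have herr := hX.integrable_active_succ_mul_errSq hp hr
  have hexit : ∀ k ∈ Finset.range (N + 1),
      Integrable (fun ω => active D f G η lam (X ω) k * errSq D f (X ω k)) μ := fun k hk =>
    hX.integrable_active_mul_errSq hp hr hx₁ hS (Nat.lt_succ_iff.1 (Finset.mem_range.1 hk))
  have hdiff : ∀ k ∈ Finset.range (N + 1),
      Integrable (fun ω => active D f G η lam (X ω) k * errSq D f (X ω k)
        - active D f G η lam (X ω) (k + 1) * errSq D f (X ω k)) μ := fun k hk =>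
    (hexit k hk).sub (herr k)
  have hzero : ∫ ω, active D f G η lam (X ω) 0 * errSq D f (X ω 0) ∂μ ≤ σ ^ 2 / S₁ := by
    simpa only [active_zero, one_mul] using hX.integral_errSq_zero_le hp hx₁ hS
  have hsum := sum_variance_recursion
    (a := fun k => ∫ ω, active D f G η lam (X ω) k * errSq D f (X ω k) ∂μ)
    hr.beta_le (by positivity : 0 ≤ β * lam / (100 * G))
    (fun k => integral_nonneg fun ω => mul_nonneg active_nonneg (errSq_nonneg (X ω k)))
    (fun k => integral_nonneg fun ω => mul_nonneg active_nonneg (gradSq_nonneg (X ω k)))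
    (fun k hk => (hX.integral_active_mul_errSq_succ_le hp hr hk).2)
  simp only [exitErr, errTotal, gradTotal]
  rw [integral_finsetSum _ hdiff,
    integral_finsetSum _ fun k _ => herr k,
    integral_finsetSum _ fun k _ => hX.integrable_active_succ_mul_gradSq hp hr k,
    Finset.sum_congr rfl fun k hk => integral_sub (hexit k hk) (herr k)]
  linarith

end IsRun

end Expectation

/-- The conditions under which the whole run of `N + 1` steps is controlled: those on single steps,
and those relating the step size to the accuracy `ε`, the failure probability `δ` and the initial
gap `Δ`. -/
structure RunRegime (δ ε ρ σ L₀ Lρ lam G η β Δ : ℝ) (N S₁ : ℕ) : Prop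
    extends StepRegime ρ σ L₀ Lρ lam G η β where
  delta_pos : 0 < δ
  eps_pos : 0 < ε
  gap_nonneg : 0 ≤ Δ
  beta_pos : 0 < β
  batch_ne_zero : S₁ ≠ 0
  eta_sigma_le : (η * (σ * G * effL ρ L₀ Lρ G)) ^ 2 ≤ (1 / 10 ^ 6) ^ 2 * (lam ^ 4 * δ * ε ^ 2)
  eta_gap_le : η * (Δ * effL ρ L₀ Lρ G ^ 2) ≤ 1 / 10 ^ 6 * (lam ^ 2 * G * δ)
  gap_le : 10 ^ 5 * (effL ρ L₀ Lρ G * Δ) ≤ 7 * (G * δ * lam)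
  le_T : 10 ^ 5 * (G * Δ / η) ≤ ((N : ℝ) + 1) * δ * ε ^ 2
  T_le : N ≠ 0 → ((N : ℝ) + 1) * δ * ε ^ 2 ≤ 2 * 10 ^ 5 * (G * Δ / η)
  batch_le : 1 / (S₁ : ℝ) ≤ 2 * β ^ 2 * (N + 1)

/-- The inequalities satisfied by the expectations `Y`, `B` and `S` of `exitErr`, `errTotal` and
`gradTotal`: the summed variance recursion and the summed descent inequality. -/
structure MeanBounds (σ lam G η β Δ : ℝ) (N : ℕ) (Y B S : ℝ) : Prop where
  exit_nonneg : 0 ≤ Y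
  err_nonneg : 0 ≤ B
  variance : Y + β / 2 * B
    ≤ 4 * (((N : ℝ) + 1) * β ^ 2 * σ ^ 2) + β * lam / (100 * G) * S
  descent : η / (8 * G) * S ≤ Δ + 3 * η / (4 * lam) * B

section Numerics

variable {δ ε ρ σ L₀ Lρ lam G η β Δ : ℝ} {N S₁ : ℕ} {Y B S : ℝ}

theorem RunRegime.mul_noise_div_le (hr : RunRegime δ ε ρ σ L₀ Lρ lam G η β Δ N S₁) :
    G * (((N : ℝ) + 1) * β * σ ^ 2) / lam ≤ 1600 / 10 ^ 12 * (((N : ℝ) + 1) * δ * ε ^ 2) := by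
  have hlam := hr.lam_pos
  refine le_of_mul_le_mul_right ?_ (by positivity : 0 < lam ^ 4)
  calc G * ((N + 1) * β * σ ^ 2) / lam * lam ^ 4 = (N + 1) * σ ^ 2 * G * (β * lam ^ 3) := by
        field_simp
    _ = 1600 * (N + 1) * (η * (σ * G * effL ρ L₀ Lρ G)) ^ 2 := by
        rw [hr.beta_eq]
        ring
    _ ≤ 1600 * (N + 1) * ((1 / 10 ^ 6) ^ 2 * (lam ^ 4 * δ * ε ^ 2)) := by
        gcongr
        exact hr.eta_sigma_le
    _ = 1600 / 10 ^ 12 * ((N + 1) * δ * ε ^ 2) * lam ^ 4 := by ring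

theorem RunRegime.mul_noise_div_le_gap (hr : RunRegime δ ε ρ σ L₀ Lρ lam G η β Δ N S₁)
    (hN : N ≠ 0) : G * (((N : ℝ) + 1) * β * σ ^ 2) / lam ≤ 4 / 10 ^ 4 * (G * Δ / η) := by
  have hG := hr.G_pos
  have hη := hr.eta_pos
  have hΔ := hr.gap_nonneg
  have hK : 0 ≤ G * Δ / η := by positivity
  linarith [hr.mul_noise_div_le, hr.T_le hN]

theorem RunRegime.beta_mul_gap_le (hr : RunRegime δ ε ρ σ L₀ Lρ lam G η β Δ N S₁) :
    β * (lam / G * (G * Δ / η)) ≤ 1600 / 10 ^ 6 * (δ * G ^ 2) := by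
  have hG := hr.G_pos
  have hη := hr.eta_pos
  have hlam := hr.lam_pos
  refine le_of_mul_le_mul_right ?_ (by positivity : 0 < lam ^ 2)
  calc β * (lam / G * (G * Δ / η)) * lam ^ 2 = β * lam ^ 3 * (Δ / η) := by field_simp
    _ = 1600 * G * (η * (Δ * effL ρ L₀ Lρ G ^ 2)) := by
        rw [hr.beta_eq]
        field_simp
    _ ≤ 1600 * G * (1 / 10 ^ 6 * (lam ^ 2 * G * δ)) :=
        mul_le_mul_of_nonneg_left hr.eta_gap_le (by positivity)
    _ = 1600 / 10 ^ 6 * (δ * G ^ 2) * lam ^ 2 := by ring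

namespace MeanBounds

theorem err_le (h : MeanBounds σ lam G η β Δ N Y B S) (hβ : 0 < β) (hG : 0 < G) :
    B ≤ 8 * (((N : ℝ) + 1) * β * σ ^ 2) + lam / (50 * G) * S := by
  refine le_of_mul_le_mul_left ?_ (by positivity : 0 < β / 2)
  calc β / 2 * B ≤ 4 * ((N + 1) * β ^ 2 * σ ^ 2) + β * lam / (100 * G) * S := by
        linarith [h.variance, h.exit_nonneg]
    _ = _ := by
        field_simp
        ring

theorem grad_le (h : MeanBounds σ lam G η β Δ N Y B S) (hβ : 0 < β) (hG : 0 < G) (hη : 0 < η)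
    (hlam : 0 < lam) (hΔ : 0 ≤ Δ) :
    S ≤ 10 * (G * Δ / η) + 60 * (G * (((N : ℝ) + 1) * β * σ ^ 2) / lam) := by
  have hdescent : S ≤ 8 * (G * Δ / η) + 6 * (G * B / lam) := by
    refine le_of_mul_le_mul_left ?_ (by positivity : 0 < η / (8 * G))
    calc η / (8 * G) * S ≤ Δ + 3 * η / (4 * lam) * B := h.descent
      _ = _ := by
        field_simp
        ring
  have herr : G * B / lam ≤ 8 * (G * ((N + 1) * β * σ ^ 2) / lam) + 1 / 50 * S := by
    calc G * B / lam ≤ G * (8 * ((N + 1) * β * σ ^ 2) + lam / (50 * G) * S) / lam := by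
          gcongr
          exact h.err_le hβ hG
      _ = _ := by field_simp
  have hE : 0 ≤ G * ((N + 1) * β * σ ^ 2) / lam := by positivity
  have hK : 0 ≤ G * Δ / η := by positivity
  linarith

theorem grad_le_accuracy (h : MeanBounds σ lam G η β Δ N Y B S)
    (hr : RunRegime δ ε ρ σ L₀ Lρ lam G η β Δ N S₁) : S ≤ δ / 8 * (ε ^ 2 * (N + 1)) := by
  have hδ := hr.delta_pos
  have hT : 0 ≤ ((N : ℝ) + 1) * δ * ε ^ 2 := by positivity
  linarith [h.grad_le hr.beta_pos hr.G_pos hr.eta_pos hr.lam_pos hr.gap_nonneg,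
    hr.mul_noise_div_le, hr.le_T]

theorem grad_le_gap (h : MeanBounds σ lam G η β Δ N Y B S)
    (hr : RunRegime δ ε ρ σ L₀ Lρ lam G η β Δ N S₁) (hN : N ≠ 0) : S ≤ 11 * (G * Δ / η) := by
  have hG := hr.G_pos
  have hη := hr.eta_pos
  have hΔ := hr.gap_nonneg
  have hK : 0 ≤ G * Δ / η := by positivity
  linarith [h.grad_le hr.beta_pos hG hη hr.lam_pos hΔ, hr.mul_noise_div_le_gap hN]

theorem noise_add_grad_le (h : MeanBounds σ lam G η β Δ N Y B S)
    (hr : RunRegime δ ε ρ σ L₀ Lρ lam G η β Δ N S₁) (hN : N ≠ 0) :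
    4 * (((N : ℝ) + 1) * β * σ ^ 2) + lam / (100 * G) * S ≤ 1 / 5 * (lam / G * (G * Δ / η)) := by
  have hG := hr.G_pos
  have hlam := hr.lam_pos
  have hη := hr.eta_pos
  have hΔ := hr.gap_nonneg
  have hK : 0 ≤ G * Δ / η := by positivity
  calc _ = lam / G * (4 * (G * ((N + 1) * β * σ ^ 2) / lam) + 1 / 100 * S) := by field_simp
    _ ≤ lam / G * (1 / 5 * (G * Δ / η)) := by
      gcongr
      linarith [h.grad_le_gap hr hN, hr.mul_noise_div_le_gap hN]
    _ = _ := by ring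

theorem exit_le (h : MeanBounds σ lam G η β Δ N Y B S)
    (hr : RunRegime δ ε ρ σ L₀ Lρ lam G η β Δ N S₁) (hN : N ≠ 0) : Y ≤ δ / 8 * G ^ 2 := by
  have hβ := hr.beta_pos
  have hδ := hr.delta_pos
  have hδG : 0 ≤ δ * G ^ 2 := by positivity
  calc Y ≤ 4 * ((N + 1) * β ^ 2 * σ ^ 2) + β * lam / (100 * G) * S := by
        linarith [h.variance, mul_nonneg (half_pos hβ).le h.err_nonneg]
    _ = β * (4 * ((N + 1) * β * σ ^ 2) + lam / (100 * G) * S) := by ring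
    _ ≤ β * (1 / 5 * (lam / G * (G * Δ / η))) := by
        gcongr
        exact h.noise_add_grad_le hr hN
    _ ≤ δ / 8 * G ^ 2 := by linarith [hr.beta_mul_gap_le]

theorem grad_add_err_le (h : MeanBounds σ lam G η β Δ N Y B S)
    (hr : RunRegime δ ε ρ σ L₀ Lρ lam G η β Δ N S₁) (hN : N ≠ 0) :
    S + B ≤ 12 * (G * Δ / η) := by
  have hG := hr.G_pos
  have hη := hr.eta_pos
  have hΔ := hr.gap_nonneg
  have hK : 0 ≤ G * Δ / η := by positivity
  have hlam : lam / G ≤ 1 / 2 := by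
    rw [div_le_iff₀ hG]
    linarith [hr.lam_le]
  have hbalance : lam / G * (G * Δ / η) ≤ 1 / 2 * (G * Δ / η) := by gcongr
  have hB : B ≤ 2 * (4 * ((N + 1) * β * σ ^ 2) + lam / (100 * G) * S) :=
    (h.err_le hr.beta_pos hG).trans_eq (by ring)
  linarith [h.noise_add_grad_le hr hN, h.grad_le_gap hr hN]

theorem effL_mul_grad_add_err_le (h : MeanBounds σ lam G η β Δ N Y B S)
    (hr : RunRegime δ ε ρ σ L₀ Lρ lam G η β Δ N S₁) (hN : N ≠ 0) (hL : 0 ≤ effL ρ L₀ Lρ G) :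
    12 * (effL ρ L₀ Lρ G * η) * (S + B) ≤ δ / 8 * (lam * G ^ 2) := by
  have hG := hr.G_pos
  have hη := hr.eta_pos
  have hδ := hr.delta_pos
  have hlam := hr.lam_pos
  calc 12 * (effL ρ L₀ Lρ G * η) * (S + B)
      ≤ 12 * (effL ρ L₀ Lρ G * η) * (12 * (G * Δ / η)) := by
        gcongr
        exact h.grad_add_err_le hr hN
    _ = 144 / 10 ^ 5 * G * (10 ^ 5 * (effL ρ L₀ Lρ G * Δ)) := by
        field_simp
        ring
    _ ≤ 144 / 10 ^ 5 * G * (7 * (G * δ * lam)) :=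
        mul_le_mul_of_nonneg_left hr.gap_le (by positivity)
    _ = 1008 / 10 ^ 5 * (δ * (lam * G ^ 2)) := by ring
    _ ≤ 1 / 8 * (δ * (lam * G ^ 2)) :=
        mul_le_mul_of_nonneg_right (by norm_num) (by positivity)
    _ = δ / 8 * (lam * G ^ 2) := by ring

end MeanBounds

end Numerics

/-- The runs on which the conclusion may fail: one of the three stopped totals is too large. The
last two totals matter from the second state on only, hence the condition `N ≠ 0`. -/
def exceptional {d : ℕ} (D : Set (Vec d)) (f : Vec d → ℝ) (ε L lam G η : ℝ) (N : ℕ) :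
    Set (ℕ → State d) :=
  {s | ε ^ 2 * (N + 1) ≤ gradTotal D f G η lam (N + 1) s} ∪
    ({s | N ≠ 0 ∧ G ^ 2 ≤ exitErr D f G η lam (N + 1) s} ∪
      {s | N ≠ 0 ∧ lam * G ^ 2 ≤ 12 * (L * η)
        * (gradTotal D f G η lam (N + 1) s + errTotal D f G η lam (N + 1) s)})

section Convergence

variable {d : ℕ} {D : Set (Vec d)} {f : Vec d → ℝ} {δ ε ρ σ L₀ Lρ lam G η β βsq : ℝ}
  {Ω Ξ : Type*} [MeasurableSpace Ω] [MeasurableSpace Ξ] {μ : Measure Ω} {P : Measure Ξ}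
  {F : Vec d → Ξ → ℝ} {x₁ : Vec d} {N S₁ k : ℕ} {batch : Fin S₁ → Ω → Ξ} {ξ : ℕ → Ω → Ξ}
  {X : Ω → ℕ → State d}

theorem gradTotal_eq_sum {s : ℕ → State d} {n : ℕ} (hgood : ∀ j < n, Good D f G η lam (s j)) :
    gradTotal D f G η lam n s = ∑ k ∈ Finset.range n, ‖gradient f (s k).x‖ ^ 2 := by
  refine Finset.sum_congr rfl fun k hk => ?_
  have hk := Finset.mem_range.1 hk
  rw [active_of_forall fun j hj => hgood j (by lia), one_mul, gradSq,
    gradExt_of_mem (hgood k hk).mem]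

theorem Problem.measurableSet_norm_sgradExt_sub_le (hp : Problem D f P F ρ σ L₀ Lρ) :
    MeasurableSet {q : State d × Ξ | q.1.next ∈ D →
      ‖sgradExt D F q.1.next q.2 - gradExt D f q.1.next‖ ≤ σ} := by
  have hnext : Measurable fun q : State d × Ξ => q.1.next :=
    measurable_state_next.comp measurable_fst
  have hsgrad := hp.measurable_sgradExt.comp (hnext.prodMk measurable_snd)
  exact (hnext hp.isOpen.measurableSet).imp
    (measurableSet_le (hsgrad.sub (hp.measurable_gradExt.comp hnext)).norm measurable_const)

namespace IsRun

theorem ae_norm_sgradExt_sub_le [IsFiniteMeasure μ]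
    (hX : IsRun μ P D F η β βsq lam x₁ N batch ξ X) (hp : Problem D f P F ρ σ L₀ Lρ) (hk : k < N) :
    ∀ᵐ ω ∂μ, (X ω k).next ∈ D →
      ‖sgradExt D F (X ω k).next (ξ (k + 2) ω) - gradExt D f (X ω k).next‖ ≤ σ := by
  have hindep := (hX.indepFun_past k hk).comp (measurable_pi_apply k) measurable_id
  simp only [Function.comp_def, min_self, id] at hindep
  refine ae_of_forall_ae_of_indepFun
    (p := fun s z => s.next ∈ D → ‖sgradExt D F s.next z - gradExt D f s.next‖ ≤ σ)
    ((measurable_pi_apply k).comp_aemeasurable hX.aemeasurable) (hX.hasLaw_sample k hk) hindep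
    hp.measurableSet_norm_sgradExt_sub_le fun s => ?_
  by_cases hs : s.next ∈ D
  · filter_upwards [hp.noise _ hs] with z hz _
    rwa [sgradExt_of_mem hs, gradExt_of_mem hs]
  · exact ae_of_all _ fun z h => absurd h hs

theorem exists_step_size (hX : IsRun μ P D F η β βsq lam x₁ N batch ξ X)
    (hr : StepRegime ρ σ L₀ Lρ lam G η β) (hβ0 : 0 ≤ βsq) (hβ1 : βsq ≤ 1) {ω : Ω}
    (herr0 : ‖(X ω 0).m - gradExt D f (X ω 0).x‖ ≤ σ)
    (hnoise : ∀ j < k, ‖sgradExt D F (X ω j).next (ξ (j + 2) ω) - gradExt D f (X ω j).next‖ ≤ σ)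
    (hgrad : ∀ j ≤ k, ‖gradExt D f (X ω j).x‖ ≤ G) (i : Fin d) :
    ∃ a ∈ Set.Icc (η / (2 * G)) (η / lam), (X ω k).x i - (X ω k).next i = a * (X ω k).m i := by
  have hη := hr.eta_pos
  have hlam := hr.lam_pos
  have hG := hr.G_pos
  have h0 : ‖(X ω 0).m‖ ≤ 3 / 2 * G := by
    linarith [norm_le_norm_add_norm_sub' (X ω 0).m (gradExt D f (X ω 0).x), hgrad 0 k.zero_le,
      hr.sigma_le]
  have hsgrad : ∀ j < k, ‖sgradExt D F (X ω j).next (ξ (j + 2) ω)‖ ≤ 3 / 2 * G := fun j hj => by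
    have hnext := hgrad (j + 1) hj
    rw [hX.succ_x] at hnext
    linarith [norm_le_norm_add_norm_sub' (sgradExt D F (X ω j).next (ξ (j + 2) ω))
      (gradExt D f (X ω j).next), hnoise j hj, hr.sigma_le]
  rw [hX.eq_oracleState] at h0 ⊢
  simp only [hX.eq_oracleState ω] at hsgrad
  obtain ⟨a, ha, heq⟩ := oracleState_exists_step_size hβ0 hβ1 hη.le hlam k h0 hsgrad i
  refine ⟨a, ⟨le_trans ?_ ha.1, ha.2⟩, heq⟩
  gcongr
  linarith [hr.lam_le]

theorem ae_forall_good [IsFiniteMeasure μ] (hX : IsRun μ P D F η β βsq lam x₁ N batch ξ X)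
    (hp : Problem D f P F ρ σ L₀ Lρ) (hr : StepRegime ρ σ L₀ Lρ lam G η β) (hx₁ : x₁ ∈ D)
    (hS : S₁ ≠ 0) (hg₁ : 2 * ‖gradient f x₁‖ ≤ G) (hβ0 : 0 ≤ βsq) (hβ1 : βsq ≤ 1)
    (hseg : ∀ᵐ ω ∂μ, ∀ k ≤ N, segment ℝ (X ω k).x (X ω k).next ⊆ D) :
    ∀ᵐ ω ∂μ, X ω ∉ exceptional D f ε (effL ρ L₀ Lρ G) lam G η N →
      ∀ k ≤ N, Good D f G η lam (X ω k) := by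
  have hnoise := (Set.finite_Iio N).eventually_all.2 fun k hk => hX.ae_norm_sgradExt_sub_le hp hk
  filter_upwards [hX.ae_norm_zero_m_sub_le hp hx₁ hS, hnoise, hseg] with ω herr0 hnoise hseg hω
  simp only [exceptional, Set.mem_union, Set.mem_ofPred_eq, not_or, not_and, not_le] at hω
  refine forall_good hp hr (hX.succ_x ω) ?_ ?_ hseg (fun k hk hgrad => ?_)
    (fun hN => (hω.2.1 hN).le) fun hN => (hω.2.2 hN).le
  · rwa [hX.zero_x, gradExt_of_mem hx₁]
  · linarith [hr.sigma_le, hr.G_pos]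
  · exact hX.exists_step_size hr hβ0 hβ1 herr0
      (fun j hj => hnoise j (hj.trans_le hk) (hseg j (by lia) (right_mem_segment ℝ _ _))) hgrad

variable [IsProbabilityMeasure μ]

theorem meanBounds [IsProbabilityMeasure P] (hX : IsRun μ P D F η β βsq lam x₁ N batch ξ X)
    (hp : Problem D f P F ρ σ L₀ Lρ)
    (hr : RunRegime δ ε ρ σ L₀ Lρ lam G η β (initGap D f x₁) N S₁) (hx₁ : x₁ ∈ D) :
    MeanBounds σ lam G η β (initGap D f x₁) N (∫ ω, exitErr D f G η lam (N + 1) (X ω) ∂μ)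
      (∫ ω, errTotal D f G η lam (N + 1) (X ω) ∂μ)
      (∫ ω, gradTotal D f G η lam (N + 1) (X ω) ∂μ) where
  exit_nonneg := integral_nonneg fun _ => exitErr_nonneg
  err_nonneg := integral_nonneg fun _ => errTotal_nonneg
  variance := by
    have hbatch : σ ^ 2 / S₁ ≤ 2 * β ^ 2 * (N + 1) * σ ^ 2 := by
      rw [← one_div_mul_eq_div]
      exact mul_le_mul_of_nonneg_right hr.batch_le (sq_nonneg σ)
    have hnoise : 0 ≤ β ^ 2 * σ ^ 2 := by positivity
    linarith [hX.integral_exitErr_add_le hp hr.toStepRegime hx₁ hr.batch_ne_zero]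
  descent := hX.mul_integral_gradTotal_le hp hr.toStepRegime hx₁ (N + 1)

theorem measureReal_exceptional_le [IsProbabilityMeasure P]
    (hX : IsRun μ P D F η β βsq lam x₁ N batch ξ X) (hp : Problem D f P F ρ σ L₀ Lρ)
    (hr : RunRegime δ ε ρ σ L₀ Lρ lam G η β (initGap D f x₁) N S₁) (hx₁ : x₁ ∈ D) :
    μ.real {ω | X ω ∈ exceptional D f ε (effL ρ L₀ Lρ G) lam G η N} ≤ δ := by
  have hδ := hr.delta_pos
  have hε := hr.eps_pos
  have hlam := hr.lam_pos
  have hη := hr.eta_pos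
  have hG := hr.G_pos
  have hL := effL_nonneg (ρ := ρ) hp.L₀_nonneg hp.Lρ_nonneg hG.le
  have hmean := hX.meanBounds hp hr hx₁
  have hgrad := hX.integrable_gradTotal hp hr.toStepRegime (N + 1)
  have herr := hX.integrable_errTotal hp hr.toStepRegime (N + 1)
  have hexit := hX.integrable_exitErr hp hr.toStepRegime hx₁ hr.batch_ne_zero
  have haccuracy : μ.real {ω | ε ^ 2 * (N + 1) ≤ gradTotal D f G η lam (N + 1) (X ω)} ≤ δ / 8 :=
    measureReal_ge_le_of_integral_le_mul (fun _ => gradTotal_nonneg) hgrad (by positivity)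
      (hmean.grad_le_accuracy hr)
  have hexit_le : μ.real {ω | N ≠ 0 ∧ G ^ 2 ≤ exitErr D f G η lam (N + 1) (X ω)} ≤ δ / 8 :=
    measureReal_and_ge_le_of_integral_le_mul (fun _ => exitErr_nonneg) hexit (by positivity)
      (by positivity) fun hN => hmean.exit_le hr hN
  have htotal_le : μ.real {ω | N ≠ 0 ∧ lam * G ^ 2 ≤ 12 * (effL ρ L₀ Lρ G * η)
      * (gradTotal D f G η lam (N + 1) (X ω) + errTotal D f G η lam (N + 1) (X ω))} ≤ δ / 8 := by
    refine measureReal_and_ge_le_of_integral_le_mul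
      (fun _ => mul_nonneg (by positivity) (add_nonneg gradTotal_nonneg errTotal_nonneg))
      ((hgrad.add herr).const_mul _) (by positivity) (by positivity) fun hN => ?_
    rw [integral_const_mul, integral_add hgrad herr]
    exact hmean.effL_mul_grad_add_err_le hr hN hL
  calc _ ≤ δ / 8 + (δ / 8 + δ / 8) :=
        (measureReal_union_le _ _).trans (add_le_add haccuracy
          ((measureReal_union_le _ _).trans (add_le_add hexit_le htotal_le)))
    _ ≤ δ := by linarith

theorem one_sub_le_measureReal [IsProbabilityMeasure P]
    (hX : IsRun μ P D F η β βsq lam x₁ N batch ξ X) (hp : Problem D f P F ρ σ L₀ Lρ)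
    (hr : RunRegime δ ε ρ σ L₀ Lρ lam G η β (initGap D f x₁) N S₁) (hx₁ : x₁ ∈ D)
    (hg₁ : 2 * ‖gradient f x₁‖ ≤ G) (hβ0 : 0 ≤ βsq) (hβ1 : βsq ≤ 1)
    (hseg : ∀ᵐ ω ∂μ, ∀ k ≤ N, segment ℝ (X ω k).x (X ω k).next ⊆ D) :
    1 - δ ≤ μ.real {ω | (∀ k ≤ N, ‖gradient f (X ω k).x‖ ≤ G) ∧
      ∑ k ∈ Finset.range (N + 1), ‖gradient f (X ω k).x‖ ^ 2 ≤ ε ^ 2 * (N + 1)} := by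
  set success := {ω | (∀ k ≤ N, ‖gradient f (X ω k).x‖ ≤ G) ∧
    ∑ k ∈ Finset.range (N + 1), ‖gradient f (X ω k).x‖ ^ 2 ≤ ε ^ 2 * (N + 1)}
  set bad := {ω | X ω ∈ exceptional D f ε (effL ρ L₀ Lρ G) lam G η N}
  have hcover : ∀ᵐ ω ∂μ, ω ∈ success ∪ bad := by
    filter_upwards [hX.ae_forall_good (ε := ε) hp hr.toStepRegime hx₁ hr.batch_ne_zero hg₁ hβ0 hβ1
      hseg] with ω hω
    refine or_iff_not_imp_right.2 fun hbad => ?_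
    have hgood := hω hbad
    have htotal : gradTotal D f G η lam (N + 1) (X ω) < ε ^ 2 * (N + 1) :=
      not_le.1 fun h => hbad (.inl h)
    rw [gradTotal_eq_sum fun j hj => hgood j (Nat.lt_succ_iff.1 hj)] at htotal
    exact ⟨fun k hk => (hgood k hk).norm_gradient_le, htotal.le⟩
  have hprob : μ.real (success ∪ bad) = 1 := by
    rw [← probReal_univ (μ := μ)]
    exact measureReal_congr (Filter.eventuallyEq_univ.2 hcover)
  linarith [measureReal_union_le (μ := μ) success bad, hX.measureReal_exceptional_le hp hr hx₁]

end IsRun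

end Convergence

theorem indepFun_of_dependsOn_compl {Ω Ξ B ι : Type*} [MeasurableSpace Ω] [MeasurableSpace Ξ]
    [MeasurableSpace B] [Finite ι] {μ : Measure Ω} {Y : ι → Ω → Ξ} (hY : iIndepFun Y μ)
    (hm : ∀ i, AEMeasurable (Y i) μ) {i j : ι} (hji : j ≠ i) {φ : (ι → Ξ) → B}
    (hφ : Measurable φ) (hdep : DependsOn φ {i}ᶜ) : (fun ω => φ fun l => Y l ω) ⟂ᵢ[μ] Y i := by
  classical
  have := Fintype.ofFinite ι
  let S : Finset ι := {i}ᶜ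
  have hjS : j ∈ S := by simpa [S] using hji
  let fill : (S → Ξ) → ι → Ξ := fun w l => if h : l ∈ S then w ⟨l, h⟩ else w ⟨j, hjS⟩
  have hfill : Measurable fill := measurable_pi_iff.2 fun l => by
    by_cases h : l ∈ S <;> simp only [fill, h, dite_true, dite_false] <;>
      exact measurable_pi_apply _
  have hfill_eq : (fun ω => φ fun l => Y l ω) = fun ω => φ (fill fun l => Y l ω) := by
    funext ω
    refine hdep fun l hl => ?_
    have hlS : l ∈ S := by simpa [S] using hl
    simp only [fill, hlS, dite_true]
  rw [hfill_eq]
  exact (hY.indepFun_finset₀ S {i} (by simp [S]) hm).comp (hφ.comp hfill)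
    (measurable_pi_apply (⟨i, Finset.mem_singleton_self i⟩ : ({i} : Finset ι)))

/-- The sample sequence read off from the tuple of all samples, padded with the batch sample `j₀`
outside the times `2, …, N + 1` at which a sample is drawn. -/
def padSamples {Ξ : Type*} {S₁ N : ℕ} (j₀ : Fin S₁) (w : Fin S₁ ⊕ Finset.Icc 2 (N + 1) → Ξ)
    (t : ℕ) : Ξ :=
  if h : t ∈ Finset.Icc 2 (N + 1) then w (.inr ⟨t, h⟩) else w (.inl j₀)

section Transfer

variable {d : ℕ} {D : Set (Vec d)} {Ω Ξ : Type*} {F : Vec d → Ξ → ℝ} {lam η β βsq : ℝ}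
  {N S₁ : ℕ} {x₁ : Vec d} {batch : Fin S₁ → Ω → Ξ} {ξ : ℕ → Ω → Ξ} {j₀ : Fin S₁}

theorem padSamples_sum_elim {t : ℕ} (ht : t ∈ Finset.Icc 2 (N + 1)) (ω : Ω) :
    padSamples j₀ (fun i => Sum.elim batch (fun t : Finset.Icc 2 (N + 1) => ξ t) i ω) t = ξ t ω :=
  dif_pos ht

theorem dependsOn_oracleState_min {γ : Vec d → Ξ → Vec d} {k : ℕ} (hk : k < N) :
    DependsOn (fun (w : Fin S₁ ⊕ Finset.Icc 2 (N + 1) → Ξ) (j : ℕ) =>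
        oracleState γ η β βsq lam x₁ (fun j => w (.inl j)) (padSamples j₀ w) (min j k))
      {.inr ⟨k + 2, Finset.mem_Icc.2 ⟨by lia, by lia⟩⟩}ᶜ := by
  intro w w' h
  have hbatch : (fun j => w (.inl j)) = fun j => w' (.inl j) := funext fun j => h _ (by simp)
  funext j
  dsimp only
  rw [hbatch]
  refine oracleState_congr_samples fun t h2 ht => ?_
  have ht' : t ∈ Finset.Icc 2 (N + 1) := Finset.mem_Icc.2 ⟨h2, by lia⟩
  simp only [padSamples, ht', dite_true]
  exact h _ (by simp; lia)

theorem state_eq_oracleState_padSamples {ω : Ω}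
    (hseg : ∀ t ∈ Finset.Icc 1 (N + 1),
      segment ℝ (iter F η β βsq lam x₁ (fun j => batch j ω) (fun s => ξ s ω) t)
        (iter F η β βsq lam x₁ (fun j => batch j ω) (fun s => ξ s ω) (t + 1)) ⊆ D)
    {k : ℕ} (hk : k ≤ N) :
    state F η β βsq lam x₁ (fun j => batch j ω) (fun s => ξ s ω) k
      = oracleState (sgradExt D F) η β βsq lam x₁ (fun j => batch j ω)
        (padSamples j₀ fun i => Sum.elim batch (fun t : Finset.Icc 2 (N + 1) => ξ t) i ω) k := by
  have hstate := state_eq_oracleState η β βsq lam F x₁ (fun j => batch j ω) fun s => ξ s ω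
  have hmem : ∀ j ≤ k, (oracleState (sgrad F) η β βsq lam x₁ (fun j => batch j ω)
      (fun s => ξ s ω) j).x ∈ D := fun j hj => by
    rw [← hstate j]
    exact hseg (j + 1) (Finset.mem_Icc.2 ⟨by lia, by lia⟩) (left_mem_segment ℝ _ _)
  rw [hstate k, oracleState_congr_oracle (fun x hx => (sgradExt_of_mem hx).symm) hmem]
  refine oracleState_congr_samples fun t h2 ht => (padSamples_sum_elim ?_ ω).symm
  exact Finset.mem_Icc.2 ⟨h2, by lia⟩

theorem forall_le_and_sum_range_le_iff {a : ℕ → ℝ} {b c : ℝ} :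
    ((∀ k ≤ N, a (k + 1) ≤ b) ∧ ∑ k ∈ Finset.range (N + 1), a (k + 1) ^ 2 ≤ c * (N + 1)) ↔
      (∀ t ∈ Finset.Icc 1 (N + 1), a t ≤ b) ∧
        1 / ((N + 1 : ℕ) : ℝ) * ∑ t ∈ Finset.Icc 1 (N + 1), a t ^ 2 ≤ c := by
  have hsum : ∑ t ∈ Finset.Icc 1 (N + 1), a t ^ 2 = ∑ k ∈ Finset.range (N + 1), a (k + 1) ^ 2 := by
    rw [Finset.range_eq_Ico, Finset.sum_Ico_add' (fun t => a t ^ 2) 0 (N + 1) 1]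
    rfl
  rw [hsum, one_div_mul_eq_div, div_le_iff₀ (by positivity), Nat.cast_succ]
  refine and_congr_left' ⟨fun h t ht => ?_, fun h k hk => h (k + 1) (by simp [hk])⟩
  obtain ⟨h1, hN⟩ := Finset.mem_Icc.1 ht
  simpa only [Nat.sub_add_cancel h1] using h (t - 1) (by lia)

variable [MeasurableSpace Ω] [MeasurableSpace Ξ] {μ : Measure Ω} {P : Measure Ξ}
  {f : Vec d → ℝ} {δ ε ρ σ L₀ Lρ G : ℝ}

theorem measurable_padSamples (j₀ : Fin S₁) :
    Measurable (padSamples (Ξ := Ξ) (N := N) j₀) := by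
  refine measurable_pi_iff.2 fun t => ?_
  by_cases h : t ∈ Finset.Icc 2 (N + 1) <;> simp only [padSamples, h, dite_true, dite_false] <;>
    exact measurable_pi_apply _

theorem measurable_oracleState_padSamples {γ : Vec d → Ξ → Vec d}
    (hγ : Measurable (Function.uncurry γ)) (k : ℕ) :
    Measurable fun w : Fin S₁ ⊕ Finset.Icc 2 (N + 1) → Ξ =>
      oracleState γ η β βsq lam x₁ (fun j => w (.inl j)) (padSamples j₀ w) k :=
  measurable_oracleState hγ x₁ (measurable_pi_iff.2 fun _ => measurable_pi_apply _)
    (measurable_padSamples j₀) k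

theorem isRun_of_iIndepFun (hp : Problem D f P F ρ σ L₀ Lρ) (j₀ : Fin S₁)
    (hbatch : ∀ j, HasLaw (batch j) P μ) (hξ : ∀ t ∈ Finset.Icc 2 (N + 1), HasLaw (ξ t) P μ)
    (hind : iIndepFun (Sum.elim batch (fun t : Finset.Icc 2 (N + 1) => ξ t)) μ) :
    IsRun μ P D F η β βsq lam x₁ N batch
      (fun t ω => padSamples j₀
        (fun i => Sum.elim batch (fun t : Finset.Icc 2 (N + 1) => ξ t) i ω) t)
      (fun ω => oracleState (sgradExt D F) η β βsq lam x₁ (fun j => batch j ω)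
        (padSamples j₀ fun i => Sum.elim batch (fun t : Finset.Icc 2 (N + 1) => ξ t) i ω)) := by
  set Y := Sum.elim batch (fun t : Finset.Icc 2 (N + 1) => ξ t)
  have hY : ∀ i, AEMeasurable (Y i) μ :=
    Sum.rec (fun j => (hbatch j).aemeasurable) fun t => (hξ t t.2).aemeasurable
  have hsample : ∀ k (hk : k < N), (fun ω => padSamples j₀ (fun i => Y i ω) (k + 2))
      = Y (.inr ⟨k + 2, Finset.mem_Icc.2 ⟨by lia, by lia⟩⟩) := fun k hk =>
    funext fun ω => padSamples_sum_elim (Finset.mem_Icc.2 ⟨by lia, by lia⟩) ω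
  have hstate := measurable_oracleState_padSamples (N := N) (η := η) (β := β) (βsq := βsq)
    (lam := lam) (x₁ := x₁) (j₀ := j₀) hp.measurable_sgradExt
  exact
    { eq_oracleState := fun _ => rfl
      aemeasurable := (measurable_pi_iff.2 hstate).comp_aemeasurable (aemeasurable_pi_lambda _ hY)
      hasLaw_batch := hbatch
      indepFun_batch := fun i j hij => hind.indepFun (Sum.inl_injective.ne hij)
      hasLaw_sample := fun k hk => by
        rw [hsample k hk]
        exact hξ (k + 2) (Finset.mem_Icc.2 ⟨by lia, by lia⟩)
      indepFun_past := fun k hk => by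
        rw [hsample k hk]
        exact indepFun_of_dependsOn_compl hind hY (j := .inl j₀) Sum.inl_ne_inr
          (measurable_pi_iff.2 fun j => hstate (min j k)) (dependsOn_oracleState_min hk) }

theorem convergence [IsProbabilityMeasure μ] (hp : Problem D f P F ρ σ L₀ Lρ)
    (hr : RunRegime δ ε ρ σ L₀ Lρ lam G η β (initGap D f x₁) N S₁) (hx₁ : x₁ ∈ D)
    (hg₁ : 2 * ‖gradient f x₁‖ ≤ G) (hβ0 : 0 ≤ βsq) (hβ1 : βsq ≤ 1)
    (hbatch : ∀ j, HasLaw (batch j) P μ) (hξ : ∀ t ∈ Finset.Icc 2 (N + 1), HasLaw (ξ t) P μ)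
    (hind : iIndepFun (Sum.elim batch (fun t : Finset.Icc 2 (N + 1) => ξ t)) μ)
    (hseg : ∀ t ∈ Finset.Icc 1 (N + 1), ∀ᵐ ω ∂μ,
      segment ℝ (iter F η β βsq lam x₁ (fun j => batch j ω) (fun s => ξ s ω) t)
        (iter F η β βsq lam x₁ (fun j => batch j ω) (fun s => ξ s ω) (t + 1)) ⊆ D) :
    1 - δ ≤ μ.real {ω |
      (∀ t ∈ Finset.Icc 1 (N + 1), ‖gradient f
        (iter F η β βsq lam x₁ (fun j => batch j ω) (fun s => ξ s ω) t)‖ ≤ G) ∧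
      (1 / ((N + 1 : ℕ) : ℝ)) * ∑ t ∈ Finset.Icc 1 (N + 1), ‖gradient f
        (iter F η β βsq lam x₁ (fun j => batch j ω) (fun s => ξ s ω) t)‖ ^ 2 ≤ ε ^ 2} := by
  let j₀ : Fin S₁ := ⟨0, Nat.pos_of_ne_zero hr.batch_ne_zero⟩
  have : IsProbabilityMeasure P := by
    rw [← (hbatch j₀).map_eq]
    exact Measure.isProbabilityMeasure_map (hbatch j₀).aemeasurable
  have hseg := (Finset.eventually_all _).2 hseg
  have hstate := hseg.mono fun ω hω k (hk : k ≤ N) =>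
    state_eq_oracleState_padSamples (j₀ := j₀) hω hk
  have hsuccess := (isRun_of_iIndepFun (η := η) (β := β) (βsq := βsq) (lam := lam) (x₁ := x₁) hp j₀
    hbatch hξ hind).one_sub_le_measureReal hp hr hx₁ hg₁ hβ0 hβ1 <| by
      filter_upwards [hseg, hstate] with ω hω heq k hk
      rw [← heq k hk]
      exact hω (k + 1) (Finset.mem_Icc.2 ⟨by lia, by lia⟩)
  refine hsuccess.trans (ENNReal.toReal_mono (measure_ne_top _ _) (measure_mono_ae ?_))
  filter_upwards [hstate] with ω hω ⟨hle, hsum⟩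
  refine forall_le_and_sum_range_le_iff.1 ⟨fun k hk => ?_, ?_⟩
  · rw [iter, Nat.add_sub_cancel, hω k hk]
    exact hle k hk
  · refine (Finset.sum_congr rfl fun k hk => ?_).trans_le hsum
    rw [iter, Nat.add_sub_cancel, hω k (Finset.mem_range_succ_iff.1 hk)]

end Transfer

section Parameters

variable {c C δ ρ lam σ L₀ Lρ Δ g₁ ε G η β : ℝ} {T S₁ : ℕ}

theorem mul_le_of_ofReal_le_div {x a b : ℝ} (ha : 0 ≤ a) (hb : 0 ≤ b)
    (h : ENNReal.ofReal x ≤ ENNReal.ofReal a / ENNReal.ofReal b) : x * b ≤ a := by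
  rcases hb.eq_or_lt with rfl | hb
  · simpa using ha
  · rw [← ENNReal.ofReal_div_of_pos hb, ENNReal.ofReal_le_ofReal_iff (by positivity)] at h
    exact (le_div_iff₀ hb).1 h

theorem inv_ofReal_le_natCast_iff {x : ℝ} {n : ℕ} :
    (ENNReal.ofReal x)⁻¹ ≤ n ↔ 0 < x ∧ x⁻¹ ≤ n := by
  rcases lt_or_ge 0 x with hx | hx
  · rw [← ENNReal.ofReal_inv_of_pos hx, ← ENNReal.ofReal_natCast,
      ENNReal.ofReal_le_ofReal_iff n.cast_nonneg]
    exact (and_iff_right hx).symm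
  · simp [ENNReal.ofReal_of_nonpos hx, hx.not_gt]

theorem isShort_of_ofReal_le_effR {R : ℝ} (hL₀ : 0 ≤ L₀) (hLρ : 0 ≤ Lρ) (hG : 0 < G)
    (h : ENNReal.ofReal (2 * R) ≤ effR ρ L₀ Lρ G) : IsShort ρ L₀ Lρ G R := by
  obtain ⟨hgrad, hbalance⟩ := le_min_iff.1 h
  rw [← one_div, ← ENNReal.ofReal_one] at hgrad
  refine ⟨?_, fun hρ h0 => ?_⟩
  · have hle := mul_le_of_ofReal_le_div zero_le_one (by positivity) hgrad
    rw [Real.rpow_sub_one hG.ne'] at hle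
    calc 10 * (R * (Lρ * G ^ ρ)) = 2 * R * (5 * Lρ * (G ^ ρ / G)) * G := by
          field_simp
          ring
      _ ≤ 1 * G := mul_le_mul_of_nonneg_right hle hG.le
      _ = G := one_mul G
  · rw [if_neg (not_or.2 ⟨hρ, h0⟩), ← one_div, ← ENNReal.ofReal_one] at hbalance
    linarith [mul_le_of_ofReal_le_div zero_le_one (by positivity) hbalance]

namespace LargeG

theorem mul_rpow_le (h : LargeG C δ ρ lam σ L₀ Lρ Δ g₁ G) (hC : 0 ≤ C) (hδ : 0 < δ) (hρ1 : ρ < 1)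
    (hlam : 0 < lam) (hLρ : 0 ≤ Lρ) (hΔ : 0 ≤ Δ) : C * Δ * Lρ * G ^ ρ ≤ G * (δ * lam) := by
  have hG := h.pos
  have hle : C * Δ * Lρ / (δ * lam) ≤ G ^ (1 - ρ) := by
    have hρ : 0 < 1 - ρ := by linarith
    rw [← Real.rpow_inv_le_iff_of_pos (by positivity) hG.le hρ, ← one_div]
    exact h.rho_le
  calc C * Δ * Lρ * G ^ ρ ≤ G ^ (1 - ρ) * (δ * lam) * G ^ ρ :=
        mul_le_mul_of_nonneg_right ((div_le_iff₀ (by positivity)).1 hle) (by positivity)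
    _ = G ^ (1 - ρ) * G ^ ρ * (δ * lam) := by ring
    _ = G * (δ * lam) := by rw [← Real.rpow_add hG, sub_add_cancel, Real.rpow_one]

theorem mul_effL_le (h : LargeG C δ ρ lam σ L₀ Lρ Δ g₁ G) (hC : 0 ≤ C) (hδ : 0 < δ) (hρ1 : ρ < 1)
    (hlam : 0 < lam) (hLρ : 0 ≤ Lρ) (hΔ : 0 ≤ Δ) :
    C * (effL ρ L₀ Lρ G * Δ) ≤ 7 * (G * δ * lam) := by
  have hL₀ : C * Δ * L₀ ≤ G * (δ * lam) := (div_le_iff₀ (by positivity)).1 h.zero_le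
  unfold effL
  linarith [h.mul_rpow_le hC hδ hρ1 hlam hLρ hΔ]

end LargeG

theorem sq_mul_rpow_mul_pow {a : ℝ} (hG : 0 ≤ G) (hlam : 0 < lam) :
    (40 * a * √G * lam ^ (-(3 / 2) : ℝ)) ^ 2 * η ^ 2 * lam ^ 3 = 1600 * a ^ 2 * G * η ^ 2 := by
  have hpow : (lam ^ (-(3 / 2) : ℝ)) ^ 2 * lam ^ 3 = 1 := by
    rw [← Real.rpow_natCast, ← Real.rpow_natCast lam, ← Real.rpow_mul hlam.le,
      ← Real.rpow_add hlam]
    norm_num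
  calc _ = 1600 * a ^ 2 * √G ^ 2 * η ^ 2 * ((lam ^ (-(3 / 2) : ℝ)) ^ 2 * lam ^ 3) := by ring
    _ = _ := by rw [hpow, Real.sq_sqrt hG, mul_one]

namespace Choice

theorem mul_le_of_stepBound_le (h : Choice c C δ ρ lam σ L₀ Lρ Δ ε G η β T S₁) (hc : 0 ≤ c)
    {a b : ℝ} (ha : 0 ≤ a) (hb : 0 ≤ b)
    (hle : stepBound δ ρ lam σ L₀ Lρ Δ ε G ≤ ENNReal.ofReal a / ENNReal.ofReal b) :
    η * b ≤ c * a := by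
  refine mul_le_of_ofReal_le_div (mul_nonneg hc ha) hb ?_
  rw [ENNReal.ofReal_mul hc, mul_div_assoc]
  exact h.eta_le.trans (mul_le_mul_right hle _)

theorem isShort (h : Choice c C δ ρ lam σ L₀ Lρ Δ ε G η β T S₁) (hc : 0 ≤ c) (hc4 : 4 * c ≤ 1)
    (hlam : 0 < lam) (hL₀ : 0 ≤ L₀) (hLρ : 0 ≤ Lρ) (hG : 0 < G) :
    IsShort ρ L₀ Lρ G (2 * (η * G) / lam) := by
  refine isShort_of_ofReal_le_effR hL₀ hLρ hG ?_
  have hη : ENNReal.ofReal η ≤ ENNReal.ofReal c * (effR ρ L₀ Lρ G * ENNReal.ofReal (lam / G)) :=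
    h.eta_le.trans (mul_le_mul_right ((min_le_left _ _).trans (min_le_left _ _)) _)
  calc ENNReal.ofReal (2 * (2 * (η * G) / lam)) = ENNReal.ofReal (4 * G / lam * η) := by
        congr 1
        ring
    _ ≤ ENNReal.ofReal (4 * G / lam)
        * (ENNReal.ofReal c * (effR ρ L₀ Lρ G * ENNReal.ofReal (lam / G))) := by
        rw [ENNReal.ofReal_mul (by positivity)]
        exact mul_le_mul_right hη _
    _ = ENNReal.ofReal (4 * c) * effR ρ L₀ Lρ G := by
        have hcancel : 4 * c = 4 * G / lam * c * (lam / G) := by field_simp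
        rw [hcancel, ENNReal.ofReal_mul (by positivity), ENNReal.ofReal_mul (by positivity)]
        ring
    _ ≤ effR ρ L₀ Lρ G := mul_le_of_le_one_left' (ENNReal.ofReal_le_one.2 hc4)

theorem beta_pos (h : Choice c C δ ρ lam σ L₀ Lρ Δ ε G η β T S₁) : 0 < β := by
  have hprod := (inv_ofReal_le_natCast_iff.1 h.batch_le).1
  have hβ : 0 ≤ β := h.beta_eq ▸ by positivity
  refine hβ.lt_of_ne' fun h0 => ?_
  simp [h0] at hprod

theorem T_pos (h : Choice c C δ ρ lam σ L₀ Lρ Δ ε G η β T S₁) : 0 < T := by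
  have hprod := (inv_ofReal_le_natCast_iff.1 h.batch_le).1
  refine Nat.pos_of_ne_zero fun h0 => ?_
  simp [h0] at hprod

theorem batch_ne_zero (h : Choice c C δ ρ lam σ L₀ Lρ Δ ε G η β T S₁) : S₁ ≠ 0 := by
  obtain ⟨hprod, hS⟩ := inv_ofReal_le_natCast_iff.1 h.batch_le
  exact Nat.cast_ne_zero.1 ((inv_pos.2 hprod).trans_le hS).ne'

theorem one_div_batch_le (h : Choice c C δ ρ lam σ L₀ Lρ Δ ε G η β T S₁) :
    1 / (S₁ : ℝ) ≤ 2 * β ^ 2 * T := by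
  obtain ⟨hprod, hS⟩ := inv_ofReal_le_natCast_iff.1 h.batch_le
  exact one_div (S₁ : ℝ) ▸ inv_le_of_inv_le₀ hprod hS

theorem gap_pos (h : Choice c C δ ρ lam σ L₀ Lρ Δ ε G η β T S₁) (hC : 0 < C) (hδ : 0 < δ)
    (hε : 0 < ε) (hG : 0 < G) : 0 < Δ := by
  have hη := h.eta_pos
  have hq := h.T_pos
  rw [h.T_eq, Nat.ceil_pos] at hq
  by_contra! hΔ
  exact hq.not_ge (mul_nonpos_of_nonneg_of_nonpos hC.le
    (div_nonpos_of_nonpos_of_nonneg (mul_nonpos_of_nonneg_of_nonpos hG.le hΔ) (by positivity)))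

theorem le_T (h : Choice c C δ ρ lam σ L₀ Lρ Δ ε G η β T S₁) (hδ : 0 < δ) (hε : 0 < ε) :
    C * (G * Δ / η) ≤ T * δ * ε ^ 2 := by
  have hη := h.eta_pos
  calc C * (G * Δ / η) = C * (G * Δ / (η * δ * ε ^ 2)) * δ * ε ^ 2 := by field_simp
    _ ≤ T * δ * ε ^ 2 := by
      gcongr
      exact h.T_eq ▸ Nat.le_ceil _

theorem T_le (h : Choice c C δ ρ lam σ L₀ Lρ Δ ε G η β T S₁) (hδ : 0 < δ) (hε : 0 < ε)
    (hT : 1 < T) : T * δ * ε ^ 2 ≤ 2 * C * (G * Δ / η) := by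
  have hη := h.eta_pos
  have hq : 1 < C * (G * Δ / (η * δ * ε ^ 2)) := by
    exact_mod_cast Nat.lt_ceil.1 (h.T_eq ▸ hT)
  calc T * δ * ε ^ 2 ≤ 2 * (C * (G * Δ / (η * δ * ε ^ 2))) * δ * ε ^ 2 := by
        gcongr
        exact h.T_eq ▸ Nat.ceil_le_two_mul (by linarith)
    _ = 2 * C * (G * Δ / η) := by field_simp

theorem runRegime (h : Choice (1 / 10 ^ 6) (10 ^ 5) δ ρ lam σ L₀ Lρ Δ ε G η β T S₁)
    (hG : LargeG (10 ^ 5) δ ρ lam σ L₀ Lρ Δ g₁ G) (hδ : 0 < δ) (hρ1 : ρ < 1)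
    (hlam : 0 < lam) (hσ : 0 ≤ σ) (hL₀ : 0 ≤ L₀) (hLρ : 0 ≤ Lρ) (hε : 0 < ε) :
    RunRegime δ ε ρ σ L₀ Lρ lam G η β Δ (T - 1) S₁ := by
  have hGpos := hG.pos
  have hη := h.eta_pos
  have hL := effL_nonneg (ρ := ρ) hL₀ hLρ hGpos.le
  have hΔ := h.gap_pos (by positivity) hδ hε hGpos
  have hT : ((T - 1 : ℕ) : ℝ) + 1 = T := by exact_mod_cast Nat.sub_add_cancel h.T_pos
  have heta_effL : η * effL ρ L₀ Lρ G ≤ 1 / 10 ^ 6 * lam :=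
    h.mul_le_of_stepBound_le (by positivity) hlam.le hL
      ((min_le_left _ _).trans (min_le_right _ _))
  have heta_sigma : η * (σ * G * effL ρ L₀ Lρ G) ≤ 1 / 10 ^ 6 * (lam ^ 2 * √δ * ε) :=
    h.mul_le_of_stepBound_le (by positivity) (by positivity) (by positivity)
      ((min_le_right _ _).trans (min_le_right _ _))
  exact
    { G_pos := hGpos
      lam_pos := hlam
      eta_pos := hη
      lam_le := hG.lam_le
      sigma_le := hG.sigma_le
      short := h.isShort (by positivity) (by norm_num) hlam hL₀ hLρ hGpos
      eta_effL_le := by linarith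
      beta_eq := by
        rw [h.beta_eq]
        exact sq_mul_rpow_mul_pow hGpos.le hlam
      beta_le := h.beta_le
      delta_pos := hδ
      eps_pos := hε
      gap_nonneg := hΔ.le
      beta_pos := h.beta_pos
      batch_ne_zero := h.batch_ne_zero
      eta_sigma_le := by
        refine (pow_le_pow_left₀ (by positivity) heta_sigma 2).trans_eq ?_
        rw [mul_pow, mul_pow, mul_pow, Real.sq_sqrt hδ.le]
        ring
      eta_gap_le := h.mul_le_of_stepBound_le (by positivity) (by positivity) (by positivity)
        ((min_le_right _ _).trans (min_le_left _ _))
      gap_le := hG.mul_effL_le (by positivity) hδ hρ1 hlam hLρ hΔ.le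
      le_T := hT ▸ h.le_T hδ hε
      T_le := fun hN => hT ▸ h.T_le hδ hε (by lia)
      batch_le := hT ▸ h.one_div_batch_le }

end Choice

end Parameters

section Complexity

variable {c C δ ρ lam σ L₀ Lρ Δ ε G : ℝ}

theorem effL_pos (hL₀ : 0 ≤ L₀) (hLρ : 0 ≤ Lρ) (hL : 0 < L₀ + Lρ) (hG : 0 < G) :
    0 < effL ρ L₀ Lρ G := by
  unfold effL
  rcases hL₀.eq_or_lt with rfl | hL₀
  · rw [zero_add] at hL
    positivity
  · positivity

theorem effR_pos : 0 < effR ρ L₀ Lρ G := by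
  refine lt_min (ENNReal.inv_pos.2 ENNReal.ofReal_ne_top) ?_
  split_ifs
  · exact ENNReal.zero_lt_top
  · exact ENNReal.inv_pos.2 ENNReal.ofReal_ne_top

theorem stepBound_pos (hδ : 0 < δ) (hlam : 0 < lam) (hε : 0 < ε) (hG : 0 < G) :
    0 < stepBound δ ρ lam σ L₀ Lρ Δ ε G := by
  have hdiv : ∀ {a b : ℝ}, 0 < a → 0 < ENNReal.ofReal a / ENNReal.ofReal b := fun ha =>
    ENNReal.div_pos (ENNReal.ofReal_pos.2 ha).ne' ENNReal.ofReal_ne_top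
  exact lt_min
    (lt_min (ENNReal.mul_pos effR_pos.ne' (ENNReal.ofReal_pos.2 (div_pos hlam hG)).ne') (hdiv hlam))
    (lt_min (hdiv (by positivity)) (hdiv (by positivity)))

theorem stepBound_ne_top (hL : 0 < effL ρ L₀ Lρ G) : stepBound δ ρ lam σ L₀ Lρ Δ ε G ≠ ∞ := by
  have hle : stepBound δ ρ lam σ L₀ Lρ Δ ε G
      ≤ ENNReal.ofReal lam / ENNReal.ofReal (effL ρ L₀ Lρ G) :=
    (min_le_left _ _).trans (min_le_right _ _)
  exact ne_top_of_le_ne_top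
    (ENNReal.div_ne_top ENNReal.ofReal_ne_top (ENNReal.ofReal_pos.2 hL).ne') hle

theorem ofReal_mul_stepBound_one_le (hε : 0 ≤ ε) (hε1 : ε ≤ 1) :
    ENNReal.ofReal ε * stepBound δ ρ lam σ L₀ Lρ Δ 1 G ≤ stepBound δ ρ lam σ L₀ Lρ Δ ε G := by
  have hself : ∀ a : ℝ≥0∞, ENNReal.ofReal ε * a ≤ a := fun a =>
    mul_le_of_le_one_left' (by simpa using hε1)
  simp only [stepBound, mul_min]
  gcongr ?_ ⊓ ?_ ⊓ (?_ ⊓ ?_)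
  · exact hself _
  · exact hself _
  · exact hself _
  · rw [← mul_div_assoc, ← ENNReal.ofReal_mul hε, mul_one, mul_comm ε]

theorem exists_forall_ofReal_mul_le_stepBound (hc : 0 < c) (hδ : 0 < δ) (hlam : 0 < lam)
    (hG : 0 < G) (hL : 0 < effL ρ L₀ Lρ G) {θ : ℝ} (hθ : 0 < θ) :
    ∃ η₀ > 0, ∀ ε, 0 < ε → ε ≤ 1 → θ * (η₀ * ε) ≤ 1 ∧
      ENNReal.ofReal (η₀ * ε) ≤ ENNReal.ofReal c * stepBound δ ρ lam σ L₀ Lρ Δ ε G := by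
  set s := stepBound δ ρ lam σ L₀ Lρ Δ 1 G
  have hs_top : s ≠ ∞ := stepBound_ne_top hL
  have hs : 0 < s.toReal := ENNReal.toReal_pos (stepBound_pos hδ hlam one_pos hG).ne' hs_top
  refine ⟨min (c * s.toReal) θ⁻¹, by positivity, fun ε hε hε1 => ⟨?_, ?_⟩⟩
  · calc θ * (min (c * s.toReal) θ⁻¹ * ε) ≤ θ * (θ⁻¹ * 1) := by
          gcongr
          exact min_le_right _ _
      _ = 1 := by field_simp
  · calc ENNReal.ofReal (min (c * s.toReal) θ⁻¹ * ε) ≤ ENNReal.ofReal (c * s.toReal * ε) := by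
          gcongr
          exact min_le_left _ _
      _ = ENNReal.ofReal c * (ENNReal.ofReal ε * s) := by
          rw [mul_assoc, ENNReal.ofReal_mul hc.le, ENNReal.ofReal_mul ENNReal.toReal_nonneg,
            ENNReal.ofReal_toReal hs_top, mul_comm s]
      _ ≤ _ := mul_le_mul_right (ofReal_mul_stepBound_one_le hε.le hε1) _

theorem ceil_mul_le_add_one {q u K : ℝ} (hq : 0 ≤ q) (hu : 0 ≤ u) (hu1 : u ≤ 1)
    (h : q * u ≤ K) : ⌈q⌉₊ * u ≤ K + 1 := by
  calc ⌈q⌉₊ * u ≤ (q + 1) * u := by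
        gcongr
        exact (Nat.ceil_lt_add_one hq).le
    _ ≤ K + 1 := by linarith

theorem gradEvals_ceil_le {β q K₁ K₂ : ℝ} (hε : 0 < ε) (hε1 : ε ≤ 1) (hq : 0 < q) (hβ : 0 < β)
    (hK₁ : q * ε ^ 3 = K₁) (hK₂ : 2 * β ^ 2 * q = K₂ * ε) :
    (gradEvals ⌈(2 * β ^ 2 * ⌈q⌉₊)⁻¹⌉₊ ⌈q⌉₊ : ℝ) ≤ (K₂⁻¹ + 1 + 2 * (K₁ + 1)) * ε ^ (-3 : ℤ) := by
  have hε3 : ε ^ 3 ≤ 1 := pow_le_one₀ hε.le hε1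
  have hT : (⌈q⌉₊ : ℝ) * ε ^ 3 ≤ K₁ + 1 := ceil_mul_le_add_one hq.le (by positivity) hε3 hK₁.le
  have hK₂pos : 0 < K₂ := pos_of_mul_pos_left (hK₂ ▸ by positivity) hε.le
  have hS : (⌈(2 * β ^ 2 * ⌈q⌉₊)⁻¹⌉₊ : ℝ) * ε ^ 3 ≤ K₂⁻¹ + 1 := by
    refine ceil_mul_le_add_one (by positivity) (by positivity) hε3 ?_
    calc (2 * β ^ 2 * ⌈q⌉₊)⁻¹ * ε ^ 3 ≤ (2 * β ^ 2 * q)⁻¹ * ε ^ 3 := by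
          gcongr
          exact Nat.le_ceil q
      _ = K₂⁻¹ * ε ^ 2 := by
          rw [hK₂]
          field_simp
      _ ≤ K₂⁻¹ := mul_le_of_le_one_right (by positivity) (pow_le_one₀ hε.le hε1)
  have hevals : (gradEvals ⌈(2 * β ^ 2 * ⌈q⌉₊)⁻¹⌉₊ ⌈q⌉₊ : ℝ)
      ≤ ⌈(2 * β ^ 2 * ⌈q⌉₊)⁻¹⌉₊ + 2 * ⌈q⌉₊ := by
    exact_mod_cast Nat.add_le_add_left (Nat.mul_le_mul_left 2 (Nat.sub_le _ 1)) _
  rw [zpow_neg, ← div_eq_mul_inv, le_div_iff₀ (by positivity)]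
  calc (gradEvals ⌈(2 * β ^ 2 * ⌈q⌉₊)⁻¹⌉₊ ⌈q⌉₊ : ℝ) * ε ^ 3
      ≤ (⌈(2 * β ^ 2 * ⌈q⌉₊)⁻¹⌉₊ + 2 * ⌈q⌉₊) * ε ^ 3 := by gcongr
    _ ≤ _ := by linarith

theorem exists_choice_gradEvals_le (hc : 0 < c) (hC : 0 < C) (hδ : 0 < δ) (hlam : 0 < lam)
    (hL : 0 < effL ρ L₀ Lρ G) (hΔ : 0 < Δ) (hG : 0 < G) :
    ∃ K : ℝ, ∀ ε : ℝ, 0 < ε → ε ≤ 1 → ∃ (η β : ℝ) (T S₁ : ℕ),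
      Choice c C δ ρ lam σ L₀ Lρ Δ ε G η β T S₁ ∧ (gradEvals S₁ T : ℝ) ≤ K * ε ^ (-3 : ℤ) := by
  set θ := 40 * effL ρ L₀ Lρ G * √G * lam ^ (-(3 / 2) : ℝ)
  have hθ : 0 < θ := by positivity
  obtain ⟨η₀, hη₀, hstep⟩ :=
    exists_forall_ofReal_mul_le_stepBound (σ := σ) (Δ := Δ) hc hδ hlam hG hL hθ
  set K₁ := C * (G * Δ / (η₀ * δ)) with hK₁_def
  refine ⟨(2 * (θ ^ 2 * η₀ ^ 2) ^ 2 * K₁)⁻¹ + 1 + 2 * (K₁ + 1), fun ε hε hε1 => ?_⟩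
  set q := C * (G * Δ / (η₀ * ε * δ * ε ^ 2)) with hq
  have hqpos : 0 < q := by positivity
  have hK₁ : q * ε ^ 3 = K₁ := by
    rw [hq, hK₁_def]
    field_simp
  set β := θ ^ 2 * (η₀ * ε) ^ 2 with hβ
  refine ⟨η₀ * ε, β, ⌈q⌉₊, ⌈(2 * β ^ 2 * ⌈q⌉₊)⁻¹⌉₊,
    ⟨by positivity, (hstep ε hε hε1).2, rfl, ?_, rfl,
      inv_ofReal_le_natCast_iff.2 ⟨by positivity, Nat.le_ceil _⟩⟩, ?_⟩
  · rw [hβ, ← mul_pow]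
    exact pow_le_one₀ (by positivity) (hstep ε hε hε1).1
  · exact gradEvals_ceil_le hε hε1 hqpos (by positivity) hK₁ (by rw [← hK₁, hβ]; ring)

end Complexity

end VRAdam

theorem mainTheorem4 :
    ∃ c C : ℝ, 0 < c ∧ 0 < C ∧
      -- convergence with probability at least `1 - δ`
      (∀ (d : ℕ) (D : Set (VRAdam.Vec d)) (f : VRAdam.Vec d → ℝ)
          (Ξ : Type*) [MeasurableSpace Ξ] (P : Measure Ξ) (F : VRAdam.Vec d → Ξ → ℝ)
          (Ω : Type*) [MeasurableSpace Ω] (μ : Measure Ω) [IsProbabilityMeasure μ]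
          (δ ρ lam σ L₀ Lρ ε G η β βsq : ℝ) (T S₁ : ℕ) (x₁ : VRAdam.Vec d)
          (batch : Fin S₁ → Ω → Ξ) (ξ : ℕ → Ω → Ξ),
        0 < δ → δ < 1 → 0 ≤ ρ → ρ < 1 → 0 < lam → 0 ≤ σ → 0 ≤ L₀ → 0 ≤ Lρ → 0 < ε →
        0 ≤ βsq → βsq ≤ 1 →
        -- the objective, bounded below on its domain, and its components
        IsOpen D → x₁ ∈ D → BddBelow (f '' D) →
        VRAdam.GenSmoothOn D ρ L₀ Lρ f →
        (∀ z : Ξ, VRAdam.GenSmoothOn D ρ L₀ Lρ (fun x => F x z)) →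
        -- unbiased stochastic gradients with bounded noise
        (∀ x ∈ D, Measurable (VRAdam.sgrad F x)) →
        (∀ x ∈ D, ∫ z, VRAdam.sgrad F x z ∂P = gradient f x) →
        (∀ x ∈ D, ∀ᵐ z ∂P, ‖VRAdam.sgrad F x z - gradient f x‖ ≤ σ) →
        -- the initial batch and the samples `ξ_2, …, ξ_T` are i.i.d. with law `P`
        (∀ j, HasLaw (batch j) P μ) →
        (∀ t ∈ Finset.Icc 2 T, HasLaw (ξ t) P μ) →
        iIndepFun (Sum.elim batch (fun t : Finset.Icc 2 T => ξ t)) μ →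
        -- the parameters
        VRAdam.LargeG C δ ρ lam σ L₀ Lρ (VRAdam.initGap D f x₁) ‖gradient f x₁‖ G →
        VRAdam.Choice c C δ ρ lam σ L₀ Lρ (VRAdam.initGap D f x₁) ε G η β T S₁ →
        -- the run stays in the domain (no condition if `D = ℝ^d`)
        (∀ t ∈ Finset.Icc 1 T, ∀ᵐ ω ∂μ,
          segment ℝ (VRAdam.iter F η β βsq lam x₁ (fun j => batch j ω) (fun s => ξ s ω) t)
            (VRAdam.iter F η β βsq lam x₁ (fun j => batch j ω) (fun s => ξ s ω) (t + 1)) ⊆ D) →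
        1 - δ ≤ μ.real {ω |
          (∀ t ∈ Finset.Icc 1 T, ‖gradient f
            (VRAdam.iter F η β βsq lam x₁ (fun j => batch j ω) (fun s => ξ s ω) t)‖ ≤ G) ∧
          (1 / (T : ℝ)) * ∑ t ∈ Finset.Icc 1 T, ‖gradient f
            (VRAdam.iter F η β βsq lam x₁ (fun j => batch j ω) (fun s => ξ s ω) t)‖ ^ 2
              ≤ ε ^ 2}) ∧
      -- dimension-free gradient complexity `O(ε⁻³)`
      (∀ δ ρ lam σ L₀ Lρ Δ g₁ G : ℝ,
        0 < δ → δ < 1 → 0 ≤ ρ → ρ < 1 → 0 < lam → 0 ≤ σ → 0 ≤ L₀ → 0 ≤ Lρ → 0 < L₀ + Lρ →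
        0 < Δ → VRAdam.LargeG C δ ρ lam σ L₀ Lρ Δ g₁ G →
        ∃ K : ℝ, ∀ ε : ℝ, 0 < ε → ε ≤ 1 → ∃ (η β : ℝ) (T S₁ : ℕ),
          VRAdam.Choice c C δ ρ lam σ L₀ Lρ Δ ε G η β T S₁ ∧
          (VRAdam.gradEvals S₁ T : ℝ) ≤ K * ε ^ (-3 : ℤ)) := by
  refine ⟨1 / 10 ^ 6, 10 ^ 5, by positivity, by positivity, ?_, ?_⟩
  · intro d D f Ξ _ P F Ω _ μ _ δ ρ lam σ L₀ Lρ ε G η β βsq T S₁ x₁ batch ξ hδ _ hρ hρ1 hlam hσ hL₀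
      hLρ hε hβ0 hβ1 hD hx₁ hbdd hf hF hmeas hmean hnoise hbatch hξ hind hG hch hseg
    have hp : VRAdam.Problem D f P F ρ σ L₀ Lρ :=
      ⟨hρ, hρ1.le, hL₀, hLρ, hD, hbdd, hf, hF, hmeas, hmean, hnoise⟩
    have hr := hch.runRegime hG hδ hρ1 hlam hσ hL₀ hLρ hε
    obtain ⟨N, rfl⟩ : ∃ N, T = N + 1 := ⟨T - 1, (Nat.sub_add_cancel hch.T_pos).symm⟩
    exact VRAdam.convergence hp hr hx₁ hG.grad_le hβ0 hβ1 hbatch hξ hind hseg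
  · intro δ ρ lam σ L₀ Lρ Δ g₁ G hδ _ _ _ hlam _ hL₀ hLρ hL hΔ hG
    exact VRAdam.exists_choice_gradEvals_le (by positivity) (by positivity) hδ hlam
      (VRAdam.effL_pos hL₀ hLρ hL hG.pos) hΔ hG.pos
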